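/- **Conventions.** All objects depend on a security parameter $\lambda\in\mathbb N$, and all strings and registers have length polynomial in $\lambda$. "Efficient" / "quantum polynomial-time" means: computed by a family (one circuit for each $\lambda$) of quantum circuits with polynomially many ancillas and gates, each gate a unitary on at most three qubits; deterministic classical algorithms use reversible classical gates only, and probabilistic ones are deterministic functions of polynomially many uniform coins. Negligible means decaying faster than every inverse polynomial. Two families of distributions $D_{0,\lambda},D_{1,\lambda}$ are computationally indistinguishable if for every quantum polynomial-time $\mathcal A$ there is a negligible $\mu$ with $|\Pr_{x\leftarrow D_{0,\lambda}}[\mathcal A(x)=0]-\Pr_{x\leftarrow D_{1,\lambda}}[\mathcal A(x)=0]|\le\mu(\lambda)$ for all $\lambda$. **Function families.** $\mathcal X,\mathcal Y$ are finite sets of strings, $\mathcal X\neq\emptyset$. $\mathcal F$ is an *extended trapdoor claw-free family* and $\mathcal G$ a corresponding *trapdoor injective family*, that is: * $\mathcal F$ (noisy trapdoor claw-free): for keys $k\in\mathcal K_{\mathcal F}$ and $b\in\{0,1\}$, $f_{k,b}(x)$ and $f'_{k,b}(x)$ ($x\in\mathcal X$) are probability densities on $\mathcal Y$. An efficient probabilistic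 $\mathrm{GEN}_{\mathcal F}$ outputs $(k,t_k)$. For each $k,b$ the supports of the $f_{k,b}(x)$ are disjoint for distinct $x$, and an efficient deterministic $\mathrm{INV}_{\mathcal F}(t_k,b,y)$ returns $x$ whenever $y\in\mathrm{Supp} f_{k,b}(x)$. $\mathcal R_k=\{(x_0,x_1): f_{k,0}(x_0)=f_{k,1}(x_1)\}$ is a perfect matching of $\mathcal X$ with $\mathcal X$; for $(x_0,x_1)\in\mathcal R_k$ and $y\in\mathrm{Supp}f'_{k,b}(x_b)$, $\mathrm{INV}_{\mathcal F}(t_k,c,y)=x_c$ for both $c$. An efficient deterministic $\mathrm{CHK}(k,b,x,y)$ decides $y\in\mathrm{Supp} f'_{k,b}(x)$. The average over $x\in\mathcal X$ of $1-\sum_y\sqrt{f_{k,b}(x)(y)f'_{k,b}(x)(y)}$ is at most a negligible function, and an efficient $\mathrm{SAMP}(k,b)$ prepares $|\mathcal X|^{-1/2}\sum_{x,y}\sqrt{f'_{k,b}(x)(y)}\,|x\rangle|y\rangle$. Adaptive hardcore bit: for some polynomially bounded $w$ there are sets $G_{k,b,x}\subseteq\{0,1\}^w$ whose complements have negligible density,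 with membership efficiently checkable given $t_k$, and an efficient, efficiently invertible injection $J:\mathcal X\to\{0,1\}^w$, such that for every quantum polynomial-time $\mathcal A$ the difference $|\Pr[\mathcal A(k)\in H_k]-\Pr[\mathcal A(k)\in\overline H_k]|$ over $(k,t_k)\leftarrow\mathrm{GEN}_{\mathcal F}$ is negligible, where $H_k=\{(b,x_b,d,d\cdot(J(x_0)\oplus J(x_1))):(x_0,x_1)\in\mathcal R_k,\ d\in G_{k,0,x_0}\cap G_{k,1,x_1}\}$ and $\overline H_k$ is $H_k$ with the last bit flipped. * $\mathcal G$ (trapdoor injective): densities $g_{k,b}(x)$ on $\mathcal Y$ ($k\in\mathcal K_{\mathcal G}$) with disjoint supports for distinct $(b,x)$; efficient $\mathrm{GEN}_{\mathcal G}$ and $\mathrm{INV}_{\mathcal G}$ with $\mathrm{INV}_{\mathcal G}(t_k,y)=(b,x)$ for $y\in\mathrm{Supp}\,g_{k,b}(x)$; efficient $\mathrm{CHK}$ and $\mathrm{SAMP}$ as above with $g$ in place of $f'$. * Injective invariance: the algorithms $\mathrm{CHK}$ and $\mathrm{SAMP}$ of $\mathcal F$ and $\mathcal G$ are the same, and for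 every quantum polynomial-time $\mathcal A$ the probabilities of $\mathcal A(k)=0$ for $k$ generated by $\mathrm{GEN}_{\mathcal F}$ and by $\mathrm{GEN}_{\mathcal G}$ differ by a negligible amount. * Second hardcore condition: for every quantum polynomial-time $\mathcal A$ there are a negligible $\mu$ and strings $d\in\{0,1\}^w$ with $|\Pr_{(k,t_k)\leftarrow\mathrm{GEN}_{\mathcal F}}[\mathcal A(k)\in\{d\cdot(J(x_0)\oplus J(x_1)):(x_0,x_1)\in\mathcal R_k\}]-\tfrac12|\le\mu$. **Protocol.** Let $n=n(\lambda)$ be polynomially bounded and $h\in\{0,1\}^n$. For each $i$ the verifier samples $(k_i,t_{k_i})$ from $\mathrm{GEN}_{\mathcal F}$ if $h_i=1$ and from $\mathrm{GEN}_{\mathcal G}$ if $h_i=0$, and sends $k'=(k_1,\dots,k_n)$. A prover $\mathbb P$ characterized by $(U_0,\mathcal S)$ ($U_0$ an efficient unitary controlled by the register holding $k'$, $\mathcal S$ an efficient CPTP map) has $n$ committed qubits, $n$ preimage registers, $n$ commitment string registers and auxiliary qubits. He applies $U_0$ to $|0\rangle|k'\rangle$, measures the commitment string registers and reports the result $(y_1,\dots,y_n)$.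 In a test round he measures the committed qubits and preimage registers in the standard basis, and the verifier accepts if the results $b_i'\in\{0,1\}$, $x_i'\in\mathcal X$ and $y_i\in\mathcal Y$ satisfy $\mathrm{CHK}(k_i,b'_i,x'_i,y_i)=1$ for all $i$. In a Hadamard round he applies to each preimage register (with appended zero qubits) the unitary $U_J:|x\rangle|0\rangle\mapsto|J(x)\rangle|0\rangle$, then $\mathcal S$ to his entire state, then measures the committed qubits and preimage registers in the Hadamard basis and reports $b_i'\in\{0,1\}$, $d_i\in\{0,1\}^w$. The verifier stores: if $h_i=0$, the first component $m_i$ of $\mathrm{INV}_{\mathcal G}(t_{k_i},y_i)$ (a random bit if there is no inverse); if $h_i=1$, $m_i=b_i'\oplus d_i\cdot(J(x_{0,y_i})\oplus J(x_{1,y_i}))$ with $x_{c,y_i}=\mathrm{INV}_{\mathcal F}(t_{k_i},c,y_i)$, or a random bit if an inverse does not exist or $d_i\notin G_{k_i,0,x_{0,y_i}}\cap G_{k_i,1,x_{1,y_i}}$ according to the check with $t_{k_i}$. $D_{\mathbb P,h}$ is the distribution of $m\in\{0,1\}^n$ in a Hadamard round. $\mathbb P$ is *trivial* if for all $\lambda$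 and $h$ he is accepted in the test round with probability $1$, and $\mathcal S$ commutes with the standard basis measurement of the $n$ committed qubits: $\Pi_b\mathcal S(\sigma)\Pi_b=\mathcal S(\Pi_b\sigma\Pi_b)$ for every $\sigma$ and every outcome $b\in\{0,1\}^n$. For an $n$-qubit state $\rho$, $D_{\rho,h}$ is the distribution of the results of measuring qubit $i$ of $\rho$ in the standard basis if $h_i=0$ and in the Hadamard basis if $h_i=1$. **Claim.** For every trivial prover $\mathbb P$ there is an $n$-qubit state $\rho$ (one for each $\lambda$), which can be created by an efficient quantum circuit, such that for all basis choices $h\in\{0,1\}^n$ (for each $\lambda$) the distribution $D_{\mathbb P,h}$ is computationally indistinguishable from $D_{\rho,h}$. Moreover $\rho$ can be taken to be the following state: sample all $(k_i,t_{k_i})$ from $\mathrm{GEN}_{\mathcal F}$; run $\mathbb P$ on $k'$ up to and including $\mathcal S$ in the Hadamard round; measure the preimage registers in the Hadamard basis to obtain $d_1,\dots,d_n$; for each $i$ apply $Z^{c_i}$ to the $i$-th committed qubit, where $c_i=d_i\cdot(J(x_{0,y_i})\oplus J(x_{1,y_i}))$ is computed with the trapdoor, and $c_i$ is a uniformly random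 bit if an inverse does not exist or the check of $d_i$ fails; trace out everything but the $n$ committed qubits. -/

import Mathlib

open scoped Matrix BigOperators ComplexOrder

noncomputable section

namespace MeasProtocol

/-! ## Strings, negligible functions, polynomial bounds -/

/-- Bit strings of length `m`. -/
abbrev Bits (m : ℕ) : Type := Fin m → Bool

/-- Bitwise exclusive or. -/
def xorBits {m : ℕ} (x y : Bits m) : Bits m := fun j => xor (x j) (y j)

/-- The inner product `d · v` modulo 2. -/
def dot {m : ℕ} (d v : Bits m) : Bool :=
  decide (Odd (Finset.univ.filter fun j => d j = true ∧ v j = true).card)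

/-- `μ` is negligible: it decays faster than every inverse polynomial. -/
def Negligible (μ : ℕ → ℝ) : Prop :=
  Asymptotics.SuperpolynomialDecay Filter.atTop (fun l : ℕ => (l : ℝ)) μ

def PolyBounded (s : ℕ → ℕ) : Prop :=
  ∃ p : Polynomial ℕ, ∀ l, s l ≤ p.eval l

/-! ## Quantum circuits

Registers are finite sets `ι` of qubits; the computational basis of such a register is
`ι → Bool`. -/

/-- Operators (in particular density matrices) on the qubits labelled by `ι`. -/
abbrev Op (ι : Type) : Type := Matrix (ι → Bool) (ι → Bool) ℂ

/-- `|x⟩⟨x|`. -/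
def ketbra {ι : Type} [DecidableEq ι] [Fintype ι] (x : ι → Bool) : Op ι := Matrix.single x x 1

/-- An elementary gate: a unitary acting on at most three of the qubits. -/
structure Gate (ι : Type) where
  arity : ℕ
  arity_le : arity ≤ 3
  wires : Fin arity ↪ ι
  mat : Matrix (Bits arity) (Bits arity) ℂ
  unitary : mat ∈ Matrix.unitaryGroup (Bits arity) ℂ

/-- A classical (reversible) gate: a permutation of at most three bits, such as NOT, CNOT or
Toffoli. -/
def Gate.IsClassical {ι : Type} (g : Gate ι) : Prop :=
  ∃ σ : Equiv.Perm (Bits g.arity), g.mat = σ.permMatrix ℂ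

open Classical in
/-- The gate, tensored with the identity on the other qubits. -/
def Gate.toOp {ι : Type} (g : Gate ι) : Op ι := fun x y =>
  if ∀ i, i ∉ Set.range g.wires → x i = y i then g.mat (x ∘ g.wires) (y ∘ g.wires) else 0

/-- A circuit; the head of the list is the gate that is applied first. -/
abbrev Circuit (ι : Type) : Type := List (Gate ι)

def Circuit.toOp {ι : Type} [DecidableEq ι] [Fintype ι] : Circuit ι → Op ι
  | [] => 1
  | g :: C => Circuit.toOp C * g.toOp

open Classical in
/-- Partial trace over all qubits outside the range of `e`. -/
def traceOut {ι κ : Type} [DecidableEq ι] [Fintype ι] (e : κ ↪ ι) (σ : Op ι) : Op κ :=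
  fun z z' => ∑ u : ι → Bool, ∑ v : ι → Bool,
    if u ∘ e = z ∧ v ∘ e = z' ∧ ∀ i, i ∉ Set.range e → u i = v i then σ u v else 0

/-- `ρ ⊗ |0⟩⟨0|`. -/
def appendZeros {ι : Type} {a : ℕ} (ρ : Op ι) : Op (ι ⊕ Fin a) := fun u v =>
  if (∀ j, u (Sum.inr j) = false) ∧ (∀ j, v (Sum.inr j) = false)
  then ρ (u ∘ Sum.inl) (v ∘ Sum.inl) else 0

/-- A quantum procedure from the qubits `ι` to the qubits `κ`: append `anc` qubits in state `0`,
run a circuit, keep the qubits selected by `out` and discard all others. -/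
structure QProc (ι κ : Type) where
  anc : ℕ
  circ : Circuit (ι ⊕ Fin anc)
  out : κ ↪ ι ⊕ Fin anc

section QProc
variable {ι κ : Type} [DecidableEq ι] [Fintype ι]

/-- The CPTP map computed by a quantum procedure. -/
def QProc.apply (A : QProc ι κ) (ρ : Op ι) : Op κ :=
  traceOut A.out (Circuit.toOp A.circ * appendZeros ρ * (Circuit.toOp A.circ)ᴴ)

/-- The probability that `A`, run on the classical input `x` and measured in the standard basis,
outputs `z`. -/
def QProc.prob (A : QProc ι κ) (x : ι → Bool) (z : κ → Bool) : ℝ :=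
  (A.apply (ketbra x) z z).re

end QProc

/-- A family of procedures, indexed by the security parameter, is quantum polynomial-time if its
circuits have polynomially many gates and auxiliary qubits. -/
def QPT {ι κ : ℕ → Type} (A : ∀ l, QProc (ι l) (κ l)) : Prop :=
  PolyBounded fun l => (A l).anc + (A l).circ.length

/-- The family of functions `f` is computed by an efficient deterministic (classical)
procedure. -/
def EfficientFun {ι κ : ℕ → Type} [∀ l, DecidableEq (ι l)] [∀ l, Fintype (ι l)]
    [∀ l, DecidableEq (κ l)] [∀ l, Fintype (κ l)]
    (f : ∀ l, (ι l → Bool) → (κ l → Bool)) : Prop :=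
  ∃ A : ∀ l, QProc (ι l) (κ l), QPT A ∧ (∀ l, ∀ g ∈ (A l).circ, g.IsClassical) ∧
    ∀ l x, (A l).apply (ketbra x) = ketbra (f l x)

def IsDensityMatrix {ι : Type} [DecidableEq ι] [Fintype ι] (ρ : Op ι) : Prop :=
  ρ.PosSemidef ∧ ρ.trace = 1

/-- The family of states `ρ` can be created by polynomial-size quantum circuits. -/
def EfficientlyPreparable {ι : ℕ → Type} (ρ : ∀ l, Op (ι l)) : Prop :=
  ∃ A : ∀ l, QProc Empty (ι l), QPT A ∧ ∀ l, ρ l = (A l).apply (ketbra fun i => i.elim)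

/-- Computational indistinguishability of two families of distributions on strings. -/
def CompIndist {n : ℕ → ℕ} (D₀ D₁ : ∀ l, Bits (n l) → ℝ) : Prop :=
  ∀ A : ∀ l, QProc (Fin (n l)) Unit, QPT A → ∃ μ : ℕ → ℝ, Negligible μ ∧ ∀ l,
    |∑ x, D₀ l x * (A l).prob x (fun _ => false) - ∑ x, D₁ l x * (A l).prob x (fun _ => false)|
      ≤ μ l

/-- The Hadamard transform on the qubits selected by `s` (identity on the others). -/
def hadOn {ι : Type} [Fintype ι] (s : ι → Bool) : Op ι := fun x y =>
  ∏ i, if s i = true then (if x i = true ∧ y i = true then -1 else 1) / ((Real.sqrt 2 : ℝ) : ℂ)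
    else if x i = y i then 1 else 0

/-- `D_{ρ,h}`: measure qubit `i` of `ρ` in the standard basis if `h i` is false, in the Hadamard
basis if `h i` is true. -/
def measDist {n : ℕ} (ρ : Op (Fin n)) (h : Bits n) (m : Bits n) : ℝ :=
  ((hadOn h * ρ * (hadOn h)ᴴ) m m).re

/-! ## Function families -/

/-- Probability densities on a finite set of strings. -/
def IsDensity {m : ℕ} (Y : Finset (Bits m)) (p : Bits m → ℝ) : Prop :=
  (∀ y, 0 ≤ p y) ∧ (∀ y, y ∉ Y → p y = 0) ∧ ∑ y, p y = 1

/-- The support of a density. -/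
def Supp {m : ℕ} (p : Bits m → ℝ) : Set (Bits m) := {y | 0 < p y}

/-- The squared Hellinger distance. -/
def hellingerSq {m : ℕ} (p q : Bits m → ℝ) : ℝ := 1 - ∑ y, Real.sqrt (p y * q y)

/-- Encoding of an optional string: a flag followed by the string. -/
def encOpt {ι : Type} : Option (ι → Bool) → (Unit ⊕ ι → Bool)
  | none => fun _ => false
  | some x => Sum.elim (fun _ => true) x

/-- The vector `|X|^{-1/2} ∑_{x ∈ X, y} √(p x y) |x⟩|y⟩`. -/
def sampVec {a b : ℕ} (X : Finset (Bits a)) (p : Bits a → Bits b → ℝ) :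
    (Fin a ⊕ Fin b → Bool) → ℂ := fun z =>
  if z ∘ Sum.inl ∈ X
  then ((Real.sqrt (p (z ∘ Sum.inl) (z ∘ Sum.inr)) / Real.sqrt X.card : ℝ) : ℂ) else 0

/-- The finite sets `𝒳`, `𝒴` (depending on the security parameter), with their elements and the
function keys written as strings of polynomial length. -/
structure Domains where
  xLen : ℕ → ℕ
  yLen : ℕ → ℕ
  kLen : ℕ → ℕ
  xLen_poly : PolyBounded xLen
  yLen_poly : PolyBounded yLen
  kLen_poly : PolyBounded kLen
  X : ∀ l, Finset (Bits (xLen l))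
  Y : ∀ l, Finset (Bits (yLen l))
  X_nonempty : ∀ l, (X l).Nonempty

/-- An efficient probabilistic algorithm that generates a key in `keys` together with a trapdoor:
a deterministic efficient function of polynomially many uniform coins. -/
structure KeyGen (𝓓 : Domains) where
  keys : ∀ l, Finset (Bits (𝓓.kLen l))
  tLen : ℕ → ℕ
  coins : ℕ → ℕ
  tLen_poly : PolyBounded tLen
  coins_poly : PolyBounded coins
  gen : ∀ l, Bits (coins l) → Bits (𝓓.kLen l) × Bits (tLen l)
  gen_mem : ∀ l r, (gen l r).1 ∈ keys l
  gen_eff : EfficientFun (ι := fun l => Fin (coins l)) (κ := fun l => Fin (𝓓.kLen l) ⊕ Fin (tLen l))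
    fun l r => Sum.elim (gen l r).1 (gen l r).2

/-- Expectation of `φ k` over a generated key `k`. -/
def KeyGen.expect {𝓓 : Domains} (𝒢 : KeyGen 𝓓) (l : ℕ) (φ : Bits (𝓓.kLen l) → ℝ) : ℝ :=
  (∑ r : Bits (𝒢.coins l), φ (𝒢.gen l r).1) / 2 ^ 𝒢.coins l

/-- `CHK`, as a family of functions of the key, the bit, the preimage and the image. -/
abbrev CheckFun (𝓓 : Domains) : Type :=
  ∀ l, Bits (𝓓.kLen l) → Bool → Bits (𝓓.xLen l) → Bits (𝓓.yLen l) → Bool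

def CheckFun.Efficient {𝓓 : Domains} (chk : CheckFun 𝓓) : Prop :=
  EfficientFun
    (ι := fun l => Fin (𝓓.kLen l) ⊕ Unit ⊕ Fin (𝓓.xLen l) ⊕ Fin (𝓓.yLen l)) (κ := fun _ => Unit)
    fun l v _ => chk l (v ∘ Sum.inl) (v (Sum.inr (Sum.inl ()))) (v ∘ Sum.inr ∘ Sum.inr ∘ Sum.inl)
      (v ∘ Sum.inr ∘ Sum.inr ∘ Sum.inr)

/-- `SAMP`, with the key and the bit as input and the registers of `𝒳` and `𝒴` as output. -/
abbrev Sampler (𝓓 : Domains) : Type :=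
  ∀ l, QProc (Fin (𝓓.kLen l) ⊕ Unit) (Fin (𝓓.xLen l) ⊕ Fin (𝓓.yLen l))

/-- `SAMP` on input `k, b` prepares `|X|^{-1/2} ∑ √(p x y) |x⟩|y⟩`. -/
def Sampler.Prepares {𝓓 : Domains} (samp : Sampler 𝓓) (l : ℕ) (k : Bits (𝓓.kLen l)) (b : Bool)
    (p : Bits (𝓓.xLen l) → Bits (𝓓.yLen l) → ℝ) : Prop :=
  (samp l).apply (ketbra (Sum.elim k fun _ => b))
    = Matrix.vecMulVec (sampVec (𝓓.X l) p) (star (sampVec (𝓓.X l) p))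

/-- The pairs `(x₀, x₁)` with `f_{k,0}(x₀) = f_{k,1}(x₁)`, for `F b x` the density
`f_{k,b}(x)`. -/
def claws {a c : ℕ} (X : Finset (Bits a)) (F : Bool → Bits a → Bits c → ℝ) :
    Set (Bits a × Bits a) :=
  {p | p.1 ∈ X ∧ p.2 ∈ X ∧ F false p.1 = F true p.2}

/-- The set `R` of pairs is a perfect matching of `X` with `X`. -/
def IsPerfectMatching {a : ℕ} (X : Finset (Bits a)) (R : Set (Bits a × Bits a)) : Prop :=
  (∀ x₀ ∈ X, ∃! x₁, (x₀, x₁) ∈ R) ∧ (∀ x₁ ∈ X, ∃! x₀, (x₀, x₁) ∈ R)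

/-- The member `x_b` of a pair `(x₀, x₁)`. -/
def pick {α : Type} (p : α × α) (b : Bool) : α := if b then p.2 else p.1

open Classical in
/-- A noisy trapdoor claw-free (NTCF) family. -/
structure NTCF (𝓓 : Domains) extends KeyGen 𝓓 where
  f : ∀ l, Bits (𝓓.kLen l) → Bool → Bits (𝓓.xLen l) → Bits (𝓓.yLen l) → ℝ
  f_density : ∀ l, ∀ k ∈ keys l, ∀ b, ∀ x ∈ 𝓓.X l, IsDensity (𝓓.Y l) (f l k b x)
  -- trapdoor injective pair
  supp_disjoint : ∀ l, ∀ k ∈ keys l, ∀ b, ∀ x ∈ 𝓓.X l, ∀ x' ∈ 𝓓.X l, x ≠ x' →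
    Disjoint (Supp (f l k b x)) (Supp (f l k b x'))
  inv : ∀ l, Bits (tLen l) → Bool → Bits (𝓓.yLen l) → Option (Bits (𝓓.xLen l))
  inv_eff : EfficientFun (ι := fun l => Fin (tLen l) ⊕ Unit ⊕ Fin (𝓓.yLen l))
    (κ := fun l => Unit ⊕ Fin (𝓓.xLen l))
    fun l v => encOpt (inv l (v ∘ Sum.inl) (v (Sum.inr (Sum.inl ()))) (v ∘ Sum.inr ∘ Sum.inr))
  inv_spec : ∀ l r b, ∀ x ∈ 𝓓.X l, ∀ y ∈ Supp (f l (gen l r).1 b x),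
    inv l (gen l r).2 b y = some x
  matching : ∀ l, ∀ k ∈ keys l, IsPerfectMatching (𝓓.X l) (claws (𝓓.X l) (f l k))
  -- efficient range superposition
  f' : ∀ l, Bits (𝓓.kLen l) → Bool → Bits (𝓓.xLen l) → Bits (𝓓.yLen l) → ℝ
  f'_density : ∀ l, ∀ k ∈ keys l, ∀ b, ∀ x ∈ 𝓓.X l, IsDensity (𝓓.Y l) (f' l k b x)
  inv_spec' : ∀ l r b, ∀ p ∈ claws (𝓓.X l) (f l (gen l r).1),
    ∀ y ∈ Supp (f' l (gen l r).1 b (pick p b)),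
      inv l (gen l r).2 b y = some (pick p b) ∧ inv l (gen l r).2 (!b) y = some (pick p (!b))
  chk : CheckFun 𝓓
  chk_eff : chk.Efficient
  chk_spec : ∀ l, ∀ k ∈ keys l, ∀ b, ∀ x ∈ 𝓓.X l, ∀ y ∈ 𝓓.Y l,
    (chk l k b x y = true ↔ y ∈ Supp (f' l k b x))
  hellinger : ∃ μ : ℕ → ℝ, Negligible μ ∧ ∀ l, ∀ k ∈ keys l, ∀ b,
    (∑ x ∈ 𝓓.X l, hellingerSq (f l k b x) (f' l k b x)) / (𝓓.X l).card ≤ μ l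
  samp : Sampler 𝓓
  samp_eff : QPT samp
  samp_spec : ∀ l, ∀ k ∈ keys l, ∀ b, samp.Prepares l k b (f' l k b)
  -- adaptive hardcore bit
  w : ℕ → ℕ
  w_poly : PolyBounded w
  good : ∀ l, Bits (𝓓.kLen l) → Bool → Bits (𝓓.xLen l) → Set (Bits (w l))
  good_dense : ∃ μ : ℕ → ℝ, Negligible μ ∧ ∀ l, ∀ k ∈ keys l, ∀ b, ∀ x ∈ 𝓓.X l,
    ((Finset.univ.filter fun d => d ∉ good l k b x).card : ℝ) / 2 ^ w l ≤ μ l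
  goodChk : ∀ l, Bits (𝓓.kLen l) → Bool → Bits (𝓓.xLen l) → Bits (tLen l) → Bits (w l) → Bool
  goodChk_eff : EfficientFun
    (ι := fun l => Fin (𝓓.kLen l) ⊕ Unit ⊕ Fin (𝓓.xLen l) ⊕ Fin (tLen l) ⊕ Fin (w l))
    (κ := fun _ => Unit)
    fun l v _ => goodChk l (v ∘ Sum.inl) (v (Sum.inr (Sum.inl ())))
      (v ∘ Sum.inr ∘ Sum.inr ∘ Sum.inl) (v ∘ Sum.inr ∘ Sum.inr ∘ Sum.inr ∘ Sum.inl)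
      (v ∘ Sum.inr ∘ Sum.inr ∘ Sum.inr ∘ Sum.inr)
  goodChk_spec : ∀ l r b, ∀ x ∈ 𝓓.X l, ∀ d,
    (goodChk l (gen l r).1 b x (gen l r).2 d = true ↔ d ∈ good l (gen l r).1 b x)
  J : ∀ l, Bits (𝓓.xLen l) → Bits (w l)
  Jinv : ∀ l, Bits (w l) → Bits (𝓓.xLen l)
  J_eff : EfficientFun (ι := fun l => Fin (𝓓.xLen l)) (κ := fun l => Fin (w l)) J
  Jinv_eff : EfficientFun (ι := fun l => Fin (w l)) (κ := fun l => Fin (𝓓.xLen l)) Jinv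
  J_inverse : ∀ l, ∀ x ∈ 𝓓.X l, Jinv l (J l x) = x
  hardcore : ∀ A : ∀ l, QProc (Fin (𝓓.kLen l)) (Unit ⊕ Fin (𝓓.xLen l) ⊕ Fin (w l) ⊕ Unit),
    QPT A → ∃ μ : ℕ → ℝ, Negligible μ ∧ ∀ l,
      -- the event that the output `(b, x, d, c)` lies in `H_k` (for `e = false`) or in the set
      -- of the `(b, x, d, c)` with `(b, x, d, c ⊕ 1) ∈ H_k` (for `e = true`)
      let pr : Bool → ℝ := fun e => toKeyGen.expect l fun k =>
        ∑ z, if ∃ p ∈ claws (𝓓.X l) (f l k),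
            z ∘ Sum.inr ∘ Sum.inl = pick p (z (Sum.inl ())) ∧
            z ∘ Sum.inr ∘ Sum.inr ∘ Sum.inl ∈ good l k false p.1 ∩ good l k true p.2 ∧
            xor (z (Sum.inr (Sum.inr (Sum.inr ())))) e =
              dot (z ∘ Sum.inr ∘ Sum.inr ∘ Sum.inl) (xorBits (J l p.1) (J l p.2))
          then (A l).prob k z else 0
      |pr false - pr true| ≤ μ l

/-- A trapdoor injective function family. -/
structure TrapdoorInjective (𝓓 : Domains) extends KeyGen 𝓓 where
  g : ∀ l, Bits (𝓓.kLen l) → Bool → Bits (𝓓.xLen l) → Bits (𝓓.yLen l) → ℝ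
  g_density : ∀ l, ∀ k ∈ keys l, ∀ b, ∀ x ∈ 𝓓.X l, IsDensity (𝓓.Y l) (g l k b x)
  supp_disjoint : ∀ l, ∀ k ∈ keys l, ∀ b b', ∀ x ∈ 𝓓.X l, ∀ x' ∈ 𝓓.X l, (b, x) ≠ (b', x') →
    Disjoint (Supp (g l k b x)) (Supp (g l k b' x'))
  inv : ∀ l, Bits (tLen l) → Bits (𝓓.yLen l) → Option (Bool × Bits (𝓓.xLen l))
  inv_eff : EfficientFun (ι := fun l => Fin (tLen l) ⊕ Fin (𝓓.yLen l))
    (κ := fun l => Unit ⊕ (Unit ⊕ Fin (𝓓.xLen l)))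
    fun l v => encOpt ((inv l (v ∘ Sum.inl) (v ∘ Sum.inr)).map fun p => Sum.elim (fun _ => p.1) p.2)
  inv_spec : ∀ l r b, ∀ x ∈ 𝓓.X l, ∀ y ∈ Supp (g l (gen l r).1 b x),
    inv l (gen l r).2 y = some (b, x)
  chk : CheckFun 𝓓
  chk_eff : chk.Efficient
  chk_spec : ∀ l, ∀ k ∈ keys l, ∀ b, ∀ x ∈ 𝓓.X l, ∀ y ∈ 𝓓.Y l,
    (chk l k b x y = true ↔ y ∈ Supp (g l k b x))
  samp : Sampler 𝓓
  samp_eff : QPT samp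
  samp_spec : ∀ l, ∀ k ∈ keys l, ∀ b, samp.Prepares l k b (g l k b)

/-- `F` is injective invariant with respect to `G`. -/
structure InjectiveInvariant {𝓓 : Domains} (F : NTCF 𝓓) (G : TrapdoorInjective 𝓓) : Prop where
  chk_eq : F.chk = G.chk
  samp_eq : F.samp = G.samp
  indist : ∀ A : ∀ l, QProc (Fin (𝓓.kLen l)) Unit, QPT A → ∃ μ : ℕ → ℝ, Negligible μ ∧ ∀ l,
    |F.expect l (fun k => (A l).prob k fun _ => false)
      - G.expect l (fun k => (A l).prob k fun _ => false)| ≤ μ l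

open Classical in
/-- `F` is an extended trapdoor claw-free family, with `G` a corresponding trapdoor injective
family. -/
structure ExtendedTCF {𝓓 : Domains} (F : NTCF 𝓓) (G : TrapdoorInjective 𝓓) : Prop where
  injective_invariant : InjectiveInvariant F G
  hardcore : ∀ A : ∀ l, QProc (Fin (𝓓.kLen l)) Unit, QPT A →
    ∃ μ : ℕ → ℝ, Negligible μ ∧ ∃ d : ∀ l, Bits (F.w l), ∀ l,
      |F.expect l (fun k => ∑ z, if ∃ p ∈ claws (𝓓.X l) (F.f l k),
            z () = dot (d l) (xorBits (F.J l p.1) (F.J l p.2))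
          then (A l).prob k z else 0) - 1 / 2| ≤ μ l

/-! ## Provers in the measurement protocol -/

/-- The qubits of a prover: `n` committed qubits, `n` preimage registers of `x` qubits, `e`
auxiliary qubits, `n` commitment string registers of `y` qubits, and the register of `n` keys of
length `k`. -/
inductive Wire (n x y k e : ℕ) : Type
  | com (i : Fin n)
  | pre (i : Fin n) (j : Fin x)
  | aux (j : Fin e)
  | str (i : Fin n) (j : Fin y)
  | key (i : Fin n) (j : Fin k)
  deriving DecidableEq, Fintype

/-- The qubits in the Hadamard round: `n` registers of `w` qubits are appended, to hold `J(x)`. -/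
abbrev HWire (n x y k e w : ℕ) : Type := Wire n x y k e ⊕ (Fin n × Fin w)

section Wires
variable {n x y k e w : ℕ}

/-- The basis vector `|0⟩|k'⟩` in which the prover starts. -/
def initBits (k' : Fin n → Bits k) : Wire n x y k e → Bool
  | .key i j => k' i j
  | _ => false

/-- The content of the appended `i`-th register. -/
def jReg (u : HWire n x y k e w → Bool) (i : Fin n) : Bits w := fun j => u (Sum.inr (i, j))

/-- The committed qubits. -/
def comEmb : Fin n ↪ HWire n x y k e w where
  toFun i := Sum.inl (.com i)
  inj' i i' h := by simpa using h

/-- The action of `U_J` on basis vectors, on all `n` preimage registers: `J` is computed into the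
appended register, and the old preimage register is then erased by computing the inverse of `J`,
so that `|x⟩|0⟩` becomes `|0⟩|J(x)⟩` for `x ∈ 𝒳`. -/
def uJBits (J : Bits x → Bits w) (Jinv : Bits w → Bits x) (u : HWire n x y k e w → Bool) :
    HWire n x y k e w → Bool :=
  let c : Fin n → Bits w := fun i => xorBits (jReg u i) (J fun j => u (Sum.inl (.pre i j)))
  fun q => match q with
    | .inl (.pre i j) => xor (u (Sum.inl (.pre i j))) (Jinv (c i) j)
    | .inl q => u (Sum.inl q)
    | .inr (i, j) => c i j

def uJ (J : Bits x → Bits w) (Jinv : Bits w → Bits x) : Op (HWire n x y k e w) :=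
  fun u v => if u = uJBits J Jinv v then 1 else 0

/-- The projection onto the committed qubits being in the basis state `b`. -/
def comProj (b : Bits n) : Op (HWire n x y k e w) :=
  Matrix.diagonal fun u => if u ∘ comEmb = b then 1 else 0

/-- Selects the registers appended in the Hadamard round. -/
def selPre : HWire n x y k e w → Bool
  | .inr _ => true
  | _ => false

/-- Selects the committed qubits and the registers appended in the Hadamard round. -/
def selComPre : HWire n x y k e w → Bool
  | .inl (.com _) => true
  | .inr _ => true
  | _ => false

end Wires

/-- A prover on `n` qubits that is characterized by an efficient unitary `U₀`, which uses the key
register as a control, and an efficient CPTP map `S`. -/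
structure Prover {𝓓 : Domains} (F : NTCF 𝓓) (n : ℕ → ℕ) where
  aux : ℕ → ℕ
  U₀ : ∀ l, Circuit (Wire (n l) (𝓓.xLen l) (𝓓.yLen l) (𝓓.kLen l) (aux l))
  U₀_eff : PolyBounded fun l => aux l + (U₀ l).length
  U₀_control : ∀ l (k' : Fin (n l) → Bits (𝓓.kLen l)) u,
    (∃ i j, u (.key i j) ≠ k' i j) → Circuit.toOp (U₀ l) u (initBits k') = 0
  S : ∀ l, QProc (HWire (n l) (𝓓.xLen l) (𝓓.yLen l) (𝓓.kLen l) (aux l) (F.w l))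
    (HWire (n l) (𝓓.xLen l) (𝓓.yLen l) (𝓓.kLen l) (aux l) (F.w l))
  S_eff : QPT S

section Protocol
variable {𝓓 : Domains} {F : NTCF 𝓓} {n : ℕ → ℕ} (G : TrapdoorInjective 𝓓) (P : Prover F n) (l : ℕ)

/-- The amplitudes of the prover's state `U₀|0⟩|k'⟩`, before the commitment strings are
measured. -/
def Prover.amp (k' : Fin (n l) → Bits (𝓓.kLen l))
    (u : Wire (n l) (𝓓.xLen l) (𝓓.yLen l) (𝓓.kLen l) (P.aux l) → Bool) : ℂ :=
  Circuit.toOp (P.U₀ l) u (initBits k')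

/-- The keys chosen by the verifier for the basis choice `h`, as a function of his coins: qubit `i`
uses `GEN_F` if `h i` is true (Hadamard basis) and `GEN_G` otherwise (standard basis). -/
def verifierKeys (F : NTCF 𝓓) (h : Bits (n l)) (r : Fin (n l) → Bits (F.coins l))
    (s : Fin (n l) → Bits (G.coins l)) : Fin (n l) → Bits (𝓓.kLen l) :=
  fun i => if h i = true then (F.gen l (r i)).1 else (G.gen l (s i)).1

open Classical in
/-- The probability that the verifier accepts in the test round for the basis choice `h`. -/
def Prover.testAccept (h : Bits (n l)) : ℝ :=
  (∑ r : Fin (n l) → Bits (F.coins l), ∑ s : Fin (n l) → Bits (G.coins l),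
    ∑ u : Wire (n l) (𝓓.xLen l) (𝓓.yLen l) (𝓓.kLen l) (P.aux l) → Bool,
      if ∀ i, (fun j => u (.pre i j)) ∈ 𝓓.X l ∧ (fun j => u (.str i j)) ∈ 𝓓.Y l ∧
          (if h i = true then F.chk else G.chk) l (verifierKeys G l F h r s i) (u (.com i))
            (fun j => u (.pre i j)) (fun j => u (.str i j)) = true
      then ‖P.amp l (verifierKeys G l F h r s) u‖ ^ 2 else 0)
    / (2 ^ (n l * F.coins l) * 2 ^ (n l * G.coins l))

/-- A perfect prover is always accepted in the test round. -/
def Prover.Perfect : Prop := ∀ l, ∀ h : Bits (n l), P.testAccept G l h = 1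

/-- A trivial prover: perfect, and `S` commutes with the standard basis measurement of the
committed qubits, i.e. with the projection onto each of its outcomes `b`. -/
def Prover.Trivial : Prop :=
  P.Perfect G ∧ ∀ l (b : Bits (n l)) σ,
    comProj b * (P.S l).apply σ * comProj b = (P.S l).apply (comProj b * σ * comProj b)

/-- The (unnormalized) state after the commitment strings have been measured with outcome `y`, with
zero qubits appended for the Hadamard round. -/
def Prover.committed (k' : Fin (n l) → Bits (𝓓.kLen l)) (y : Fin (n l) → Bits (𝓓.yLen l)) :
    Op (HWire (n l) (𝓓.xLen l) (𝓓.yLen l) (𝓓.kLen l) (P.aux l) (F.w l)) :=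
  let φ : (HWire (n l) (𝓓.xLen l) (𝓓.yLen l) (𝓓.kLen l) (P.aux l) (F.w l) → Bool) → ℂ := fun u =>
    if (∀ i j, u (Sum.inr (i, j)) = false) ∧ (∀ i j, u (Sum.inl (.str i j)) = y i j)
    then P.amp l k' (u ∘ Sum.inl) else 0
  Matrix.vecMulVec φ (star φ)

/-- The (unnormalized) state in the Hadamard round after the application of `U_J` and `S`. -/
def Prover.attacked (k' : Fin (n l) → Bits (𝓓.kLen l)) (y : Fin (n l) → Bits (𝓓.yLen l)) :
    Op (HWire (n l) (𝓓.xLen l) (𝓓.yLen l) (𝓓.kLen l) (P.aux l) (F.w l)) :=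
  (P.S l).apply (uJ (F.J l) (F.Jinv l) * P.committed l k' y * (uJ (F.J l) (F.Jinv l))ᴴ)

/-- The probability that a prover with function choice `k'` reports the commitment strings `y` and
then, in the Hadamard round, the bits `b` and the strings `d`. -/
def Prover.outcome (k' : Fin (n l) → Bits (𝓓.kLen l)) (y : Fin (n l) → Bits (𝓓.yLen l))
    (b : Bits (n l)) (d : Fin (n l) → Bits (F.w l)) : ℝ :=
  let τ : Op (HWire (n l) (𝓓.xLen l) (𝓓.yLen l) (𝓓.kLen l) (P.aux l) (F.w l)) :=
    hadOn selComPre * P.attacked l k' y * (hadOn selComPre)ᴴ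
  ∑ u, if u ∘ comEmb = b ∧ jReg u = d then (τ u u).re else 0

/-- The probability that the decoding bit of a qubit with key and trapdoor `kt`, commitment string
`y` and Hadamard measurement result `d` is `c`. The decoding bit is `d · (J(x₀) ⊕ J(x₁))` if both
inverses `x₀`, `x₁` of `y` exist and `d` passes the membership check, and uniformly random
otherwise. -/
def decodeProb (F : NTCF 𝓓) (kt : Bits (𝓓.kLen l) × Bits (F.tLen l)) (y : Bits (𝓓.yLen l))
    (d : Bits (F.w l)) (c : Bool) : ℝ :=
  match F.inv l kt.2 false y, F.inv l kt.2 true y with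
  | some x₀, some x₁ =>
    if F.goodChk l kt.1 false x₀ kt.2 d = true ∧ F.goodChk l kt.1 true x₁ kt.2 d = true
    then (if c = dot d (xorBits (F.J l x₀) (F.J l x₁)) then 1 else 0)
    else 1 / 2
  | _, _ => 1 / 2

/-- The probability that the verifier stores the standard basis measurement result `m` for a qubit
with trapdoor `t` and commitment string `y`. -/
def standardProb (t : Bits (G.tLen l)) (y : Bits (𝓓.yLen l)) (m : Bool) : ℝ :=
  match G.inv l t y with
  | some p => if m = p.1 then 1 else 0
  | none => 1 / 2

/-- `D_{P,h}`: the distribution of the measurement results `m` stored by the verifier in the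
Hadamard round for the basis choice `h`. If `h i` is true, `m i` is the reported bit `b i` XORed
with the decoding bit (hence uniform if an inverse or the membership check fails). -/
def Prover.dist (h : Bits (n l)) (m : Bits (n l)) : ℝ :=
  (∑ r : Fin (n l) → Bits (F.coins l), ∑ s : Fin (n l) → Bits (G.coins l),
    ∑ y : Fin (n l) → Bits (𝓓.yLen l), ∑ b : Bits (n l), ∑ d : Fin (n l) → Bits (F.w l),
      P.outcome l (verifierKeys G l F h r s) y b d *
        ∏ i, if h i = true then decodeProb l F (F.gen l (r i)) (y i) (d i) (xor (m i) (b i))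
          else standardProb G l (G.gen l (s i)).2 (y i) (m i))
    / (2 ^ (n l * F.coins l) * 2 ^ (n l * G.coins l))

/-- The `n`-qubit state obtained as follows: sample all keys from `GEN_F`; run the prover up to and
including `S`; measure the preimage registers in the Hadamard basis, with outcomes `d`; apply `Z` to
the `i`-th committed qubit if its decoding bit is 1; discard everything but the committed qubits. -/
def Prover.decodedState : Op (Fin (n l)) := fun a a' =>
  (∑ r : Fin (n l) → Bits (F.coins l), ∑ y : Fin (n l) → Bits (𝓓.yLen l),
    ∑ d : Fin (n l) → Bits (F.w l),
      let τ : Op (HWire (n l) (𝓓.xLen l) (𝓓.yLen l) (𝓓.kLen l) (P.aux l) (F.w l)) :=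
        hadOn selPre * P.attacked l (fun i => (F.gen l (r i)).1) y * (hadOn selPre)ᴴ
      traceOut comEmb (fun u v => if jReg u = d ∧ jReg v = d then τ u v else 0) a a' *
        ∏ i, ∑ c : Bool, (decodeProb l F (F.gen l (r i)) (y i) (d i) c : ℂ) *
          if c = true ∧ a i ≠ a' i then -1 else 1)
    / 2 ^ (n l * F.coins l)

end Protocol

end MeasProtocol

end

open scoped Matrix BigOperators ComplexOrder

noncomputable section

set_option linter.unusedSectionVars false
set_option synthInstance.maxSize 1000

namespace MeasProtocol


/-! Fix `h`. Where `h i` is true the verifier stores the reported bit XORed with the decoding bit.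
As `H Z = X H`, this is the same as applying `Z` to the decoded power before the Hadamard
measurement (`had1_weigh`, `weigh_hadOn_diag`). Where `h i` is false the key is injective, so
perfectness makes the commitment string determine the committed bit (`Prover.Perfect.inv_eq`). Since
`S` commutes with the standard basis measurement of the committed qubits, this bit is still what
such a measurement would give after `S` (`Prover.Trivial.exists_commitVec_ne_zero`). The Hadamard
result reported for that qubit is not used, so measuring it in the standard basis instead changes
nothing (`sum_hadOn_diag`). Hence the distribution of the verifier's results is exactly that of
measuring, in the bases `h`, a state that differs from `decodedState` in two ways: the keys with `h
i` false come from `GEN_G`, and those qubits are not decoded (`Prover.Trivial.sum_standard`,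
`Prover.Trivial.dist_eq`).

A qubit that is not decoded needs no trapdoor. An adversary who is handed its key can therefore run
the whole experiment, and injective invariance allows its `GEN_G` key to be replaced by a `GEN_F`
key at negligible cost (`Prover.exists_reduction`, `InjectiveInvariant.hybrid_step`). After at most
polynomially many replacements all keys come from `GEN_F`. Decoding the remaining qubits as well
only applies `Z` before a standard basis measurement, which is invisible
(`Prover.measL_hybrid_last`), and the target state is reached.

Most of the file shows that the adversary and the preparation of the state are efficient. Both are
instances of one map `Prover.channel`, a single circuit whose input is one key: coins are qubits put
into superposition and finally discarded, commitment strings are measured by copying them and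
discarding the copies, and decoding is a phase oracle. `Prover.channel_ketbra` identifies this map
with the intended average over coins. Circuits are composed through two notions, unitaries with
clean ancillas (`CleanU`) and channels (`Realizes`), and `exists_amalgam` combines the ancillas of
different pieces. -/

/-! ## Operators on subregisters -/

section Operators
variable {ι κ γ δ W V : Type}

/-- The matrix of a function on basis vectors. -/
def fm {A B : Type} [DecidableEq B] (π : A → B) : Matrix B A ℂ :=
  fun b a => if b = π a then 1 else 0

lemma fm_mul_apply {A B C : Type} [Fintype B] [DecidableEq B] [DecidableEq C]
    (M : Matrix C B ℂ) (π : A → B) (c : C) (a : A) : (M * fm π) c a = M c (π a) := by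
  simp [Matrix.mul_apply, fm]

lemma fm_mul {A B C : Type} [Fintype B] [DecidableEq B] [DecidableEq C]
    (π : B → C) (ρ : A → B) : fm π * fm ρ = fm (π ∘ ρ) := by
  ext c a; rw [fm_mul_apply]; rfl

lemma fm_id {A : Type} [DecidableEq A] : fm (id : A → A) = 1 := by
  ext a b; simp [fm, Matrix.one_apply]

lemma fm_conjTranspose_mul {A B : Type} [Fintype B] [DecidableEq A] [DecidableEq B]
    {π : A → B} (hπ : Function.Injective π) : (fm π)ᴴ * fm π = 1 := by
  ext a b
  simp [fm_mul_apply, Matrix.conjTranspose_apply, fm, Matrix.one_apply, hπ.eq_iff, eq_comm]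

lemma fm_mul_apply_of_involutive {A B : Type} [Fintype A] [DecidableEq A]
    {π : A → A} (hπ : Function.Involutive π) (M : Matrix A B ℂ) (a : A) (b : B) :
    (fm π * M) a b = M (π a) b := by
  have h : ∀ x, (a = π x) ↔ (x = π a) := fun x =>
    ⟨fun h => by rw [h, hπ x], fun h => by rw [h, hπ a]⟩
  simp [Matrix.mul_apply, fm, h]

/-- The bit string that is `a` on the first and `g` on the second part of a decomposition of a
register. -/
def join (w : ι ⊕ γ ≃ W) (a : ι → Bool) (g : γ → Bool) : W → Bool := Sum.elim a g ∘ w.symm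

lemma join_inl (w : ι ⊕ γ ≃ W) (a : ι → Bool) (g : γ → Bool) (i : ι) :
    join w a g (w (Sum.inl i)) = a i := by simp [join]

lemma join_inr (w : ι ⊕ γ ≃ W) (a : ι → Bool) (g : γ → Bool) (i : γ) :
    join w a g (w (Sum.inr i)) = g i := by simp [join]

lemma join_self (w : ι ⊕ γ ≃ W) (u : W → Bool) :
    join w (u ∘ w ∘ Sum.inl) (u ∘ w ∘ Sum.inr) = u := by
  funext x
  obtain ⟨y, rfl⟩ := w.surjective x
  rcases y with y | y <;> simp [join]

/-- The splitting of bit strings that corresponds to a decomposition of a register. -/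
def joinEquiv (w : ι ⊕ γ ≃ W) : (ι → Bool) × (γ → Bool) ≃ (W → Bool) where
  toFun p := join w p.1 p.2
  invFun u := (u ∘ w ∘ Sum.inl, u ∘ w ∘ Sum.inr)
  left_inv p := by
    ext i
    · simp [join_inl]
    · simp [join_inr]
  right_inv u := join_self w u

lemma join_inj (w : ι ⊕ γ ≃ W) {a a' : ι → Bool} {g g' : γ → Bool} :
    join w a g = join w a' g' ↔ a = a' ∧ g = g' := by
  have := (joinEquiv w).injective.eq_iff (a := (a, g)) (b := (a', g'))
  simpa [joinEquiv] using this

lemma sum_join [Fintype ι] [Fintype γ] [Fintype W] [DecidableEq ι] [DecidableEq γ] [DecidableEq W]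
    {M : Type} [AddCommMonoid M] (w : ι ⊕ γ ≃ W) (f : (W → Bool) → M) :
    ∑ u, f u = ∑ a, ∑ g, f (join w a g) := by
  rw [← (joinEquiv w).sum_comp, Fintype.sum_prod_type]; rfl

lemma exists_join (w : ι ⊕ γ ≃ W) (u : W → Bool) : ∃ a g, join w a g = u := ⟨_, _, join_self w u⟩

lemma op_ext_join (w : ι ⊕ γ ≃ W) {σ τ : Op W}
    (h : ∀ a g a' g', σ (join w a g) (join w a' g') = τ (join w a g) (join w a' g')) : σ = τ := by
  ext u v
  rw [← join_self w u, ← join_self w v]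
  exact h _ _ _ _

/-- `w` decomposes the register `W` into the image of `e` and its complement. -/
def IsFrame (e : ι ↪ W) (w : ι ⊕ γ ≃ W) : Prop := ∀ i, w (Sum.inl i) = e i

lemma IsFrame.comp {e : ι ↪ W} {w : ι ⊕ γ ≃ W} (hw : IsFrame e w) (a : ι → Bool) (g : γ → Bool) :
    join w a g ∘ e = a := by
  funext i; simp [← hw i, join_inl]

lemma IsFrame.agree {e : ι ↪ W} {w : ι ⊕ γ ≃ W} (hw : IsFrame e w) {a a' : ι → Bool}
    {g g' : γ → Bool} :
    (∀ i, i ∉ Set.range e → join w a g i = join w a' g' i) ↔ g = g' := by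
  constructor
  · intro h
    funext i
    have := h (w (Sum.inr i)) (by
      rintro ⟨j, hj⟩
      rw [← hw j] at hj
      simpa using w.injective hj)
    simpa [join_inr] using this
  · rintro rfl i hi
    obtain ⟨y, rfl⟩ := w.surjective i
    rcases y with y | y
    · exact absurd ⟨y, (hw y).symm⟩ hi
    · simp [join_inr]

lemma isFrame_inl : IsFrame (Function.Embedding.inl : ι ↪ ι ⊕ γ) (Equiv.refl (ι ⊕ γ)) := fun _ => rfl

/-- Source of coordinates: identities about a subregister are checked entrywise after writing each
bit string as `join w a g`, where lifted operators, appended zeros and partial traces have simple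
entries. -/
lemma exists_frame [Fintype W] [DecidableEq W] (e : ι ↪ W) :
    ∃ (γ : Type) (_ : Fintype γ) (_ : DecidableEq γ) (w : ι ⊕ γ ≃ W), IsFrame e w := by
  classical
  refine ⟨{x // x ∉ Set.range e}, inferInstance, inferInstance,
    (Equiv.sumCongr (Equiv.ofInjective e e.injective) (Equiv.refl _)).trans
      (Equiv.sumCompl (· ∈ Set.range e)), fun i => ?_⟩
  simp

open Classical in
/-- The operator `M` on the subregister `e`, tensored with the identity. -/
def lift (e : ι ↪ W) (M : Op ι) : Op W := fun x y =>
  if ∀ i, i ∉ Set.range e → x i = y i then M (x ∘ e) (y ∘ e) else 0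

lemma Gate.toOp_eq_lift (g : Gate ι) : g.toOp = lift g.wires g.mat := rfl

lemma lift_join [DecidableEq γ] [Fintype γ] {e : ι ↪ W} {w : ι ⊕ γ ≃ W} (hw : IsFrame e w) (M : Op ι)
    (a a' : ι → Bool) (g g' : γ → Bool) :
    lift e M (join w a g) (join w a' g') = if g = g' then M a a' else 0 := by
  simp only [lift, hw.agree, hw.comp]

variable [Fintype ι] [DecidableEq ι] [Fintype κ] [DecidableEq κ] [Fintype W] [DecidableEq W]
  [Fintype V] [DecidableEq V] [Fintype γ] [DecidableEq γ] [Fintype δ] [DecidableEq δ]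

lemma lift_mul_join {e : ι ↪ W} {w : ι ⊕ γ ≃ W} (hw : IsFrame e w) (M : Op ι) {A : Type*}
    (σ : Matrix (W → Bool) A ℂ) (a : ι → Bool) (g : γ → Bool) (v : A) :
    (lift e M * σ) (join w a g) v = ∑ b, M a b * σ (join w b g) v := by
  rw [Matrix.mul_apply, sum_join w]
  simp [lift_join hw]

lemma mul_lift_join {e : ι ↪ W} {w : ι ⊕ γ ≃ W} (hw : IsFrame e w) (M : Op ι) {A : Type*}
    (σ : Matrix A (W → Bool) ℂ) (a : ι → Bool) (g : γ → Bool) (v : A) :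
    (σ * lift e M) v (join w a g) = ∑ b, σ v (join w b g) * M b a := by
  rw [Matrix.mul_apply, sum_join w]
  simp [lift_join hw]

lemma lift_one (e : ι ↪ W) : lift e 1 = 1 := by
  obtain ⟨γ, _, _, w, hw⟩ := exists_frame e
  refine op_ext_join w fun a g a' g' => ?_
  rw [lift_join hw]
  simp only [Matrix.one_apply, join_inj]
  split_ifs <;> simp_all

lemma lift_mul (e : ι ↪ W) (M N : Op ι) : lift e (M * N) = lift e M * lift e N := by
  obtain ⟨γ, _, _, w, hw⟩ := exists_frame e
  refine op_ext_join w fun a g a' g' => ?_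
  rw [lift_join hw, lift_mul_join hw]
  simp only [lift_join hw]
  split_ifs <;> simp [Matrix.mul_apply]

lemma lift_conjTranspose (e : ι ↪ W) (M : Op ι) : (lift e M)ᴴ = lift e Mᴴ := by
  obtain ⟨γ, _, _, w, hw⟩ := exists_frame e
  refine op_ext_join w fun a g a' g' => ?_
  rw [lift_join hw, Matrix.conjTranspose_apply, lift_join hw]
  simp only [eq_comm (a := g')]
  split_ifs <;> simp [Matrix.conjTranspose_apply]

lemma lift_lift (e : ι ↪ κ) (f : κ ↪ W) (M : Op ι) : lift f (lift e M) = lift (e.trans f) M := by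
  funext u v
  simp only [lift]
  have : (∀ i, i ∉ Set.range (e.trans f) → u i = v i) ↔
      (∀ i, i ∉ Set.range f → u i = v i) ∧ ∀ i, i ∉ Set.range e → (u ∘ f) i = (v ∘ f) i := by
    constructor
    · refine fun h => ⟨fun i hi => h i ?_, fun i hi => h (f i) ?_⟩
      · rintro ⟨j, rfl⟩; exact hi ⟨e j, rfl⟩
      · rintro ⟨j, hj⟩; exact hi ⟨j, f.injective hj⟩
    · rintro ⟨h1, h2⟩ i hi
      by_cases hf : i ∈ Set.range f
      · obtain ⟨j, rfl⟩ := hf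
        exact h2 j (by rintro ⟨k, rfl⟩; exact hi ⟨k, rfl⟩)
      · exact h1 i hf
  by_cases h0 : ∀ i, i ∉ Set.range (e.trans f) → u i = v i
  · rw [if_pos h0, if_pos (this.1 h0).1, if_pos (this.1 h0).2]; rfl
  · rw [if_neg h0]
    by_cases h1 : ∀ i, i ∉ Set.range f → u i = v i
    · rw [if_pos h1, if_neg fun h2 => h0 (this.2 ⟨h1, h2⟩)]
    · rw [if_neg h1]

/-- Extension of a bit string by zeros. -/
def zext (e : ι ↪ W) (a : ι → Bool) : W → Bool := Function.extend e a fun _ => false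

lemma zext_comp (e : ι ↪ W) (a : ι → Bool) : zext e a ∘ e = a := by
  funext i; simp [zext, e.injective.extend_apply]

lemma zext_injective (e : ι ↪ W) : Function.Injective (zext e) := fun a b h => by
  rw [← zext_comp e a, h, zext_comp]

lemma zext_trans (e : ι ↪ κ) (f : κ ↪ W) (a : ι → Bool) :
    zext (e.trans f) a = zext f (zext e a) := by
  funext i
  by_cases hf : i ∈ Set.range f
  · obtain ⟨j, rfl⟩ := hf
    by_cases he : j ∈ Set.range e
    · obtain ⟨k, rfl⟩ := he
      have := (e.trans f).injective.extend_apply a (fun _ => false) k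
      simp only [Function.Embedding.trans_apply] at this
      simp [zext, f.injective.extend_apply, e.injective.extend_apply, this]
    · rw [zext, zext, f.injective.extend_apply, Function.extend_apply' , zext,
        Function.extend_apply']
      · exact he
      · rintro ⟨k, hk⟩; exact he ⟨k, f.injective hk⟩
  · rw [zext, zext, Function.extend_apply' , Function.extend_apply']
    · exact hf
    · rintro ⟨k, hk⟩; exact hf ⟨e k, hk⟩

lemma IsFrame.zext {e : ι ↪ W} {w : ι ⊕ γ ≃ W} (hw : IsFrame e w) (a : ι → Bool) :
    zext e a = join w a fun _ => false := by
  funext i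
  obtain ⟨y, rfl⟩ := w.surjective i
  rcases y with y | y
  · rw [join_inl, hw y]; exact e.injective.extend_apply ..
  · rw [join_inr]
    refine Function.extend_apply' _ _ _ ?_
    rintro ⟨k, hk⟩
    rw [← hw k] at hk
    simpa using w.injective hk

/-- The isometry that appends qubits in state `0`. -/
def iso (e : ι ↪ W) : Matrix (W → Bool) (ι → Bool) ℂ := fm (zext e)

lemma iso_join {e : ι ↪ W} {w : ι ⊕ γ ≃ W} (hw : IsFrame e w) (a a' : ι → Bool) (g : γ → Bool) :
    iso e (join w a g) a' = if a = a' ∧ g = (fun _ => false) then 1 else 0 := by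
  simp only [iso, fm, hw.zext, join_inj]

lemma iso_trans (e : ι ↪ κ) (f : κ ↪ W) : iso (e.trans f) = iso f * iso e := by
  rw [iso, iso, iso, fm_mul]; congr 1; funext a; exact zext_trans e f a

lemma iso_conjTranspose_mul (e : ι ↪ W) : (iso e)ᴴ * iso e = 1 :=
  fm_conjTranspose_mul (zext_injective e)

lemma lift_mul_iso (e : ι ↪ W) (M : Op ι) : lift e M * iso e = iso e * M := by
  obtain ⟨γ, _, _, w, hw⟩ := exists_frame e
  ext u a'
  obtain ⟨a, g, rfl⟩ := exists_join w u
  rw [lift_mul_join hw, Matrix.mul_apply]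
  simp only [iso_join hw]
  by_cases hg : g = fun _ => false <;> simp [hg]

/-- Appending qubits in state `0` to a mixed state. -/
def ap (e : ι ↪ W) (ρ : Op ι) : Op W := iso e * ρ * (iso e)ᴴ

lemma ap_join {e : ι ↪ W} {w : ι ⊕ γ ≃ W} (hw : IsFrame e w) (ρ : Op ι)
    (a a' : ι → Bool) (g g' : γ → Bool) :
    ap e ρ (join w a g) (join w a' g')
      = if g = (fun _ => false) ∧ g' = (fun _ => false) then ρ a a' else 0 := by
  have h1 : (iso e * ρ) (join w a g) = fun b => if g = (fun _ => false) then ρ a b else 0 := by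
    funext b
    rw [Matrix.mul_apply]
    simp only [iso_join hw]
    by_cases hg : g = fun _ => false <;> simp [hg]
  rw [ap, Matrix.mul_apply]
  simp only [h1, Matrix.conjTranspose_apply, iso_join hw]
  by_cases hg : g = fun _ => false <;> by_cases hg' : g' = fun _ => false <;> simp [hg, hg']

lemma appendZeros_eq {k : ℕ} (ρ : Op ι) :
    (appendZeros ρ : Op (ι ⊕ Fin k)) = ap Function.Embedding.inl ρ := by
  refine op_ext_join (Equiv.refl _) fun a g a' g' => ?_
  rw [ap_join isFrame_inl, appendZeros]
  have h1 : ∀ (b : ι → Bool) (g : Fin k → Bool),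
    (∀ j, join (Equiv.refl (ι ⊕ Fin k)) b g (Sum.inr j) = false) ↔ g = fun _ => false := by
    intro b g; simp [join, funext_iff]
  have h2 : ∀ (b : ι → Bool) (g : Fin k → Bool), join (Equiv.refl (ι ⊕ Fin k)) b g ∘ Sum.inl = b := by
    intro b g; funext i; simp [join]
  simp only [h1, h2]

lemma ap_ap (e : ι ↪ κ) (f : κ ↪ W) (ρ : Op ι) : ap f (ap e ρ) = ap (e.trans f) ρ := by
  simp only [ap, iso_trans, Matrix.conjTranspose_mul, Matrix.mul_assoc]

lemma ap_conj (e : ι ↪ W) (M ρ : Op ι) : ap e (M * ρ * Mᴴ) = lift e M * ap e ρ * (lift e M)ᴴ := by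
  have h : (iso e)ᴴ * (lift e M)ᴴ = Mᴴ * (iso e)ᴴ := by
    rw [← Matrix.conjTranspose_mul, lift_mul_iso, Matrix.conjTranspose_mul]
  simp only [ap, Matrix.mul_assoc, h]
  simp only [← Matrix.mul_assoc, lift_mul_iso]

lemma ap_ketbra (e : ι ↪ W) (x : ι → Bool) : ap e (ketbra x) = ketbra (zext e x) := by
  obtain ⟨γ, _, _, w, hw⟩ := exists_frame e
  refine op_ext_join w fun a g a' g' => ?_
  rw [ap_join hw, hw.zext]
  simp only [ketbra, Matrix.single_apply, join_inj]
  by_cases hg : g = fun _ => false <;> by_cases hg' : g' = fun _ => false <;>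
    simp [hg, hg', eq_comm]

/-! ## Partial traces -/

lemma traceOut_join {e : ι ↪ W} {w : ι ⊕ γ ≃ W} (hw : IsFrame e w) (σ : Op W)
    (z z' : ι → Bool) : traceOut e σ z z' = ∑ g, σ (join w z g) (join w z' g) := by
  simp only [traceOut]
  rw [sum_join w]
  simp_rw [sum_join w, hw.agree, hw.comp]
  rw [Finset.sum_eq_single z, Finset.sum_congr rfl]
  · intro g _
    rw [Finset.sum_eq_single z', Finset.sum_eq_single g]
    · simp
    · intro b _ hb; simp [hb.symm]
    · simp
    · intro b _ hb; simp [hb]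
    · simp
  · intro b _ hb; simp [hb]
  · simp

/-- The sum over the discarded coordinates `g` is untouched by an operator that acts on the kept
coordinates only, so no unitarity is needed. -/
lemma traceOut_conj (e : ι ↪ W) (M : Op ι) (σ : Op W) :
    traceOut e (lift e M * σ * (lift e M)ᴴ) = M * traceOut e σ * Mᴴ := by
  obtain ⟨γ, _, _, w, hw⟩ := exists_frame e
  funext z z'
  rw [lift_conjTranspose, traceOut_join hw]
  simp only [mul_lift_join hw, lift_mul_join hw]
  rw [Matrix.mul_apply]
  simp only [Matrix.mul_apply, traceOut_join hw, Finset.mul_sum, Finset.sum_mul]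
  rw [Finset.sum_comm]
  refine Finset.sum_congr rfl fun b _ => ?_
  rw [Finset.sum_comm]

lemma traceOut_ap (e : ι ↪ W) (ρ : Op ι) : traceOut e (ap e ρ) = ρ := by
  obtain ⟨γ, _, _, w, hw⟩ := exists_frame e
  funext z z'
  rw [traceOut_join hw]
  simp [ap_join hw]

/-- The frame of a composed embedding. -/
lemma IsFrame.trans {ε : Type} {e : ι ↪ κ} {f : κ ↪ W} {w : ι ⊕ γ ≃ κ} {w' : κ ⊕ ε ≃ W}
    (hw : IsFrame e w) (hw' : IsFrame f w') :
    IsFrame (e.trans f) ((Equiv.sumAssoc ι γ ε).symm.trans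
      ((Equiv.sumCongr w (Equiv.refl ε)).trans w')) := fun i => by
  simp [hw i, hw' (e i)]

lemma join_trans {ε : Type} (w : ι ⊕ γ ≃ κ) (w' : κ ⊕ ε ≃ W) (a : ι → Bool) (g : γ → Bool)
    (h : ε → Bool) :
    join ((Equiv.sumAssoc ι γ ε).symm.trans ((Equiv.sumCongr w (Equiv.refl ε)).trans w'))
      a (Sum.elim g h) = join w' (join w a g) h := by
  funext x
  obtain ⟨y, rfl⟩ := w'.surjective x
  rcases y with y | y
  · obtain ⟨z, rfl⟩ := w.surjective y
    rcases z with z | z <;> simp [join]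
  · simp [join]

lemma sum_sum_elim {A B M : Type} [Fintype A] [Fintype B] [DecidableEq A] [DecidableEq B]
    [AddCommMonoid M] (f : (A ⊕ B → Bool) → M) :
    ∑ u, f u = ∑ a, ∑ b, f (Sum.elim a b) := by
  rw [sum_join (Equiv.refl (A ⊕ B))]; rfl

lemma traceOut_trans (e : ι ↪ κ) (f : κ ↪ W) (σ : Op W) :
    traceOut e (traceOut f σ) = traceOut (e.trans f) σ := by
  obtain ⟨γ, _, _, w, hw⟩ := exists_frame e
  obtain ⟨ε, _, _, w', hw'⟩ := exists_frame f
  funext z z'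
  rw [traceOut_join hw, traceOut_join (hw.trans hw'), sum_sum_elim]
  simp only [join_trans, traceOut_join hw']

end Operators


/-! ## Circuits -/

section Circuits
variable {ι κ γ δ W V : Type}

/-- The gate `g` on a larger register. -/
def Gate.map (e : ι ↪ W) (g : Gate ι) : Gate W := { g with wires := g.wires.trans e }

/-- The circuit `C` on a larger register. -/
def Circuit.map (e : ι ↪ W) (C : Circuit ι) : Circuit W := List.map (Gate.map e) C

/-- The inverse of a gate. -/
def Gate.adj (g : Gate ι) : Gate ι :=
  { g with
    mat := g.matᴴ
    unitary := by
      have := g.unitary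
      rw [Matrix.mem_unitaryGroup_iff, Matrix.star_eq_conjTranspose] at *
      rw [Matrix.conjTranspose_conjTranspose]
      exact mul_eq_one_comm.1 this }

/-- The inverse of a circuit. -/
def Circuit.adj (C : Circuit ι) : Circuit ι := (List.map Gate.adj C).reverse

variable [Fintype ι] [DecidableEq ι] [Fintype κ] [DecidableEq κ] [Fintype W] [DecidableEq W]
  [Fintype V] [DecidableEq V] [Fintype γ] [DecidableEq γ] [Fintype δ] [DecidableEq δ]

lemma Gate.toOp_map (e : ι ↪ W) (g : Gate ι) : (g.map e).toOp = lift e g.toOp := by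
  rw [g.toOp_eq_lift, lift_lift]; rfl

lemma Gate.toOp_adj (g : Gate ι) : g.adj.toOp = g.toOpᴴ := by
  rw [g.toOp_eq_lift, lift_conjTranspose]; rfl

lemma Gate.toOp_unitary (g : Gate ι) : g.toOpᴴ * g.toOp = 1 := by
  rw [g.toOp_eq_lift, lift_conjTranspose, ← lift_mul]
  have := g.unitary
  rw [Matrix.mem_unitaryGroup_iff', Matrix.star_eq_conjTranspose] at this
  rw [this, lift_one]

lemma Circuit.toOp_append (C D : Circuit ι) :
    Circuit.toOp (C ++ D) = Circuit.toOp D * Circuit.toOp C := by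
  induction C with
  | nil => simp [Circuit.toOp]
  | cons g C ih => simp [Circuit.toOp, ih, Matrix.mul_assoc]

lemma Circuit.toOp_map (e : ι ↪ W) (C : Circuit ι) :
    Circuit.toOp (C.map e) = lift e (Circuit.toOp C) := by
  induction C with
  | nil => simp [Circuit.map, Circuit.toOp, lift_one]
  | cons g C ih =>
    simp only [Circuit.map, List.map_cons, Circuit.toOp] at *
    rw [lift_mul, ← ih, Gate.toOp_map]

lemma Circuit.toOp_adj (C : Circuit ι) : Circuit.toOp C.adj = (Circuit.toOp C)ᴴ := by
  induction C with
  | nil => simp [Circuit.adj, Circuit.toOp]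
  | cons g C ih =>
    have : Circuit.adj (g :: C) = Circuit.adj C ++ [g.adj] := by simp [Circuit.adj]
    rw [this, Circuit.toOp_append, ih]
    simp [Circuit.toOp, Gate.toOp_adj]

lemma Circuit.conjTranspose_mul_toOp (C : Circuit ι) :
    (Circuit.toOp C)ᴴ * Circuit.toOp C = 1 := by
  induction C with
  | nil => simp [Circuit.toOp]
  | cons g C ih =>
    rw [Circuit.toOp, Matrix.conjTranspose_mul, Matrix.mul_assoc, ← Matrix.mul_assoc (Circuit.toOp C)ᴴ, ih,
      Matrix.one_mul, Gate.toOp_unitary]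

lemma Circuit.length_map (e : ι ↪ W) (C : Circuit ι) : (C.map e).length = C.length := by
  simp [Circuit.map]

lemma Circuit.length_adj (C : Circuit ι) : C.adj.length = C.length := by
  simp [Circuit.adj]

/-! ## Amalgams of registers -/

/-- Adding spectator qubits to a decomposition. -/
def swapFrame (γ : Type) (w : ι ⊕ δ ≃ W) : (ι ⊕ γ) ⊕ δ ≃ W ⊕ γ :=
  (Equiv.sumAssoc ι γ δ).trans ((Equiv.sumCongr (Equiv.refl ι) (Equiv.sumComm γ δ)).trans
    ((Equiv.sumAssoc ι δ γ).symm.trans (Equiv.sumCongr w (Equiv.refl γ))))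

lemma join_swapFrame (w : ι ⊕ δ ≃ W) (a : ι → Bool) (g : γ → Bool) (d : δ → Bool) :
    join (swapFrame γ w) (Sum.elim a g) d = Sum.elim (join w a d) g := by
  funext x
  rcases x with x | x
  · obtain ⟨z, rfl⟩ := w.surjective x
    rcases z with z | z <;> simp [join, swapFrame]
  · simp [join, swapFrame]

lemma join_refl (a : ι → Bool) (g : γ → Bool) : join (Equiv.refl (ι ⊕ γ)) a g = Sum.elim a g := rfl

/-- An embedding, extended by the identity on spectator qubits. -/
def withSpec (γ : Type) (e : ι ↪ W) : ι ⊕ γ ↪ W ⊕ γ := e.sumMap (Function.Embedding.refl γ)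

lemma isFrame_swapFrame {e : ι ↪ W} {w : ι ⊕ δ ≃ W} (hw : IsFrame e w) :
    IsFrame (withSpec γ e) (swapFrame γ w) := fun i => by
  rcases i with i | i
  · simp [swapFrame, withSpec, hw i]
  · simp [swapFrame, withSpec]

lemma iso_mul_join {e : ι ↪ W} {w : ι ⊕ γ ≃ W} (hw : IsFrame e w) {A : Type*}
    (M : Matrix (ι → Bool) A ℂ) (a : ι → Bool) (g : γ → Bool) (v : A) :
    (iso e * M) (join w a g) v = if g = (fun _ => false) then M a v else 0 := by
  rw [Matrix.mul_apply]
  simp only [iso_join hw]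
  by_cases hg : g = fun _ => false <;> simp [hg]

lemma mul_iso_apply {A : Type} [DecidableEq A] (e : ι ↪ W) (M : Matrix A (W → Bool) ℂ) (c : A)
    (a : ι → Bool) : (M * iso e) c a = M c (zext e a) := fm_mul_apply ..

/-- Two registers can be amalgamated along a common part. -/
lemma exists_amalgam (e₁ : κ ↪ W) (e₂ : κ ↪ V) :
    ∃ (X : Type) (_ : Fintype X) (_ : DecidableEq X) (i₁ : W ↪ X) (i₂ : V ↪ X),
      Fintype.card X ≤ Fintype.card W + Fintype.card V ∧ e₁.trans i₁ = e₂.trans i₂ ∧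
      (∀ σ, traceOut i₂ (ap i₁ σ) = ap e₂ (traceOut e₁ σ)) ∧
      ∀ M U, M * iso e₁ = iso e₁ * U → lift i₁ M * iso i₂ = iso i₂ * lift e₂ U := by
  obtain ⟨ε, _, _, w₁, hw₁⟩ := exists_frame e₁
  obtain ⟨δ, _, _, w₂, hw₂⟩ := exists_frame e₂
  -- The amalgam is the pushout over `κ`: the qubits `δ` of `V` outside `κ` are added to `W`.
  -- Discarding and then appending thus agrees with appending and then discarding, and an operator
  -- clean on `W` stays clean with `δ` as spectators.
  let i₂ : V ↪ W ⊕ δ := w₂.symm.toEmbedding.trans (withSpec δ e₁)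
  let w : V ⊕ ε ≃ W ⊕ δ := (Equiv.sumCongr w₂.symm (Equiv.refl ε)).trans (swapFrame δ w₁)
  have hw : IsFrame i₂ w := fun i => by
    have := isFrame_swapFrame (γ := δ) hw₁ (w₂.symm i)
    simpa [w, i₂] using this
  have hj : ∀ a d h, join w (join w₂ a d) h = Sum.elim (join w₁ a h) d := by
    intro a d h
    rw [← join_swapFrame]
    funext x
    obtain ⟨y, rfl⟩ := w.surjective x
    rcases y with y | y
    · obtain ⟨z, rfl⟩ := w₂.surjective y
      rcases z with z | z <;> simp [join, w]
    · simp [join, w]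
  refine ⟨W ⊕ δ, inferInstance, inferInstance, Function.Embedding.inl, i₂, ?_, ?_, ?_, ?_⟩
  · have := Fintype.card_congr w₂
    simp only [Fintype.card_sum] at *
    omega
  · ext x
    simp [i₂, ← hw₂ x, withSpec]
  · intro σ
    refine op_ext_join w₂ fun a d a' d' => ?_
    rw [traceOut_join hw, ap_join hw₂]
    simp only [hj, ← join_refl, ap_join isFrame_inl, traceOut_join hw₁]
    split_ifs <;> simp
  · intro M U h
    ext u v
    obtain ⟨p, d, rfl⟩ := exists_join (Equiv.refl (W ⊕ δ)) u
    obtain ⟨a, f, rfl⟩ := exists_join w₁ p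
    obtain ⟨b, d', rfl⟩ := exists_join w₂ v
    have hz : zext i₂ (join w₂ b d') = join (Equiv.refl _) (zext e₁ b) d' := by
      rw [hw.zext, hj, hw₁.zext]; rfl
    rw [mul_iso_apply, hz, lift_join isFrame_inl, join_refl, ← hj, iso_mul_join hw,
      lift_join hw₂]
    have := congrFun (congrFun h (join w₁ a f)) b
    rw [iso_mul_join hw₁, mul_iso_apply] at this
    rw [this]
    split_ifs <;> rfl

/-! ## Unitaries with clean auxiliary qubits -/

lemma ap_conj_of_intertwine (e : ι ↪ W) {M : Op W} {U : Op ι} (h : M * iso e = iso e * U)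
    (ρ : Op ι) : M * ap e ρ * Mᴴ = ap e (U * ρ * Uᴴ) := by
  have h2 : (iso e)ᴴ * Mᴴ = Uᴴ * (iso e)ᴴ := by
    rw [← Matrix.conjTranspose_mul, h, Matrix.conjTranspose_mul]
  simp only [ap, Matrix.mul_assoc, h2]
  simp only [← Matrix.mul_assoc, h]

/-- The operator `U` is implemented by a circuit of size at most `s` that returns its auxiliary
qubits to the state `0`. -/
def CleanU (s : ℕ) (U : Op W) : Prop :=
  ∃ (X : Type) (_ : Fintype X) (_ : DecidableEq X) (e : W ↪ X) (C : Circuit X),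
    Fintype.card X + C.length ≤ s ∧ Circuit.toOp C * iso e = iso e * U

lemma CleanU.mono {s t : ℕ} {U : Op W} (h : CleanU s U) (hst : s ≤ t) : CleanU t U := by
  obtain ⟨X, _, _, e, C, hs, hC⟩ := h
  exact ⟨X, _, _, e, C, hs.trans hst, hC⟩

lemma Circuit.cleanU (C : Circuit W) : CleanU (Fintype.card W + C.length) (Circuit.toOp C) :=
  ⟨W, inferInstance, inferInstance, Function.Embedding.refl W, C, le_rfl, by
    have h : iso (Function.Embedding.refl W) = 1 := by
      rw [← fm_id, iso]; congr 1; funext a; exact zext_comp (Function.Embedding.refl W) a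
    rw [h, Matrix.mul_one, Matrix.one_mul]⟩

lemma CleanU.one : CleanU (Fintype.card W) (1 : Op W) := Circuit.cleanU []

/-- Over the amalgam along `W` the two circuits have disjoint ancillas, so each circuit can be moved
past the isometry that appends the ancillas of the other. -/
lemma CleanU.mul {s t : ℕ} {U U' : Op W} (h : CleanU s U) (h' : CleanU t U') :
    CleanU (s + t) (U * U') := by
  obtain ⟨X, _, _, e, C, hs, hC⟩ := h
  obtain ⟨X', _, _, e', C', hs', hC'⟩ := h'
  obtain ⟨Y, _, _, i, i', hY, hi, -, -⟩ := exists_amalgam e e'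
  refine ⟨Y, inferInstance, inferInstance, e.trans i, C'.map i' ++ C.map i, ?_, ?_⟩
  · simp only [List.length_append, Circuit.length_map]; omega
  · rw [Circuit.toOp_append, Circuit.toOp_map, Circuit.toOp_map, Matrix.mul_assoc]
    conv_lhs => rw [hi, iso_trans, ← Matrix.mul_assoc (lift i' _), lift_mul_iso, Matrix.mul_assoc,
      hC', ← Matrix.mul_assoc (iso i'), ← iso_trans, ← hi, iso_trans]
    rw [iso_trans]
    simp only [← Matrix.mul_assoc, lift_mul_iso]
    rw [Matrix.mul_assoc (iso i), hC]
    simp only [Matrix.mul_assoc]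

lemma CleanU.lift {s : ℕ} {U : Op W} (h : CleanU s U) (f : W ↪ V) :
    CleanU (s + Fintype.card V) (MeasProtocol.lift f U) := by
  obtain ⟨X, _, _, e, C, hs, hC⟩ := h
  obtain ⟨Y, _, _, i, i', hY, hi, -, hU⟩ := exists_amalgam e f
  refine ⟨Y, inferInstance, inferInstance, i', C.map i, ?_, ?_⟩
  · rw [Circuit.length_map]; omega
  · rw [Circuit.toOp_map]; exact hU _ _ hC

/-- Qubits of `V` outside `W` that start in zero and are returned to zero count as further ancillas.
This is how compute-use-uncompute constructions are concluded. -/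
lemma CleanU.restrict {s : ℕ} {U : Op V} (h : CleanU s U) (f : W ↪ V) {U' : Op W}
    (hU : U * iso f = iso f * U') : CleanU s U' := by
  obtain ⟨X, _, _, e, C, hs, hC⟩ := h
  refine ⟨X, inferInstance, inferInstance, f.trans e, C, hs, ?_⟩
  rw [iso_trans, ← Matrix.mul_assoc, hC, Matrix.mul_assoc, hU, Matrix.mul_assoc]

/-- Every unitary on at most three qubits is a gate. -/
lemma CleanU.of_card_le {U : Op W} (hW : Fintype.card W ≤ 3) (hU : Uᴴ * U = 1) : CleanU 4 U := by
  let w : Fin (Fintype.card W) ≃ W := (Fintype.equivFin W).symm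
  let E : (W → Bool) ≃ Bits (Fintype.card W) := Equiv.arrowCongr w.symm (Equiv.refl Bool)
  let g : Gate W :=
    { arity := Fintype.card W
      arity_le := hW
      wires := w.toEmbedding
      mat := U.submatrix E.symm E.symm
      unitary := by
        rw [Matrix.mem_unitaryGroup_iff', Matrix.star_eq_conjTranspose,
          Matrix.conjTranspose_submatrix, Matrix.submatrix_mul_equiv, hU,
          Matrix.submatrix_one_equiv] }
  have hg : g.toOp = U := by
    ext x y
    have : ∀ i, i ∉ Set.range g.wires → x i = y i := by
      intro i hi
      exact absurd ⟨w.symm i, by simp [g]⟩ hi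
    simp only [Gate.toOp, if_pos this]
    show U (E.symm (x ∘ w)) (E.symm (y ∘ w)) = U x y
    have h : ∀ z : W → Bool, E.symm (z ∘ w) = z := by
      intro z; funext i; simp [E, Equiv.arrowCongr]
    rw [h, h]
  have := Circuit.cleanU [g]
  simp only [Circuit.toOp, hg, Matrix.one_mul, List.length_singleton] at this
  exact this.mono (by omega)

/-! ## Efficiently realized channels -/

/-- The map `Φ` is realized by a circuit of size at most `s`. -/
def Realizes (s : ℕ) (Φ : Op ι → Op κ) : Prop :=
  ∃ (X : Type) (_ : Fintype X) (_ : DecidableEq X) (e : ι ↪ X) (f : κ ↪ X) (C : Circuit X),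
    Fintype.card X + C.length ≤ s ∧
      ∀ ρ, Φ ρ = traceOut f (Circuit.toOp C * ap e ρ * (Circuit.toOp C)ᴴ)

lemma QProc.realizes (A : QProc ι κ) :
    Realizes (Fintype.card ι + (A.anc + A.circ.length)) A.apply :=
  ⟨ι ⊕ Fin A.anc, inferInstance, inferInstance, Function.Embedding.inl, A.out, A.circ, by
    simp [Nat.add_assoc], fun ρ => by rw [QProc.apply, appendZeros_eq]⟩

/-- Clean ancillas end in the product state zero, so tracing them out leaves the ideal output. -/
lemma CleanU.realizes {s : ℕ} {U : Op W} (h : CleanU s U) (e : ι ↪ W) (f : κ ↪ W) :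
    Realizes s fun ρ => traceOut f (U * ap e ρ * Uᴴ) := by
  obtain ⟨X, _, _, i, C, hs, hC⟩ := h
  refine ⟨X, inferInstance, inferInstance, e.trans i, f.trans i, C, hs, fun ρ => ?_⟩
  rw [← traceOut_trans, ← ap_ap, ap_conj_of_intertwine i hC, traceOut_ap]

/-- `Realizes` allows any finite register containing the input; numbering the qubits outside the
input brings it into the form required of a `QProc`. -/
lemma Realizes.exists_qProc {s : ℕ} {Φ : Op ι → Op κ} (h : Realizes s Φ) :
    ∃ A : QProc ι κ, A.anc + A.circ.length ≤ s ∧ A.apply = Φ := by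
  obtain ⟨X, _, _, e, f, C, hs, hC⟩ := h
  obtain ⟨γ, _, _, w, hw⟩ := exists_frame e
  let i : X ↪ ι ⊕ Fin (Fintype.card γ) :=
    (w.symm.trans (Equiv.sumCongr (Equiv.refl ι) (Fintype.equivFin γ))).toEmbedding
  refine ⟨⟨Fintype.card γ, C.map i, f.trans i⟩, ?_, funext fun ρ => ?_⟩
  · have := Fintype.card_congr w
    simp only [Fintype.card_sum] at this
    simp only [Circuit.length_map]
    omega
  · have hi : (Function.Embedding.inl : ι ↪ ι ⊕ Fin (Fintype.card γ)) = e.trans i := by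
      ext x
      simp [i, ← hw x]
    rw [hC, QProc.apply, appendZeros_eq]
    simp only
    rw [Circuit.toOp_map, hi, ← ap_ap, ← ap_conj, ← traceOut_trans, traceOut_ap]

/-- Amalgamating along the middle register postpones all discarding to the end: the base change
property of `exists_amalgam` exchanges the first partial trace with the appending of the second set
of ancillas. -/
lemma Realizes.comp {s t : ℕ} {Φ : Op ι → Op κ} {Ψ : Op κ → Op W} (hΨ : Realizes t Ψ)
    (hΦ : Realizes s Φ) : Realizes (s + t) (Ψ ∘ Φ) := by
  obtain ⟨X, _, _, e, f, C, hs, hC⟩ := hΦ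
  obtain ⟨X', _, _, e', f', C', hs', hC'⟩ := hΨ
  obtain ⟨Y, _, _, i, i', hY, hi, htr, -⟩ := exists_amalgam f e'
  refine ⟨Y, inferInstance, inferInstance, e.trans i, f'.trans i', C.map i ++ C'.map i', ?_, ?_⟩
  · simp only [List.length_append, Circuit.length_map]; omega
  · intro ρ
    rw [Function.comp_apply, hC', hC, ← htr, ← traceOut_conj, traceOut_trans, ap_conj, ap_ap,
      Circuit.toOp_append, Circuit.toOp_map, Circuit.toOp_map, Matrix.conjTranspose_mul]
    simp only [Matrix.mul_assoc]

/-- The block of an operator that belongs to the states `g`, `g'` of the spectator qubits. -/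
def blk (σ : Op (ι ⊕ γ)) (g g' : γ → Bool) : Op ι := fun x y => σ (Sum.elim x g) (Sum.elim y g')

/-- The map `Φ`, tensored with the identity on spectator qubits. -/
def par (γ : Type) (Φ : Op ι → Op κ) (σ : Op (ι ⊕ γ)) : Op (κ ⊕ γ) := fun u v =>
  Φ (blk σ (u ∘ Sum.inr) (v ∘ Sum.inr)) (u ∘ Sum.inl) (v ∘ Sum.inl)

lemma blk_par (Φ : Op ι → Op κ) (σ : Op (ι ⊕ γ)) (g g' : γ → Bool) :
    blk (par γ Φ σ) g g' = Φ (blk σ g g') := rfl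

lemma op_ext_blk {σ τ : Op (ι ⊕ γ)} (h : ∀ g g', blk σ g g' = blk τ g g') : σ = τ :=
  op_ext_join (Equiv.refl _) fun a g a' g' => congrFun (congrFun (h g g') a) a'

lemma blk_conj (M : Op ι) (σ : Op (ι ⊕ γ)) (g g' : γ → Bool) :
    blk (lift Function.Embedding.inl M * σ * (lift Function.Embedding.inl M)ᴴ) g g'
      = M * blk σ g g' * Mᴴ := by
  ext x y
  rw [blk, lift_conjTranspose, ← join_refl, ← join_refl, mul_lift_join isFrame_inl,
    Matrix.mul_apply]
  simp only [lift_mul_join isFrame_inl, Matrix.mul_apply]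
  rfl

lemma blk_ap (e : ι ↪ W) (σ : Op (ι ⊕ γ)) (g g' : γ → Bool) :
    blk (ap (withSpec γ e) σ) g g' = ap e (blk σ g g') := by
  obtain ⟨δ, _, _, w, hw⟩ := exists_frame e
  refine op_ext_join w fun a d a' d' => ?_
  rw [blk, ap_join hw, ← join_swapFrame, ← join_swapFrame, ap_join (isFrame_swapFrame hw)]
  rfl

lemma blk_traceOut (f : κ ↪ W) (σ : Op (W ⊕ γ)) (g g' : γ → Bool) :
    blk (traceOut (withSpec γ f) σ) g g' = traceOut f (blk σ g g') := by
  obtain ⟨δ, _, _, w, hw⟩ := exists_frame f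
  ext x y
  rw [blk, traceOut_join hw, traceOut_join (isFrame_swapFrame hw)]
  simp only [join_swapFrame]
  rfl

/-- The same circuit is run beside the spectators. Conjugation, appending and tracing out act
separately on each block, and the blocks determine the operator. -/
lemma Realizes.par {s : ℕ} {Φ : Op ι → Op κ} (h : Realizes s Φ) (γ : Type) [Fintype γ]
    [DecidableEq γ] : Realizes (s + Fintype.card γ) (par γ Φ) := by
  obtain ⟨X, _, _, e, f, C, hs, hC⟩ := h
  refine ⟨X ⊕ γ, inferInstance, inferInstance, withSpec γ e, withSpec γ f,
    C.map Function.Embedding.inl, ?_, fun σ => op_ext_blk fun g g' => ?_⟩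
  · simp only [Fintype.card_sum, Circuit.length_map]; omega
  · rw [blk_par, hC, blk_traceOut, Circuit.toOp_map, blk_conj, blk_ap]

end Circuits


/-! ## Reversible evaluation of Boolean functions -/

section Oracles
variable {ι κ γ δ W V : Type}
variable [Fintype ι] [DecidableEq ι] [Fintype κ] [DecidableEq κ] [Fintype W] [DecidableEq W]
  [Fintype V] [DecidableEq V] [Fintype γ] [DecidableEq γ] [Fintype δ] [DecidableEq δ]

/-- The function `π` applied to a subregister. -/
def liftFn (e : ι ↪ W) (π : (ι → Bool) → (ι → Bool)) (v : W → Bool) : W → Bool :=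
  Function.extend e (π (v ∘ e)) v

lemma lift_fm (e : ι ↪ W) (π : (ι → Bool) → (ι → Bool)) : lift e (fm π) = fm (liftFn e π) := by
  obtain ⟨γ, _, _, w, hw⟩ := exists_frame e
  refine op_ext_join w fun a g a' g' => ?_
  have : liftFn e π (join w a' g') = join w (π a') g' := by
    funext x
    rw [liftFn, hw.comp]
    obtain ⟨y, rfl⟩ := w.surjective x
    rcases y with y | y
    · rw [join_inl, hw y, e.injective.extend_apply]
    · rw [join_inr, Function.extend_apply', join_inr]
      rintro ⟨k, hk⟩
      rw [← hw k] at hk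
      simpa using w.injective hk
  rw [lift_join hw]
  simp only [fm, this, join_inj]
  split_ifs <;> simp_all

lemma lift_fm_eq (e : ι ↪ W) {π : (ι → Bool) → (ι → Bool)} {θ : (W → Bool) → (W → Bool)}
    (h : ∀ v i, θ v (e i) = π (v ∘ e) i) (h' : ∀ v x, x ∉ Set.range e → θ v x = v x) :
    lift e (fm π) = fm θ := by
  rw [lift_fm]
  congr 1
  funext v x
  by_cases hx : x ∈ Set.range e
  · obtain ⟨i, rfl⟩ := hx
    rw [h, liftFn, e.injective.extend_apply]
  · rw [h' v x hx, liftFn, Function.extend_apply' _ _ _ hx]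

/-- The function on basis vectors that adds `f`, evaluated at the first part of the register, to
the second part. -/
def xorVecBits (f : (W → Bool) → (κ → Bool)) (v : W ⊕ κ → Bool) : W ⊕ κ → Bool :=
  Sum.elim (v ∘ Sum.inl) fun k => xor (v (Sum.inr k)) (f (v ∘ Sum.inl) k)

lemma xorVecBits_involutive (f : (W → Bool) → (κ → Bool)) :
    Function.Involutive (xorVecBits f) := fun v => by
  funext x
  rcases x with x | x
  · rfl
  · have : xorVecBits f v ∘ Sum.inl = v ∘ Sum.inl := rfl
    rw [xorVecBits, Sum.elim_inr, this, xorVecBits, Sum.elim_inr, Bool.xor_assoc, Bool.xor_self,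
      Bool.xor_false]

def xorVec (f : (W → Bool) → (κ → Bool)) : Op (W ⊕ κ) := fm (xorVecBits f)

/-- The Boolean function `φ` can be added to a target qubit by a circuit of size at most `s`. -/
def XorC (s : ℕ) (φ : (W → Bool) → Bool) : Prop :=
  CleanU s (xorVec (κ := Unit) fun x _ => φ x)

lemma fm_conjTranspose_of_involutive {A : Type} [Fintype A] [DecidableEq A] {π : A → A}
    (hπ : Function.Involutive π) : (fm π)ᴴ = fm π := by
  ext a b
  simp only [Matrix.conjTranspose_apply, fm]
  have : b = π a ↔ a = π b := ⟨fun h => by rw [h, hπ a], fun h => by rw [h, hπ b]⟩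
  simp only [this]
  split_ifs <;> simp

lemma fm_involutive_mul_self {A : Type} [Fintype A] [DecidableEq A] {π : A → A}
    (hπ : Function.Involutive π) : fm π * fm π = 1 := by
  rw [fm_mul, hπ.comp_self, fm_id]

/-- Two inputs and the target make three qubits, so the permutation is a single gate; the `4` counts
these qubits and that gate. -/
lemma XorC.of_card_le (φ : (W → Bool) → Bool) (hW : Fintype.card W ≤ 2) : XorC 4 φ := by
  refine CleanU.of_card_le (by simp only [Fintype.card_sum, Fintype.card_unit]; omega) ?_
  rw [xorVec, fm_conjTranspose_of_involutive (xorVecBits_involutive _),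
    fm_involutive_mul_self (xorVecBits_involutive _)]

lemma XorC.xor {s t : ℕ} {φ ψ : (W → Bool) → Bool} (hφ : XorC s φ) (hψ : XorC t ψ) :
    XorC (s + t) fun x => Bool.xor (φ x) (ψ x) := by
  have h : xorVec (κ := Unit) (fun x _ => Bool.xor (φ x) (ψ x))
      = xorVec (κ := Unit) (fun x _ => φ x) * xorVec (κ := Unit) fun x _ => ψ x := by
    rw [xorVec, xorVec, xorVec, fm_mul]
    congr 1
    funext v x
    rcases x with x | x
    · rfl
    · have : xorVecBits (κ := Unit) (fun x _ => ψ x) v ∘ Sum.inl = v ∘ Sum.inl := rfl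
      simp only [xorVecBits, Function.comp_apply, Sum.elim_inr, Sum.elim_comp_inl]
      cases φ (v ∘ Sum.inl) <;> cases ψ (v ∘ Sum.inl) <;> simp
  rw [XorC, h]
  exact CleanU.mul hφ hψ

lemma XorC.comap {s : ℕ} {φ : (ι → Bool) → Bool} (h : XorC s φ) (e : ι ↪ W) :
    XorC (s + (Fintype.card W + 1)) fun x => φ (x ∘ e) := by
  have := CleanU.lift h (withSpec Unit e)
  rw [xorVec, lift_fm_eq (θ := xorVecBits (κ := Unit) fun x _ => φ (x ∘ e))] at this
  · simpa only [Fintype.card_sum, Fintype.card_unit, XorC, xorVec] using this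
  · intro v i
    rcases i with i | i <;> rfl
  · intro v x hx
    rcases x with x | x
    · rfl
    · exact absurd ⟨Sum.inr x, rfl⟩ hx

lemma XorC.bit (i : W) : XorC (4 + (Fintype.card W + 1)) fun x => x i :=
  (XorC.of_card_le (W := Unit) (fun x => x ()) (by simp)).comap
    (⟨fun _ => i, fun _ _ _ => rfl⟩ : Unit ↪ W)

lemma XorC.const (b : Bool) : XorC (4 + (Fintype.card W + 1)) fun _ : W → Bool => b :=
  (XorC.of_card_le (W := Empty) (fun _ => b) (by simp)).comap
    (⟨fun i => i.elim, fun i => i.elim⟩ : Empty ↪ W)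

lemma XorC.mono {s t : ℕ} {φ : (W → Bool) → Bool} (h : XorC s φ) (hst : s ≤ t) : XorC t φ :=
  CleanU.mono h hst

/-- The size of a circuit that evaluates `m` Boolean functions of size `s` on a register of `w`
qubits. -/
def vecSize (m w s : ℕ) : ℕ := (m + 1) * (s + (w + m))

/-- The output bits are added one target at a time, by induction on the set `S` of targets already
treated. -/
lemma CleanU.xorVec {s : ℕ} {f : (W → Bool) → (κ → Bool)} (h : ∀ k, XorC s fun x => f x k) :
    CleanU (vecSize (Fintype.card κ) (Fintype.card W) s) (MeasProtocol.xorVec f) := by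
  suffices H : ∀ S : Finset κ, CleanU ((S.card + 1) * (s + (Fintype.card W + Fintype.card κ)))
      (MeasProtocol.xorVec fun x k => decide (k ∈ S) && f x k) by
    simpa [vecSize] using H Finset.univ
  intro S
  induction S using Finset.induction_on with
  | empty =>
    have : (MeasProtocol.xorVec fun x k => decide (k ∈ (∅ : Finset κ)) && f x k) = 1 := by
      rw [← fm_id, MeasProtocol.xorVec]
      congr 1
      funext v x
      rcases x with x | x
      · rfl
      · simp [xorVecBits]
    rw [this]
    refine CleanU.one.mono ?_
    simp
  | insert a S ha ih =>
    let e : W ⊕ Unit ↪ W ⊕ κ :=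
      (Function.Embedding.refl W).sumMap (⟨fun _ => a, fun _ _ _ => rfl⟩ : Unit ↪ κ)
    have h1 := (CleanU.lift (h a) e).mul ih
    rw [MeasProtocol.xorVec, lift_fm_eq (θ := xorVecBits fun x k => decide (k = a) && f x k),
      MeasProtocol.xorVec, fm_mul] at h1
    · have h2 : (xorVecBits fun x k => decide (k = a) && f x k) ∘
          (xorVecBits fun x k => decide (k ∈ S) && f x k)
          = xorVecBits fun x k => decide (k ∈ insert a S) && f x k := by
        funext v x
        rcases x with x | x
        · rfl
        · simp only [xorVecBits, Function.comp_apply, Sum.elim_inr, Sum.elim_comp_inl]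
          by_cases hx : x = a
          · subst hx; simp [ha]
          · simp [hx]
      rw [h2] at h1
      refine h1.mono ?_
      rw [Finset.card_insert_of_notMem ha, Fintype.card_sum]
      ring_nf
      rfl
    · intro v i
      rcases i with i | i
      · rfl
      · show Bool.xor (v (Sum.inr a)) (decide (a = a) && f (v ∘ Sum.inl) a)
          = Bool.xor (v (Sum.inr a)) (f (v ∘ Sum.inl) a)
        simp
    · intro v x hx
      rcases x with x | x
      · rfl
      · have : x ≠ a := fun h => hx ⟨Sum.inr (), by subst h; rfl⟩
        simp [xorVecBits, this]

lemma fm_iso_eq (e : ι ↪ W) {π : (ι → Bool) → (ι → Bool)} {θ : (W → Bool) → (W → Bool)}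
    (h : ∀ a, θ (zext e a) = zext e (π a)) : fm θ * iso e = iso e * fm π := by
  rw [iso, fm_mul, fm_mul]; congr 1; funext a; exact h a

lemma zext_inl (a : W → Bool) :
    zext (Function.Embedding.inl : W ↪ W ⊕ κ) a = Sum.elim a fun _ => false := by
  rw [isFrame_inl.zext]; rfl

/-- Compute `f x` into `κ` ancillas, evaluate `φ` on them, and uncompute `f x`. The oracle for `f`
is its own inverse, which accounts for the factor 2; each of the three steps is lifted to the full
register. -/
lemma XorC.subst {s t : ℕ} {φ : (κ → Bool) → Bool} {f : (W → Bool) → (κ → Bool)}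
    (hφ : XorC t φ) (hf : ∀ k, XorC s fun x => f x k) :
    XorC (2 * vecSize (Fintype.card κ) (Fintype.card W) s + t
      + 3 * (Fintype.card W + 1 + Fintype.card κ)) fun x => φ (f x) := by
  let e₁ : W ⊕ κ ↪ (W ⊕ Unit) ⊕ κ := Function.Embedding.inl.sumMap (Function.Embedding.refl κ)
  let e₂ : κ ⊕ Unit ↪ (W ⊕ Unit) ⊕ κ :=
    ⟨Sum.elim Sum.inr fun x => Sum.inl (Sum.inr x), by
      rintro (a | a) (b | b) hab <;> simp at hab ⊢
      exact hab⟩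
  have hV := (CleanU.xorVec hf).lift e₁
  have hM := CleanU.lift hφ e₂
  have eV : MeasProtocol.lift e₁ (xorVec f) = fm fun v => Sum.elim (v ∘ Sum.inl)
      fun k => Bool.xor (v (Sum.inr k)) (f (v ∘ Sum.inl ∘ Sum.inl) k) := by
    refine lift_fm_eq e₁ ?_ ?_
    · intro v i
      rcases i with i | i <;> rfl
    · intro v x hx
      rcases x with (x | x) | x
      · rfl
      · rfl
      · exact absurd ⟨Sum.inr x, rfl⟩ hx
  have eM : MeasProtocol.lift e₂ (xorVec (κ := Unit) fun x _ => φ x) = fm fun v => Sum.elim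
      (Sum.elim (v ∘ Sum.inl ∘ Sum.inl) fun x => Bool.xor (v (Sum.inl (Sum.inr x)))
        (φ (v ∘ Sum.inr))) (v ∘ Sum.inr) := by
    refine lift_fm_eq e₂ ?_ ?_
    · intro v i
      rcases i with i | i <;> rfl
    · intro v x hx
      rcases x with (x | x) | x
      · rfl
      · exact absurd ⟨Sum.inr x, rfl⟩ hx
      · rfl
  rw [eV] at hV
  rw [eM] at hM
  have h := (hV.mul hM).mul hV
  rw [fm_mul, fm_mul] at h
  refine (h.restrict (Function.Embedding.inl : W ⊕ Unit ↪ (W ⊕ Unit) ⊕ κ) (fm_iso_eq _ ?_)).mono ?_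
  · intro a
    rw [zext_inl, zext_inl]
    funext x
    rcases x with (x | x) | x
    · simp [xorVecBits]
    · simp [xorVecBits, Function.comp_def]
    · simp [Function.comp_def]
  · simp only [Fintype.card_sum, Fintype.card_unit]; omega

lemma Gate.IsClassical.exists_fm {g : Gate ι} (hg : g.IsClassical) : ∃ π, g.toOp = fm π := by
  obtain ⟨σ, hσ⟩ := hg
  -- The entry of `permMatrix` at `(x, y)` is 1 when `σ x = y`, so on column vectors the matrix acts
  -- by the inverse permutation.
  refine ⟨liftFn g.wires σ.symm, ?_⟩
  rw [g.toOp_eq_lift, hσ, ← lift_fm]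
  congr 1
  ext x y
  simp only [fm, Equiv.Perm.permMatrix, PEquiv.toMatrix_apply, Equiv.toPEquiv_apply,
    Option.mem_some_iff]
  have : (σ x = y) ↔ (x = σ.symm y) := Equiv.eq_symm_apply σ |>.symm
  simp only [this]

lemma Circuit.exists_fm {C : Circuit ι} (hC : ∀ g ∈ C, g.IsClassical) :
    ∃ π, Circuit.toOp C = fm π := by
  induction C with
  | nil => exact ⟨id, fm_id.symm⟩
  | cons g C ih =>
    obtain ⟨π, hπ⟩ := ih fun g hg => hC g (List.mem_cons_of_mem _ hg)
    obtain ⟨π', hπ'⟩ := (hC g List.mem_cons_self).exists_fm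
    exact ⟨π ∘ π', by rw [Circuit.toOp, hπ, hπ', fm_mul]⟩

lemma traceOut_ketbra (e : κ ↪ W) (u : W → Bool) : traceOut e (ketbra u) = ketbra (u ∘ e) := by
  obtain ⟨γ, _, _, w, hw⟩ := exists_frame e
  obtain ⟨a, g, rfl⟩ := exists_join w u
  ext z z'
  rw [traceOut_join hw, hw.comp]
  simp only [ketbra, Matrix.single_apply, join_inj]
  rw [Finset.sum_eq_single g]
  · simp
  · intro b _ hb; simp [hb.symm]
  · simp

lemma fm_mul_ketbra {π : (W → Bool) → (V → Bool)} (u : W → Bool) :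
    fm π * ketbra u * (fm π)ᴴ = ketbra (π u) := by
  ext x y
  have h1 : ∀ z, (fm π * ketbra u : Matrix (V → Bool) (W → Bool) ℂ) x z
      = if x = π u ∧ z = u then 1 else 0 := by
    intro z
    rw [Matrix.mul_apply, Finset.sum_eq_single u]
    · by_cases hx : x = π u <;> by_cases hz : z = u <;>
        simp [hx, hz, fm, ketbra, Ne.symm]
    · intro b _ hb; simp [ketbra, hb.symm]
    · simp
  rw [Matrix.mul_apply, Finset.sum_congr rfl fun z _ => by rw [h1]]
  simp only [Matrix.conjTranspose_apply, fm, ketbra, Matrix.single_apply]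
  rw [Finset.sum_eq_single u]
  · by_cases hx : x = π u <;> by_cases hy : y = π u <;> simp [hx, hy, eq_comm]
  · intro b _ hb; simp [hb]
  · simp

lemma ketbra_injective : Function.Injective (ketbra : (ι → Bool) → Op ι) := fun a b h => by
  have := congrFun (congrFun h a) a
  simp only [ketbra, Matrix.single_apply] at this
  by_contra hab
  simp [Ne.symm hab] at this

/-- The bits of a function computed by a classical circuit can be evaluated reversibly. -/
lemma XorC.of_qProc (A : QProc ι κ) (hA : ∀ g ∈ A.circ, g.IsClassical)
    {f : (ι → Bool) → (κ → Bool)} (hf : ∀ x, A.apply (ketbra x) = ketbra (f x)) (k : κ) :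
    XorC (5 * (Fintype.card ι + (A.anc + A.circ.length)) + 10) fun x => f x k := by
  obtain ⟨π, hπ⟩ := Circuit.exists_fm hA
  -- A classical circuit is a function `π` on basis strings, and the output bit is simply read from
  -- the wire `A.out k`; the other wires may hold garbage.
  have hfk : ∀ x, f x k = π (Sum.elim x fun _ => false) (A.out k) := by
    intro x
    have := hf x
    rw [QProc.apply, appendZeros_eq, ap_ketbra, hπ, fm_mul_ketbra, traceOut_ketbra] at this
    have := congrFun (ketbra_injective this) k
    rw [← this, zext_inl]; rfl
  let e : ι ⊕ Fin A.anc ↪ (ι ⊕ Unit) ⊕ Fin A.anc :=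
    Function.Embedding.inl.sumMap (Function.Embedding.refl _)
  let c : Unit ⊕ Unit ↪ (ι ⊕ Unit) ⊕ Fin A.anc :=
    ⟨Sum.elim (fun _ => e (A.out k)) fun _ => Sum.inl (Sum.inr ()), by
      rintro (a | a) (b | b) hab
      · rfl
      · rcases h : A.out k with x | x <;> simp [e, h] at hab
      · rcases h : A.out k with x | x <;> simp [e, h] at hab
      · rfl⟩
  have hU := (Circuit.cleanU A.circ).lift e
  have hU' := (Circuit.cleanU A.circ.adj).lift e
  have hM := CleanU.lift (XorC.of_card_le (W := Unit) (fun x => x ()) (by simp)) c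
  have eU : MeasProtocol.lift e (Circuit.toOp A.circ) = fm fun v => Sum.elim (Sum.elim
      (π (v ∘ e) ∘ Sum.inl) (v ∘ Sum.inl ∘ Sum.inr)) (π (v ∘ e) ∘ Sum.inr) := by
    rw [hπ]
    refine lift_fm_eq e ?_ ?_
    · intro v i
      rcases i with i | i <;> rfl
    · intro v x hx
      rcases x with (x | x) | x
      · exact absurd ⟨Sum.inl x, rfl⟩ hx
      · rfl
      · exact absurd ⟨Sum.inr x, rfl⟩ hx
  have eM : MeasProtocol.lift c (xorVec (κ := Unit) fun x _ => x ()) = fm fun v => Sum.elim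
      (Sum.elim (v ∘ Sum.inl ∘ Sum.inl) fun x => Bool.xor (v (Sum.inl (Sum.inr x)))
        (v (e (A.out k)))) (v ∘ Sum.inr) := by
    refine lift_fm_eq c ?_ ?_
    · intro v i
      rcases i with i | i
      · show _ = v (e (A.out k))
        show Sum.elim _ _ (e (A.out k)) = _
        rcases h : A.out k with x | x <;> rfl
      · rfl
    · intro v x hx
      rcases x with (x | x) | x
      · rfl
      · exact absurd ⟨Sum.inr x, rfl⟩ hx
      · rfl
  -- Run the circuit, copy the output wire to the target with a CNOT, and run the circuit backwards
  -- to remove the garbage.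
  have h := (hU'.mul hM).mul hU
  refine (h.restrict (Function.Embedding.inl : ι ⊕ Unit ↪ (ι ⊕ Unit) ⊕ Fin A.anc) ?_).mono ?_
  -- It suffices to show that, on clean ancillas, copying after the circuit equals adding `f x k` to
  -- the target and then running the circuit; the reversed circuit then cancels.
  · have key : MeasProtocol.lift c (xorVec (κ := Unit) fun x _ => x ()) *
        (MeasProtocol.lift e (Circuit.toOp A.circ) *
          iso (Function.Embedding.inl : ι ⊕ Unit ↪ (ι ⊕ Unit) ⊕ Fin A.anc))
        = MeasProtocol.lift e (Circuit.toOp A.circ) *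
          (iso (Function.Embedding.inl : ι ⊕ Unit ↪ (ι ⊕ Unit) ⊕ Fin A.anc) *
            xorVec (κ := Unit) fun x _ => f x k) := by
      rw [eU, eM, iso, xorVec, fm_mul, fm_mul, fm_mul, fm_mul]
      congr 1
      funext v
      have hz : ∀ a : ι ⊕ Unit → Bool, zext (Function.Embedding.inl :
          ι ⊕ Unit ↪ (ι ⊕ Unit) ⊕ Fin A.anc) a ∘ e = Sum.elim (a ∘ Sum.inl) fun _ => false := by
        intro a
        rw [zext_inl]
        funext x
        rcases x with x | x <;> rfl
      simp only [Function.comp_apply, hz]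
      simp only [zext_inl]
      funext x
      rcases x with (x | x) | x
      · rfl
      · have : ∀ (p : ι ⊕ Fin A.anc → Bool) (b : Unit → Bool),
            Sum.elim (Sum.elim (p ∘ Sum.inl) b) (p ∘ Sum.inr) (e (A.out k)) = p (A.out k) := by
          intro p b
          rcases A.out k with x | x <;> rfl
        simp only [Sum.elim_inl, Sum.elim_inr, this, ← hfk]
        rfl
      · rfl
    rw [Matrix.mul_assoc, Matrix.mul_assoc, key, Circuit.toOp_adj, ← lift_conjTranspose,
      ← Matrix.mul_assoc]
    rw [lift_conjTranspose, ← lift_mul, Circuit.conjTranspose_mul_toOp, lift_one, Matrix.one_mul]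
  · simp only [Fintype.card_sum, Fintype.card_unit, Fintype.card_fin, Circuit.length_adj]; omega

/-! ## Phase oracles -/

/-- The phase `(-1)^(g u)`. -/
def phaseOp (g : (W → Bool) → Bool) : Op W := Matrix.diagonal fun u => if g u = true then -1 else 1

lemma diagonal_mul_fm {A B : Type} [Fintype A] [DecidableEq A] [Fintype B] [DecidableEq B]
    (d : B → ℂ) (π : A → B) : Matrix.diagonal d * fm π = fm π * Matrix.diagonal (d ∘ π) := by
  ext b a
  rw [Matrix.diagonal_mul, Matrix.mul_diagonal]
  simp only [fm]
  split_ifs with h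
  · simp [h]
  · simp

lemma lift_diagonal (e : ι ↪ W) (d : (ι → Bool) → ℂ) :
    lift e (Matrix.diagonal d) = Matrix.diagonal fun u => d (u ∘ e) := by
  obtain ⟨γ, _, _, w, hw⟩ := exists_frame e
  refine op_ext_join w fun a g a' g' => ?_
  rw [lift_join hw]
  simp only [Matrix.diagonal_apply, join_inj, hw.comp]
  split_ifs <;> simp_all

lemma phaseOp_unitary (g : (W → Bool) → Bool) : (phaseOp g)ᴴ * phaseOp g = 1 := by
  rw [phaseOp, Matrix.diagonal_conjTranspose, Matrix.diagonal_mul_diagonal, ← Matrix.diagonal_one]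
  congr 1
  funext u
  simp only [Pi.star_apply]
  split_ifs <;> simp

/-- Compute `g` into a fresh qubit, apply `Z` to that qubit, and uncompute. -/
lemma CleanU.phaseOp {s : ℕ} {g : (W → Bool) → Bool} (h : XorC s g) :
    CleanU (2 * s + (4 + (Fintype.card W + 1))) (MeasProtocol.phaseOp g) := by
  have hZ := (CleanU.of_card_le (W := Unit) (by simp)
    (phaseOp_unitary fun u : Unit → Bool => u ())).lift (Function.Embedding.inr : Unit ↪ W ⊕ Unit)
  have := (CleanU.mul h hZ).mul h
  refine (this.restrict (Function.Embedding.inl : W ↪ W ⊕ Unit) ?_).mono ?_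
  · rw [MeasProtocol.phaseOp, lift_diagonal, MeasProtocol.phaseOp, MeasProtocol.xorVec, Matrix.mul_assoc, iso,
      fm_mul, Matrix.mul_assoc, diagonal_mul_fm, ← Matrix.mul_assoc, fm_mul]
    rw [← Function.comp_assoc, (xorVecBits_involutive _).comp_self, Function.id_comp]
    congr 2
    funext u
    simp [zext_inl, xorVecBits, Function.comp_def]
    rfl
  · simp only [Fintype.card_sum, Fintype.card_unit]; omega

end Oracles


/-! ## Hadamard transforms -/

section Hadamard
variable {ι κ γ W : Type}
variable [Fintype ι] [DecidableEq ι] [Fintype κ] [DecidableEq κ] [Fintype W] [DecidableEq W]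
  [Fintype γ] [DecidableEq γ]

/-- The matrix entries of the Hadamard transform (for `s = true`) or the identity on a qubit. -/
def had1 (s x y : Bool) : ℂ :=
  if s = true then (if x = true ∧ y = true then -1 else 1) / ((Real.sqrt 2 : ℝ) : ℂ)
    else if x = y then 1 else 0

lemma hadOn_apply (s x y : ι → Bool) : hadOn s x y = ∏ i, had1 (s i) (x i) (y i) := rfl

lemma sqrt_two_mul_self : ((Real.sqrt 2 : ℝ) : ℂ) * ((Real.sqrt 2 : ℝ) : ℂ) = 2 := by
  rw [← Complex.ofReal_mul, Real.mul_self_sqrt (by norm_num)]; norm_num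

lemma star_had1 (s x y : Bool) : star (had1 s x y) = had1 s y x := by
  cases s <;> cases x <;> cases y <;> simp [had1]

lemma had1_mul_had1 (x y x' y' : Bool) : had1 true x y * had1 true x' y'
    = (if x = true ∧ y = true then -1 else 1) * (if x' = true ∧ y' = true then -1 else 1) / 2 := by
  simp only [had1, if_true]
  rw [div_mul_div_comm, sqrt_two_mul_self]

lemma sum_had1_mul_had1 (s x z : Bool) :
    ∑ y, had1 s x y * had1 s y z = if x = z then 1 else 0 := by
  cases s
  · cases x <;> cases z <;> simp [had1]
  · rw [Fintype.sum_bool, had1_mul_had1, had1_mul_had1]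
    cases x <;> cases z <;> norm_num

lemma prod_sum_bits (f : ι → Bool → ℂ) : ∏ i, ∑ b, f i b = ∑ x : ι → Bool, ∏ i, f i (x i) := by
  rw [Finset.prod_univ_sum, Fintype.piFinset_univ]

lemma prod_ite_eq_bits (x y : ι → Bool) :
    (∏ i, if x i = y i then (1 : ℂ) else 0) = if x = y then 1 else 0 := by
  by_cases h : x = y
  · simp [h]
  · rw [if_neg h]
    obtain ⟨i, hi⟩ := Function.ne_iff.1 h
    exact Finset.prod_eq_zero (Finset.mem_univ i) (if_neg hi)

lemma hadOn_conjTranspose (s : ι → Bool) : (hadOn s)ᴴ = hadOn s := by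
  ext x y
  simp only [Matrix.conjTranspose_apply, hadOn_apply, star_prod, star_had1]

lemma hadOn_mul_apply (s t x z : ι → Bool) :
    (hadOn s * hadOn t) x z = ∏ i, ∑ b, had1 (s i) (x i) b * had1 (t i) b (z i) := by
  rw [Matrix.mul_apply, prod_sum_bits]
  simp only [hadOn_apply, Finset.prod_mul_distrib]

lemma hadOn_mul_self (s : ι → Bool) : hadOn s * hadOn s = 1 := by
  ext x z
  rw [hadOn_mul_apply]
  simp only [sum_had1_mul_had1, prod_ite_eq_bits, Matrix.one_apply]

lemma hadOn_mul (s t : ι → Bool) (h : ∀ i, (s i && t i) = false) :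
    hadOn s * hadOn t = hadOn fun i => s i || t i := by
  ext x z
  rw [hadOn_mul_apply, hadOn_apply]
  refine Finset.prod_congr rfl fun i _ => ?_
  have := h i
  generalize s i = a at *
  generalize t i = b at *
  cases a <;> cases b <;> cases x i <;> cases z i <;> simp_all [had1]

/-- On the qubits outside `e` the selection is false, where the one-qubit factor is the identity. -/
lemma lift_hadOn (e : ι ↪ W) {s : ι → Bool} {t : W → Bool} (h : ∀ i, t (e i) = s i)
    (h' : ∀ x, x ∉ Set.range e → t x = false) : lift e (hadOn s) = hadOn t := by
  obtain ⟨γ, _, _, w, hw⟩ := exists_frame e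
  refine op_ext_join w fun a g a' g' => ?_
  rw [lift_join hw, hadOn_apply t, ← Equiv.prod_comp w, Fintype.prod_sum_type]
  have h2 : ∀ y, t (w (Sum.inr y)) = false := fun y => h' _ (by
    rintro ⟨k, hk⟩
    rw [← hw k] at hk
    simpa using w.injective hk)
  have h1 : ∀ y, t (w (Sum.inl y)) = s y := fun y => by rw [hw y, h]
  simp only [join_inl, join_inr, h1, h2]
  have h3 : (∏ x, had1 false (g x) (g' x)) = if g = g' then 1 else 0 := by
    rw [← prod_ite_eq_bits]
    simp [had1]
  rw [h3, hadOn_apply]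
  split_ifs <;> simp

/-- One single-qubit Hadamard gate is applied for each selected qubit, by induction on the selected
set. -/
lemma CleanU.hadOn (s : ι → Bool) :
    CleanU ((Fintype.card ι + 1) * (4 + Fintype.card ι)) (MeasProtocol.hadOn s) := by
  suffices H : ∀ S : Finset ι, CleanU ((S.card + 1) * (4 + Fintype.card ι))
      (MeasProtocol.hadOn fun i => decide (i ∈ S)) by
    have h := H (Finset.univ.filter fun i => s i = true)
    simp only [Finset.mem_filter, Finset.mem_univ, true_and, Bool.decide_eq_true] at h
    refine h.mono (Nat.mul_le_mul_right _ (Nat.succ_le_succ ?_))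
    exact Finset.card_le_univ _
  intro S
  induction S using Finset.induction_on with
  | empty =>
    have : (MeasProtocol.hadOn fun i : ι => decide (i ∈ (∅ : Finset ι))) = 1 := by
      ext x y
      simp [hadOn_apply, had1, prod_ite_eq_bits, Matrix.one_apply]
    rw [this]
    exact CleanU.one.mono (by simp)
  | insert a S ha ih =>
    have h1 : CleanU 4 (MeasProtocol.hadOn fun _ : Unit => true) :=
      CleanU.of_card_le (by simp) (by rw [hadOn_conjTranspose, hadOn_mul_self])
    have h2 := (h1.lift (⟨fun _ => a, fun _ _ _ => rfl⟩ : Unit ↪ ι)).mul ih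
    rw [lift_hadOn (t := fun i => decide (i = a)), hadOn_mul] at h2
    · have : (fun i => decide (i = a) || decide (i ∈ S)) = fun i => decide (i ∈ insert a S) := by
        funext i; simp
      rw [this] at h2
      refine h2.mono ?_
      rw [Finset.card_insert_of_notMem ha]
      ring_nf; rfl
    · intro i
      by_cases hi : i = a <;> simp [hi, ha]
    · intro i; simp; rfl
    · intro x hx
      have : x ≠ a := fun h => hx ⟨(), h.symm⟩
      simp [this]

end Hadamard

/-! ## Polynomial bounds -/

lemma PolyBounded.mono {s t : ℕ → ℕ} (ht : PolyBounded t) (h : ∀ l, s l ≤ t l) : PolyBounded s := by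
  obtain ⟨p, hp⟩ := ht
  exact ⟨p, fun l => (h l).trans (hp l)⟩

lemma PolyBounded.const (c : ℕ) : PolyBounded fun _ => c := ⟨Polynomial.C c, fun l => by simp⟩

lemma PolyBounded.add {s t : ℕ → ℕ} (hs : PolyBounded s) (ht : PolyBounded t) :
    PolyBounded fun l => s l + t l := by
  obtain ⟨p, hp⟩ := hs
  obtain ⟨q, hq⟩ := ht
  exact ⟨p + q, fun l => by rw [Polynomial.eval_add]; exact Nat.add_le_add (hp l) (hq l)⟩

lemma PolyBounded.mul {s t : ℕ → ℕ} (hs : PolyBounded s) (ht : PolyBounded t) :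
    PolyBounded fun l => s l * t l := by
  obtain ⟨p, hp⟩ := hs
  obtain ⟨q, hq⟩ := ht
  exact ⟨p * q, fun l => by rw [Polynomial.eval_mul]; exact Nat.mul_le_mul (hp l) (hq l)⟩

lemma PolyBounded.vecSize {m w s : ℕ → ℕ} (hm : PolyBounded m) (hw : PolyBounded w)
    (hs : PolyBounded s) : PolyBounded fun l => vecSize (m l) (w l) (s l) :=
  (hm.add (.const 1)).mul (hs.add (hw.add hm))

/-! ## Efficiently computable families of Boolean functions -/

/-- The parity of the number of true entries. -/
def parity {J : Type} (S : Finset J) (φ : J → Bool) : Bool :=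
  decide (Odd (S.filter fun j => φ j = true).card)

lemma parity_insert {J : Type} [DecidableEq J] {S : Finset J} {a : J} (ha : a ∉ S) (φ : J → Bool) :
    parity (insert a S) φ = xor (φ a) (parity S φ) := by
  unfold parity
  rw [Finset.filter_insert]
  cases h : φ a
  · simp
  · rw [if_pos rfl, Finset.card_insert_of_notMem (by simp [ha])]
    simp [Nat.odd_add_one, ← decide_not]

lemma dot_eq_parity {m : ℕ} (d v : Bits m) : dot d v = parity Finset.univ fun j => d j && v j := by
  simp [dot, parity]

section Eff
variable {P P' : ℕ → Type} {ι κ J W : ℕ → Type}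
variable [∀ l, Fintype (ι l)] [∀ l, DecidableEq (ι l)] [∀ l, Fintype (κ l)] [∀ l, DecidableEq (κ l)]
  [∀ l, Fintype (W l)] [∀ l, DecidableEq (W l)] [∀ l, Fintype (J l)] [∀ l, DecidableEq (J l)]

/-- The number of qubits is polynomial in the security parameter. -/
def PolyCard (W : ℕ → Type) [∀ l, Fintype (W l)] : Prop := PolyBounded fun l => Fintype.card (W l)

lemma PolyCard.bool : PolyCard fun _ => Bool := PolyBounded.const 2

/-- A family of Boolean functions, indexed by the security parameter and further parameters `P`,
can be evaluated by circuits of polynomial size, uniformly in the parameters. -/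
def Eff (φ : ∀ l, P l → (W l → Bool) → Bool) : Prop :=
  ∃ s, PolyBounded s ∧ ∀ l p, XorC (s l) (φ l p)

lemma Eff.bit (hW : PolyCard W) (i : ∀ l, P l → W l) : Eff fun l p (x : W l → Bool) => x (i l p) :=
  ⟨_, (PolyBounded.const 4).add (PolyBounded.add hW (.const 1)), fun _ _ => XorC.bit _⟩

lemma Eff.const (hW : PolyCard W) (b : ∀ l, P l → Bool) :
    Eff fun l p (_ : W l → Bool) => b l p :=
  ⟨_, (PolyBounded.const 4).add (PolyBounded.add hW (.const 1)), fun _ _ => XorC.const _⟩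

lemma Eff.xor {φ ψ : ∀ l, P l → (W l → Bool) → Bool} (hφ : Eff φ) (hψ : Eff ψ) :
    Eff fun l p x => Bool.xor (φ l p x) (ψ l p x) := by
  obtain ⟨s, hs, h⟩ := hφ
  obtain ⟨t, ht, h'⟩ := hψ
  exact ⟨_, hs.add ht, fun l p => (h l p).xor (h' l p)⟩

lemma Eff.param {φ : ∀ l, P l → (W l → Bool) → Bool} (hφ : Eff φ) (g : ∀ l, P' l → P l) :
    Eff fun l p x => φ l (g l p) x := by
  obtain ⟨s, hs, h⟩ := hφ
  exact ⟨s, hs, fun l p => h l _⟩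

/-- The condition concerns the parameter only, so nothing is computed by the circuit: either of the
two circuits is used, and the sum of the sizes bounds both. Branching on data is `Eff.ite`. -/
lemma Eff.cases {φ ψ : ∀ l, P l → (W l → Bool) → Bool} (hφ : Eff φ) (hψ : Eff ψ)
    (q : ∀ l, P l → Prop) [∀ l p, Decidable (q l p)] :
    Eff fun l p x => if q l p then φ l p x else ψ l p x := by
  obtain ⟨s, hs, h⟩ := hφ
  obtain ⟨t, ht, h'⟩ := hψ
  refine ⟨_, hs.add ht, fun l p => ?_⟩
  by_cases hq : q l p
  · simp only [if_pos hq]; exact (h l p).mono (Nat.le_add_right _ _)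
  · simp only [if_neg hq]; exact (h' l p).mono (Nat.le_add_left _ _)

/-- The index of the output bit of `f` is treated as an extra parameter, so that one size bound
covers all bits. -/
lemma Eff.subst {φ : ∀ l, P l → (κ l → Bool) → Bool} {f : ∀ l, P l → (W l → Bool) → (κ l → Bool)}
    (hW : PolyCard W) (hκ : PolyCard κ) (hφ : Eff φ)
    (hf : Eff fun l (p : P l × κ l) x => f l p.1 x p.2) : Eff fun l p x => φ l p (f l p x) := by
  obtain ⟨t, ht, h⟩ := hφ
  obtain ⟨s, hs, h'⟩ := hf
  exact ⟨_, (((PolyBounded.const 2).mul (PolyBounded.vecSize hκ hW hs)).add ht).add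
    ((PolyBounded.const 3).mul ((PolyBounded.add hW (.const 1)).add hκ)),
    fun l p => (h l p).subst fun k => h' l (p, k)⟩

lemma Eff.boolOp (o : Bool → Bool → Bool) :
    Eff (P := P) (W := fun _ => Bool) fun _ _ y => o (y true) (y false) :=
  ⟨fun _ => 4, PolyBounded.const 4, fun _ _ => XorC.of_card_le _ (by simp)⟩

lemma Eff.bif {φ ψ : ∀ l, P l → (W l → Bool) → Bool} (hφ : Eff φ) (hψ : Eff ψ) :
    Eff fun l (p : P l × Bool) x => bif p.2 then φ l p.1 x else ψ l p.1 x := by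
  have := (hφ.param fun l (p : P l × Bool) => p.1).cases (hψ.param fun l (p : P l × Bool) => p.1)
    fun l p => p.2 = true
  convert this using 4 with l p x
  cases p.2 <;> rfl

/-- The two functions are the components, indexed by `Bool`, of a vector that is substituted into a
two-bit function. -/
lemma Eff.op (hW : PolyCard W) {φ ψ : ∀ l, P l → (W l → Bool) → Bool} (hφ : Eff φ) (hψ : Eff ψ)
    (o : Bool → Bool → Bool) : Eff fun l p x => o (φ l p x) (ψ l p x) := by
  have h1 := hφ.bif hψ
  have h2 := Eff.boolOp (P := P) o
  have h := Eff.subst (κ := fun _ => Bool) (f := fun l p x b => bif b then φ l p x else ψ l p x)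
    hW PolyCard.bool h2 h1
  exact h

lemma Eff.ite (hW : PolyCard W) {c φ ψ : ∀ l, P l → (W l → Bool) → Bool} (hc : Eff c) (hφ : Eff φ)
    (hψ : Eff ψ) : Eff fun l p x => if c l p x = true then φ l p x else ψ l p x := by
  -- Branching is written as `ψ ⊕ (c ∧ (φ ⊕ ψ))`.
  have := hψ.xor (hc.op hW (hφ.xor hψ) and)
  convert this using 4 with l p x
  cases c l p x <;> cases φ l p x <;> cases ψ l p x <;> rfl

lemma Eff.parity {φ : ∀ l, P l × J l → (W l → Bool) → Bool} (hW : PolyCard W) (hJ : PolyCard J)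
    (hφ : Eff φ) : Eff fun l p x => MeasProtocol.parity Finset.univ fun j => φ l (p, j) x := by
  obtain ⟨s, hs, h⟩ := hφ
  refine ⟨_, (PolyBounded.add hJ (.const 1)).mul (hs.add ((PolyBounded.const 4).add
    (PolyBounded.add hW (.const 1)))), fun l p => ?_⟩
  have H : ∀ S : Finset (J l), XorC ((S.card + 1) * (s l + (4 + (Fintype.card (W l) + 1))))
      fun x => MeasProtocol.parity S fun j => φ l (p, j) x := by
    intro S
    induction S using Finset.induction_on with
    | empty =>
      simp only [MeasProtocol.parity, Finset.filter_empty, Finset.card_empty]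
      exact (XorC.const _).mono (by omega)
    | insert a S ha ih =>
      simp only [parity_insert ha]
      refine ((h l (p, a)).xor ih).mono ?_
      rw [Finset.card_insert_of_notMem ha]
      ring_nf; omega
  exact H Finset.univ

lemma EfficientFun.eff {f : ∀ l, (ι l → Bool) → (κ l → Bool)} (hf : EfficientFun f)
    (hι : PolyCard ι) : Eff fun l k x => f l x k := by
  obtain ⟨A, hA, hcl, hf⟩ := hf
  exact ⟨_, ((PolyBounded.const 5).mul (PolyBounded.add hι hA)).add (.const 10),
    fun l k => XorC.of_qProc (A l) (hcl l) (hf l) k⟩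

lemma PolyCard.sum (hι : PolyCard ι) (hκ : PolyCard κ) : PolyCard fun l => ι l ⊕ κ l := by
  simp only [PolyCard, Fintype.card_sum]
  exact PolyBounded.add hι hκ

lemma PolyCard.prod (hι : PolyCard ι) (hκ : PolyCard κ) : PolyCard fun l => ι l × κ l := by
  simp only [PolyCard, Fintype.card_prod]
  exact PolyBounded.mul hι hκ

lemma PolyBounded.polyCard {n : ℕ → ℕ} (hn : PolyBounded n) : PolyCard fun l => Fin (n l) := by
  simpa only [PolyCard, Fintype.card_fin] using hn

lemma PolyCard.unit : PolyCard fun _ => Unit := PolyBounded.const 1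

end Eff


/-! ### Linearity and elementary properties of channels and partial traces -/

section General
variable {ι κ γ W : Type}
variable [Fintype ι] [DecidableEq ι] [Fintype κ] [DecidableEq κ] [Fintype W] [DecidableEq W]
  [Fintype γ] [DecidableEq γ]

lemma zext_refl (x : ι → Bool) : zext (Function.Embedding.refl ι) x = x :=
  zext_comp (Function.Embedding.refl ι) x

lemma iso_refl : iso (Function.Embedding.refl ι) = 1 := by
  rw [← fm_id, iso]; congr 1; funext a; exact zext_refl a

lemma ap_refl (ρ : Op ι) : ap (Function.Embedding.refl ι) ρ = ρ := by
  simp [ap, iso_refl]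

lemma traceOut_refl (ρ : Op ι) : traceOut (Function.Embedding.refl ι) ρ = ρ := by
  conv_rhs => rw [← traceOut_ap (Function.Embedding.refl ι) ρ, ap_refl]

lemma traceOut_inl (σ : Op (ι ⊕ γ)) : traceOut Function.Embedding.inl σ = ∑ g, blk σ g g := by
  ext x y
  rw [traceOut_join isFrame_inl, Matrix.sum_apply]
  rfl

lemma conj_ketbra {A : Type} (M : Matrix A (ι → Bool) ℂ) (z : ι → Bool) :
    M * ketbra z * Mᴴ = Matrix.vecMulVec (fun u => M u z) (star fun u => M u z) := by
  ext u v
  rw [Matrix.mul_apply, Matrix.vecMulVec_apply, Finset.sum_eq_single z]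
  · rw [Matrix.mul_apply, Finset.sum_eq_single z]
    · simp [ketbra]
    · intro b _ hb; simp [ketbra, hb.symm]
    · simp
  · intro b _ hb
    rw [Matrix.mul_apply, Finset.sum_eq_zero, zero_mul]
    intro c _
    simp [ketbra, hb.symm]
  · simp

lemma traceOut_add (e : κ ↪ W) (σ τ : Op W) :
    traceOut e (σ + τ) = traceOut e σ + traceOut e τ := by
  obtain ⟨γ, _, _, w, hw⟩ := exists_frame e
  ext z z'
  simp only [traceOut_join hw, Matrix.add_apply, Finset.sum_add_distrib]

lemma traceOut_smul (e : κ ↪ W) (c : ℂ) (σ : Op W) : traceOut e (c • σ) = c • traceOut e σ := by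
  obtain ⟨γ, _, _, w, hw⟩ := exists_frame e
  ext z z'
  simp only [traceOut_join hw, Matrix.smul_apply, Finset.smul_sum]

/-- The partial trace as a linear map. -/
def traceOutL (e : κ ↪ W) : Op W →ₗ[ℂ] Op κ where
  toFun := traceOut e
  map_add' := traceOut_add e
  map_smul' := traceOut_smul e

lemma traceOut_sum {J : Type*} (e : κ ↪ W) (S : Finset J) (f : J → Op W) :
    traceOut e (∑ j ∈ S, f j) = ∑ j ∈ S, traceOut e (f j) := map_sum (traceOutL e) f S

lemma QProc.apply_eq (A : QProc ι κ) (ρ : Op ι) : A.apply ρ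
    = traceOut A.out (Circuit.toOp A.circ * ap Function.Embedding.inl ρ * (Circuit.toOp A.circ)ᴴ) := by
  rw [QProc.apply, appendZeros_eq]

lemma QProc.apply_add (A : QProc ι κ) (ρ σ : Op ι) : A.apply (ρ + σ) = A.apply ρ + A.apply σ := by
  simp only [QProc.apply_eq, ap, Matrix.mul_add, Matrix.add_mul, traceOut_add]

lemma QProc.apply_smul (A : QProc ι κ) (c : ℂ) (ρ : Op ι) : A.apply (c • ρ) = c • A.apply ρ := by
  simp only [QProc.apply_eq, ap, Matrix.mul_smul, Matrix.smul_mul, traceOut_smul]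

/-- The linear map computed by a quantum procedure. -/
def QProc.applyL (A : QProc ι κ) : Op ι →ₗ[ℂ] Op κ where
  toFun := A.apply
  map_add' := A.apply_add
  map_smul' := A.apply_smul

lemma QProc.apply_sum {J : Type*} (A : QProc ι κ) (S : Finset J) (f : J → Op ι) :
    A.apply (∑ j ∈ S, f j) = ∑ j ∈ S, A.apply (f j) := map_sum A.applyL f S

lemma QProc.apply_zero (A : QProc ι κ) : A.apply 0 = 0 := map_zero A.applyL

lemma lift_mul_elim (M : Op ι) {A : Type*} (σ : Matrix (ι ⊕ γ → Bool) A ℂ) (a : ι → Bool)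
    (g : γ → Bool) (v : A) : (lift (Function.Embedding.inl : ι ↪ ι ⊕ γ) M * σ) (Sum.elim a g) v
      = ∑ b, M a b * σ (Sum.elim b g) v :=
  lift_mul_join isFrame_inl M σ a g v

end General

/-! ## A coherent version of the Hadamard round -/

section Experiment
variable {n x y k e w : ℕ} {κ R : Type} [Fintype κ] [DecidableEq κ] [Fintype R] [DecidableEq R]

/-- Side registers for the Hadamard round: an input, coins, and copies of the commitment
strings. -/
abbrev Side (n y : ℕ) (κ R : Type) : Type := (κ ⊕ R) ⊕ (Fin n × Fin y)

/-- All bits of `J`, applied to `n` strings. -/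
def mapBits {a b : ℕ} (J : Bits a → Bits b) (v : Fin n × Fin a → Bool) (p : Fin n × Fin b) : Bool :=
  J (fun j => v (p.1, j)) p.2

/-- The preimage registers and the appended registers. -/
def preEmb : (Fin n × Fin x) ⊕ (Fin n × Fin w) ↪ HWire n x y k e w where
  toFun := Sum.elim (fun p => Sum.inl (.pre p.1 p.2)) Sum.inr
  inj' := by
    rintro (⟨a, b⟩ | a) (⟨c, d⟩ | c) h <;> simp at h ⊢ <;> exact h

def preEmb' : (Fin n × Fin w) ⊕ (Fin n × Fin x) ↪ HWire n x y k e w where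
  toFun := Sum.elim Sum.inr fun p => Sum.inl (.pre p.1 p.2)
  inj' := by
    rintro (a | ⟨a, b⟩) (c | ⟨c, d⟩) h <;> simp at h ⊢ <;> exact h

/-- `U_J` factors into two bit oracles, the first computing `J` into the appended registers and the
second erasing the old registers with `Jinv`. Its efficiency follows from that of the two functions.
-/
lemma uJ_eq (J : Bits x → Bits w) (Jinv : Bits w → Bits x) :
    (uJ J Jinv : Op (HWire n x y k e w))
      = lift preEmb' (xorVec (mapBits Jinv)) * lift preEmb (xorVec (mapBits J)) := by
  have h1 : lift (preEmb : _ ↪ HWire n x y k e w) (xorVec (mapBits J)) = fm fun u => Sum.elim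
      (u ∘ Sum.inl) fun p => xor (u (Sum.inr p)) (J (fun j => u (Sum.inl (.pre p.1 j))) p.2) := by
    refine lift_fm_eq _ ?_ ?_
    · intro v i
      rcases i with i | i <;> rfl
    · intro v a ha
      rcases a with a | a
      · rfl
      · exact absurd ⟨Sum.inr a, rfl⟩ ha
  have h2 : lift (preEmb' : _ ↪ HWire n x y k e w) (xorVec (mapBits Jinv)) = fm fun u => fun q =>
      match q with
      | .inl (.pre i j) => xor (u (Sum.inl (.pre i j))) (Jinv (jReg u i) j)
      | q => u q := by
    refine lift_fm_eq _ ?_ ?_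
    · intro v i
      rcases i with i | i <;> rfl
    · intro v a ha
      rcases a with (_ | ⟨i, j⟩ | _ | _ | _) | a
      · rfl
      · exact absurd ⟨Sum.inr (i, j), rfl⟩ ha
      all_goals rfl
  rw [h1, h2, fm_mul]
  have h3 : (uJ J Jinv : Op (HWire n x y k e w)) = fm (uJBits J Jinv) := rfl
  rw [h3]
  congr 1
  funext u q
  rcases q with (_ | ⟨i, j⟩ | _ | _ | _) | a <;> rfl

/-- The input and coins, and the key registers. -/
def keyEmb : (κ ⊕ R) ⊕ (Fin n × Fin k) ↪ HWire n x y k e w ⊕ Side n y κ R where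
  toFun := Sum.elim (fun v => Sum.inr (Sum.inl v)) fun p => Sum.inl (Sum.inl (.key p.1 p.2))
  inj' := by
    rintro (a | ⟨a, b⟩) (c | ⟨c, d⟩) h <;> simp at h ⊢ <;> exact h

/-- The commitment string registers and their copies. -/
def strEmb : (Fin n × Fin y) ⊕ (Fin n × Fin y) ↪ HWire n x y k e w ⊕ Side n y κ R where
  toFun := Sum.elim (fun p => Sum.inl (Sum.inl (.str p.1 p.2))) fun p => Sum.inr (Sum.inr p)
  inj' := by
    rintro (⟨a, b⟩ | a) (⟨c, d⟩ | c) h <;> simp at h ⊢ <;> exact h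

def coinEmb : R ↪ HWire n x y k e w ⊕ Side n y κ R where
  toFun r := Sum.inr (Sum.inl (Sum.inr r))
  inj' _ _ h := by simpa using h

def inputEmb : κ ↪ HWire n x y k e w ⊕ Side n y κ R where
  toFun r := Sum.inr (Sum.inl (Sum.inl r))
  inj' _ _ h := by simpa using h

/-- The preparation of the prover's state: choose coins, compute the keys, apply `U₀`, and copy the
commitment strings. -/
def prepOp (U₀ : Op (Wire n x y k e)) (K : (κ ⊕ R → Bool) → Fin n × Fin k → Bool) :
    Op (HWire n x y k e w ⊕ Side n y κ R) :=
  lift strEmb (xorVec id) * (lift Function.Embedding.inl (lift Function.Embedding.inl U₀) *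
    (lift keyEmb (xorVec K) * lift coinEmb (hadOn fun _ => true)))

/-- The prover's unnormalized state after the commitment string `y` has been measured. -/
def commitVec (U₀ : Op (Wire n x y k e)) (k' : Fin n → Bits k) (c : Fin n → Bits y)
    (u : HWire n x y k e w → Bool) : ℂ :=
  if (∀ i j, u (Sum.inr (i, j)) = false) ∧ (∀ i j, u (Sum.inl (.str i j)) = c i j)
    then U₀ (u ∘ Sum.inl) (initBits k') else 0

/-- The `n` rows of a bit string. -/
def rows {a : ℕ} (v : Fin n × Fin a → Bool) : Fin n → Bits a := fun i j => v (i, j)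

lemma hadOn_true_zero (u : R → Bool) :
    hadOn (fun _ => true) u (fun _ => false) = (1 / ((Real.sqrt 2 : ℝ) : ℂ)) ^ Fintype.card R := by
  rw [hadOn_apply]
  simp [had1]

/-- The prepared state is a uniform superposition over the coins `r`, each tied to the keys it
generates. The copy `c` of the commitment strings selects the branch `commitVec`, and the input `x₀`
is left unchanged. -/
lemma prepOp_apply (U₀ : Op (Wire n x y k e)) (K : (κ ⊕ R → Bool) → Fin n × Fin k → Bool)
    (x₀ : κ → Bool) (u : HWire n x y k e w → Bool) (z : κ → Bool) (r : R → Bool)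
    (c : Fin n × Fin y → Bool) :
    prepOp U₀ K (Sum.elim u (Sum.elim (Sum.elim z r) c)) (zext inputEmb x₀)
      = if z = x₀ then (1 / ((Real.sqrt 2 : ℝ) : ℂ)) ^ Fintype.card R
          * commitVec U₀ (rows (K (Sum.elim x₀ r))) (rows c) u else 0 := by
  have hz : zext (inputEmb : κ ↪ HWire n x y k e w ⊕ Side n y κ R) x₀
      = Sum.elim (fun _ => false) (Sum.elim (Sum.elim x₀ fun _ => false) fun _ => false) := by
    funext q
    by_cases hq : q ∈ Set.range (inputEmb : κ ↪ HWire n x y k e w ⊕ Side n y κ R)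
    · obtain ⟨i, rfl⟩ := hq
      exact inputEmb.injective.extend_apply ..
    · rw [zext, Function.extend_apply' _ _ _ hq]
      rcases q with q | (q | q) | q
      · rfl
      · exact absurd ⟨q, rfl⟩ hq
      · rfl
      · rfl
  -- The amplitudes are tracked through the four factors of `prepOp`: here after the Hadamards on
  -- the coins, in `hk` after the keys are written, in `hU` after `U₀`, and at the end after the
  -- copying.
  have hr : ∀ (u : HWire n x y k e w → Bool) (z : κ → Bool) (r : R → Bool)
      (c : Fin n × Fin y → Bool), lift coinEmb (hadOn fun _ => true)
        (Sum.elim u (Sum.elim (Sum.elim z r) c)) (zext inputEmb x₀)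
      = if u = (fun _ => false) ∧ z = x₀ ∧ c = (fun _ => false)
        then (1 / ((Real.sqrt 2 : ℝ) : ℂ)) ^ Fintype.card R else 0 := by
    intro u z r c
    have h0 : (Sum.elim (fun _ => false) (Sum.elim (Sum.elim x₀ fun _ => false) fun _ => false) :
      HWire n x y k e w ⊕ Side n y κ R → Bool) ∘ (coinEmb : R ↪ _) = fun _ => false := rfl
    rw [hz, lift, h0, hadOn_true_zero]
    have : (∀ i, i ∉ Set.range (coinEmb : R ↪ HWire n x y k e w ⊕ Side n y κ R) →
        (Sum.elim u (Sum.elim (Sum.elim z r) c)) i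
          = Sum.elim (fun _ => false) (Sum.elim (Sum.elim x₀ fun _ => false) fun _ => false) i)
        ↔ (u = (fun _ => false) ∧ z = x₀ ∧ c = (fun _ => false)) := by
      constructor
      · intro h
        refine ⟨funext fun i => h (Sum.inl i) ?_, funext fun i => h (Sum.inr (Sum.inl (Sum.inl i))) ?_,
          funext fun i => h (Sum.inr (Sum.inr i)) ?_⟩
        all_goals
          rintro ⟨j, hj⟩
          change Sum.inr (Sum.inl (Sum.inr j)) = _ at hj
          simp at hj
      · rintro ⟨rfl, rfl, rfl⟩ i hi
        rcases i with i | (i | i) | i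
        · rfl
        · rfl
        · exact absurd ⟨i, rfl⟩ hi
        · rfl
    split_ifs with h1 h2 h2
    · rfl
    · exact absurd (this.1 h1) h2
    · exact absurd (this.2 h2) h1
    · rfl
  have eK : lift (keyEmb : _ ↪ HWire n x y k e w ⊕ Side n y κ R) (xorVec K)
      = fm fun v q => match q with
        | .inl (.inl (.key i j)) => xor (v q) (K (v ∘ Sum.inr ∘ Sum.inl) (i, j))
        | q => v q := by
    refine lift_fm_eq _ ?_ ?_
    · intro v i
      rcases i with i | i <;> rfl
    · intro v a ha
      rcases a with ((_ | _ | _ | _ | ⟨i, j⟩) | a) | a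
      on_goal 5 => exact absurd ⟨Sum.inr (i, j), rfl⟩ ha
      all_goals rfl
  have eS : lift (strEmb : _ ↪ HWire n x y k e w ⊕ Side n y κ R) (xorVec id)
      = fm fun v => Sum.elim (v ∘ Sum.inl) (Sum.elim (v ∘ Sum.inr ∘ Sum.inl)
        fun p => xor (v (Sum.inr (Sum.inr p))) (v (Sum.inl (Sum.inl (.str p.1 p.2))))) := by
    refine lift_fm_eq _ ?_ ?_
    · intro v i
      rcases i with i | i <;> rfl
    · intro v a ha
      rcases a with a | a | a
      · rfl
      · rfl
      · exact absurd ⟨Sum.inr a, rfl⟩ ha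
  have hk : ∀ (a : Wire n x y k e → Bool) (b : Fin n × Fin w → Bool) (z : κ → Bool) (r : R → Bool)
      (c : Fin n × Fin y → Bool),
      (lift keyEmb (xorVec K) * lift coinEmb (hadOn fun _ => true) :
        Op (HWire n x y k e w ⊕ Side n y κ R))
        (Sum.elim (Sum.elim a b) (Sum.elim (Sum.elim z r) c)) (zext inputEmb x₀)
      = if a = initBits (rows (K (Sum.elim x₀ r))) ∧ b = (fun _ => false) ∧ z = x₀ ∧
          c = (fun _ => false)
        then (1 / ((Real.sqrt 2 : ℝ) : ℂ)) ^ Fintype.card R else 0 := by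
    intro a b z r c
    rw [eK, fm_mul_apply_of_involutive]
    · have h1 : (fun q : HWire n x y k e w ⊕ Side n y κ R => match q with
          | .inl (.inl (.key i j)) =>
            xor (Sum.elim (Sum.elim a b) (Sum.elim (Sum.elim z r) c) q)
              (K (Sum.elim (Sum.elim a b) (Sum.elim (Sum.elim z r) c) ∘ Sum.inr ∘ Sum.inl) (i, j))
          | q => Sum.elim (Sum.elim a b) (Sum.elim (Sum.elim z r) c) q)
          = Sum.elim (Sum.elim (fun q => match q with
            | .key i j => xor (a (.key i j)) (K (Sum.elim z r) (i, j))
            | q => a q) b) (Sum.elim (Sum.elim z r) c) := by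
        funext q
        rcases q with ((_ | _ | _ | _ | ⟨i, j⟩) | q) | q <;> rfl
      refine (congrArg (fun v => lift coinEmb (hadOn fun _ => true) v (zext inputEmb x₀)) h1).trans ?_
      rw [hr]
      refine if_congr ?_ rfl rfl
      constructor
      · rintro ⟨h, rfl, rfl⟩
        refine ⟨?_, ?_, rfl, rfl⟩
        · funext q
          have h' := congrFun h (Sum.inl q)
          rcases q with _ | _ | _ | _ | ⟨i, j⟩
          on_goal 5 => simpa [initBits, rows] using h'
          all_goals exact h'
        · funext q; exact congrFun h (Sum.inr q)
      · rintro ⟨rfl, rfl, rfl, rfl⟩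
        refine ⟨?_, rfl, rfl⟩
        funext q
        rcases q with (_ | _ | _ | _ | ⟨i, j⟩) | q <;> simp [initBits, rows]
    · intro v
      funext q
      rcases q with ((_ | _ | _ | _ | ⟨i, j⟩) | q) | q
      on_goal 5 =>
        show xor (xor (v _) (K (v ∘ Sum.inr ∘ Sum.inl) (i, j))) (K (v ∘ Sum.inr ∘ Sum.inl) (i, j)) = _
        simp
      all_goals rfl
  have hU : ∀ (a : Wire n x y k e → Bool) (b : Fin n × Fin w → Bool) (z : κ → Bool) (r : R → Bool)
      (c : Fin n × Fin y → Bool),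
      (lift Function.Embedding.inl (lift Function.Embedding.inl U₀) *
        (lift keyEmb (xorVec K) * lift coinEmb (hadOn fun _ => true)) :
        Op (HWire n x y k e w ⊕ Side n y κ R))
        (Sum.elim (Sum.elim a b) (Sum.elim (Sum.elim z r) c)) (zext inputEmb x₀)
      = if b = (fun _ => false) ∧ z = x₀ ∧ c = (fun _ => false)
        then U₀ a (initBits (rows (K (Sum.elim x₀ r)))) *
          (1 / ((Real.sqrt 2 : ℝ) : ℂ)) ^ Fintype.card R else 0 := by
    intro a b z r c
    rw [lift_mul_elim, sum_sum_elim]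
    have : ∀ a' b', lift (Function.Embedding.inl : _ ↪ HWire n x y k e w) U₀ (Sum.elim a b)
        (Sum.elim a' b') = if b = b' then U₀ a a' else 0 :=
      fun a' b' => lift_join isFrame_inl U₀ a a' b b'
    simp only [this, hk]
    rw [Finset.sum_eq_single (initBits (rows (K (Sum.elim x₀ r)))), Finset.sum_eq_single b]
    · simp
    · intro b' _ hb; simp [hb.symm]
    · simp
    · intro b' _ hb; simp [hb]
    · simp
  obtain ⟨a, b, rfl⟩ := exists_join (Equiv.refl (Wire n x y k e ⊕ (Fin n × Fin w))) u
  rw [join_refl, prepOp, eS, fm_mul_apply_of_involutive]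
  · have h1 : (Sum.elim (Sum.elim (Sum.elim a b) (Sum.elim (Sum.elim z r) c) ∘ Sum.inl)
        (Sum.elim (Sum.elim (Sum.elim a b) (Sum.elim (Sum.elim z r) c) ∘ Sum.inr ∘ Sum.inl)
        fun p => xor (Sum.elim (Sum.elim a b) (Sum.elim (Sum.elim z r) c) (Sum.inr (Sum.inr p)))
          (Sum.elim (Sum.elim a b) (Sum.elim (Sum.elim z r) c)
            (Sum.inl (Sum.inl (.str p.1 p.2))))) : HWire n x y k e w ⊕ Side n y κ R → Bool)
        = Sum.elim (Sum.elim a b) (Sum.elim (Sum.elim z r)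
          fun p => xor (c p) (a (.str p.1 p.2))) := by
      funext q
      rcases q with q | q | q <;> rfl
    rw [h1, hU, commitVec]
    have h2 : ((fun p : Fin n × Fin y => xor (c p) (a (.str p.1 p.2))) = fun _ => false) ↔
        ∀ i j, a (.str i j) = rows c i j := by
      constructor
      · intro h i j
        have := congrFun h (i, j)
        simp at this
        exact this.symm
      · intro h
        funext p
        have := h p.1 p.2
        simp [rows] at this
        simp [this]
    have h3 : (b = fun _ => false) ↔ ∀ i j, b (i, j) = false := by
      simp [funext_iff]
    simp only [h2, h3, Sum.elim_inr, Sum.elim_inl, Sum.elim_comp_inl]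
    by_cases hz : z = x₀ <;> by_cases hb : ∀ i j, b (i, j) = false <;> simp [hz, hb, mul_comm]
  · intro v
    funext q
    rcases q with q | q | q
    · rfl
    · rfl
    · show xor (xor (v _) (v _)) (v _) = v _
      simp

/-- The joint operation of verifier and prover, up to the decoded committed qubits. -/
def experiment (U₀ : Op (Wire n x y k e)) (K : (κ ⊕ R → Bool) → Fin n × Fin k → Bool)
    (J : Bits x → Bits w) (Jinv : Bits w → Bits x)
    (S : QProc (HWire n x y k e w) (HWire n x y k e w))
    (g : (HWire n x y k e w ⊕ Side n y κ R → Bool) → Bool) (ρ : Op κ) : Op (Fin n) :=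
  let A : Op (HWire n x y k e w ⊕ Side n y κ R) :=
    lift Function.Embedding.inl (uJ J Jinv) * prepOp U₀ K
  let B : Op (HWire n x y k e w ⊕ Side n y κ R) :=
    phaseOp g * lift Function.Embedding.inl (hadOn selPre)
  traceOut (comEmb.trans Function.Embedding.inl)
    (B * par (Side n y κ R) S.apply (A * ap inputEmb ρ * Aᴴ) * Bᴴ)

lemma blk_phaseOp {ι γ : Type} [Fintype ι] [DecidableEq ι] [Fintype γ] [DecidableEq γ]
    (g : (ι ⊕ γ → Bool) → Bool) (σ : Op (ι ⊕ γ)) (c : γ → Bool) :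
    blk (phaseOp g * σ * (phaseOp g)ᴴ) c c
      = phaseOp (fun u => g (Sum.elim u c)) * blk σ c c * phaseOp fun u => g (Sum.elim u c) := by
  ext u v
  rw [phaseOp, phaseOp, Matrix.diagonal_conjTranspose, blk, Matrix.mul_diagonal,
    Matrix.mul_diagonal, Matrix.diagonal_mul, Matrix.diagonal_mul, blk]
  simp only [Pi.star_apply]
  congr 1
  split_ifs <;> simp

/-- Only blocks diagonal in the side register survive the partial trace. Superposed coins thereby
become uniform classical coins, with weight the squared Hadamard amplitude, and copied commitment
strings become measured ones. Within a block the phase oracle sees fixed coins and strings. -/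
lemma experiment_ketbra (U₀ : Op (Wire n x y k e)) (K : (κ ⊕ R → Bool) → Fin n × Fin k → Bool)
    (J : Bits x → Bits w) (Jinv : Bits w → Bits x)
    (S : QProc (HWire n x y k e w) (HWire n x y k e w))
    (g : (HWire n x y k e w ⊕ Side n y κ R → Bool) → Bool) (x₀ : κ → Bool) :
    experiment U₀ K J Jinv S g (ketbra x₀) = ∑ r : R → Bool, ∑ c : Fin n × Fin y → Bool,
      (1 / 2 ^ Fintype.card R : ℂ) • traceOut comEmb
        (phaseOp (fun u => g (Sum.elim u (Sum.elim (Sum.elim x₀ r) c))) *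
          (hadOn selPre * S.apply (uJ J Jinv * Matrix.vecMulVec
            (commitVec U₀ (rows (K (Sum.elim x₀ r))) (rows c))
            (star (commitVec U₀ (rows (K (Sum.elim x₀ r))) (rows c))) * (uJ J Jinv)ᴴ)
            * (hadOn selPre)ᴴ) *
          phaseOp (fun u => g (Sum.elim u (Sum.elim (Sum.elim x₀ r) c)))) := by
  have hb : ∀ z r c, blk (prepOp U₀ K * ketbra (zext inputEmb x₀) * (prepOp U₀ K)ᴴ)
      (Sum.elim (Sum.elim z r) c) (Sum.elim (Sum.elim z r) c)
      = if z = x₀ then (1 / 2 ^ Fintype.card R : ℂ) • Matrix.vecMulVec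
            (commitVec U₀ (rows (K (Sum.elim x₀ r))) (rows c))
            (star (commitVec (w := w) U₀ (rows (K (Sum.elim x₀ r))) (rows c))) else 0 := by
    intro z r c
    ext u v
    rw [conj_ketbra, blk, Matrix.vecMulVec_apply, Pi.star_apply]
    simp only [prepOp_apply]
    split_ifs with hz
    · rw [Matrix.smul_apply, Matrix.vecMulVec_apply, Pi.star_apply, star_mul']
      have : (1 / ((Real.sqrt 2 : ℝ) : ℂ)) ^ Fintype.card R *
          star ((1 / ((Real.sqrt 2 : ℝ) : ℂ)) ^ Fintype.card R) = 1 / 2 ^ Fintype.card R := by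
        rw [star_pow, ← mul_pow]
        have : (1 / ((Real.sqrt 2 : ℝ) : ℂ)) * star (1 / ((Real.sqrt 2 : ℝ) : ℂ)) = 1 / 2 := by
          simp only [one_div, star_inv₀, Complex.star_def, Complex.conj_ofReal]
          rw [← mul_inv, sqrt_two_mul_self]
        rw [this, one_div_pow]
      rw [← this, smul_eq_mul]
      ring
    · simp
  unfold experiment
  simp only
  rw [← traceOut_trans, traceOut_inl]
  have hblk : ∀ c : Side n y κ R → Bool, ∀ σ : Op (HWire n x y k e w ⊕ Side n y κ R),
      blk (phaseOp g * lift Function.Embedding.inl (hadOn selPre) * σ *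
        (phaseOp g * lift Function.Embedding.inl (hadOn selPre))ᴴ) c c
      = phaseOp (fun u => g (Sum.elim u c)) * (hadOn selPre * blk σ c c * (hadOn selPre)ᴴ) *
        phaseOp fun u => g (Sum.elim u c) := by
    intro c σ
    rw [← blk_conj, ← blk_phaseOp, Matrix.conjTranspose_mul]
    simp only [Matrix.mul_assoc]
  have hA : ∀ c : Side n y κ R → Bool,
      blk (lift Function.Embedding.inl (uJ J Jinv) * prepOp U₀ K * ap inputEmb (ketbra x₀) *
        (lift Function.Embedding.inl (uJ J Jinv) * prepOp U₀ K)ᴴ) c c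
      = uJ J Jinv * blk (prepOp U₀ K * ketbra (zext inputEmb x₀) * (prepOp U₀ K)ᴴ) c c
        * (uJ J Jinv)ᴴ := by
    intro c
    rw [← blk_conj, ap_ketbra, Matrix.conjTranspose_mul]
    simp only [Matrix.mul_assoc]
  simp only [hblk, blk_par, hA]
  rw [sum_sum_elim, sum_sum_elim]
  simp only [hb]
  -- The input register is never altered, so only the block with its original content contributes.
  rw [Finset.sum_eq_single x₀]
  · simp only [if_true, Matrix.mul_smul, Matrix.smul_mul, QProc.apply_smul]
    simp only [traceOut_sum, traceOut_smul]
  · intro z _ hz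
    simp [hz, QProc.apply_zero]
  · simp

end Experiment


/-! ### Efficient families of vector functions, unitaries and channels -/

section Families
variable {P P' : ℕ → Type} {ι κ ν J W V : ℕ → Type}
variable [∀ l, Fintype (ι l)] [∀ l, DecidableEq (ι l)] [∀ l, Fintype (κ l)] [∀ l, DecidableEq (κ l)]
  [∀ l, Fintype (W l)] [∀ l, DecidableEq (W l)] [∀ l, Fintype (J l)] [∀ l, DecidableEq (J l)]
  [∀ l, Fintype (ν l)] [∀ l, DecidableEq (ν l)] [∀ l, Fintype (V l)] [∀ l, DecidableEq (V l)]

/-- All bits of a family of functions can be evaluated efficiently. -/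
def EffV (f : ∀ l, P l → (W l → Bool) → (κ l → Bool)) : Prop :=
  Eff fun l (p : P l × κ l) x => f l p.1 x p.2

lemma EffV.vars (hW : PolyCard W) (i : ∀ l, P l → κ l → W l) :
    EffV fun l p (x : W l → Bool) k => x (i l p k) := Eff.bit hW _

lemma EffV.bit {f : ∀ l, P l → (W l → Bool) → (κ l → Bool)} (hf : EffV f) (j : ∀ l, P l → κ l) :
    Eff fun l p x => f l p x (j l p) := Eff.param hf fun l p => (p, j l p)

lemma EffV.reindex {f : ∀ l, P l → (W l → Bool) → (κ l → Bool)} (hf : EffV f)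
    (g : ∀ l, P l → ι l → κ l) : EffV fun l p x k => f l p x (g l p k) :=
  Eff.param (P' := fun l => P l × ι l) hf fun l p => (p.1, g l p.1 p.2)

lemma EffV.elim {f : ∀ l, P l → (W l → Bool) → (κ l → Bool)}
    {g : ∀ l, P l → (W l → Bool) → (ι l → Bool)} (hf : EffV f) (hg : EffV g) :
    EffV fun l p x => Sum.elim (f l p x) (g l p x) := by
  obtain ⟨s, hs, h⟩ := hf
  obtain ⟨t, ht, h'⟩ := hg
  refine ⟨_, hs.add ht, fun l ⟨p, k⟩ => ?_⟩
  rcases k with k | k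
  · exact (h l (p, k)).mono (Nat.le_add_right _ _)
  · exact (h' l (p, k)).mono (Nat.le_add_left _ _)

lemma EffV.comp {f : ∀ l, P l → (W l → Bool) → (κ l → Bool)}
    {F : ∀ l, (κ l → Bool) → (ι l → Bool)} (hf : EffV f) (hF : EfficientFun F) (hW : PolyCard W)
    (hκ : PolyCard κ) : EffV fun l p x => F l (f l p x) := by
  obtain ⟨s, hs, h⟩ := hf
  have h1 : Eff fun l (p : P l × ι l) (x : κ l → Bool) => F l x p.2 := by
    obtain ⟨t, ht, h'⟩ := hF.eff hκ
    exact ⟨t, ht, fun l p => h' l p.2⟩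
  have h2 : Eff fun l (p : (P l × ι l) × κ l) (x : W l → Bool) => f l p.1.1 x p.2 :=
    ⟨s, hs, fun l p => h l (p.1.1, p.2)⟩
  have h3 := Eff.subst (f := fun l (p : P l × ι l) x => f l p.1 x) hW hκ h1 h2
  exact h3

/-- A family of unitaries that can be implemented efficiently. -/
def EffU (U : ∀ l, P l → Op (W l)) : Prop := ∃ s, PolyBounded s ∧ ∀ l p, CleanU (s l) (U l p)

lemma EffU.mul {U U' : ∀ l, P l → Op (W l)} (h : EffU U) (h' : EffU U') :
    EffU fun l p => U l p * U' l p := by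
  obtain ⟨s, hs, h⟩ := h
  obtain ⟨t, ht, h'⟩ := h'
  exact ⟨_, hs.add ht, fun l p => (h l p).mul (h' l p)⟩

lemma EffU.lift {U : ∀ l, P l → Op (W l)} (h : EffU U) (hV : PolyCard V) (e : ∀ l, W l ↪ V l) :
    EffU fun l p => MeasProtocol.lift (e l) (U l p) := by
  obtain ⟨s, hs, h⟩ := h
  exact ⟨_, hs.add hV, fun l p => (h l p).lift _⟩

lemma EffV.xorVec {f : ∀ l, P l → (W l → Bool) → (κ l → Bool)} (hf : EffV f) (hW : PolyCard W)
    (hκ : PolyCard κ) : EffU fun l p => MeasProtocol.xorVec (f l p) := by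
  obtain ⟨s, hs, h⟩ := hf
  exact ⟨_, PolyBounded.vecSize hκ hW hs, fun l p => CleanU.xorVec fun k => h l (p, k)⟩

lemma Eff.phaseOp {g : ∀ l, P l → (W l → Bool) → Bool} (hg : Eff g) (hW : PolyCard W) :
    EffU fun l p => MeasProtocol.phaseOp (g l p) := by
  obtain ⟨s, hs, h⟩ := hg
  exact ⟨_, ((PolyBounded.const 2).mul hs).add ((PolyBounded.const 4).add
    (PolyBounded.add hW (.const 1))), fun l p => CleanU.phaseOp (h l p)⟩

lemma EffU.hadOn (hW : PolyCard W) (s : ∀ l, P l → W l → Bool) :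
    EffU fun l p => MeasProtocol.hadOn (s l p) :=
  ⟨_, (PolyBounded.add hW (.const 1)).mul ((PolyBounded.const 4).add hW),
    fun _ _ => CleanU.hadOn _⟩

lemma EffU.circuit (hW : PolyCard W) {C : ∀ l, Circuit (W l)}
    (hC : PolyBounded fun l => (C l).length) : EffU fun l (_ : P l) => Circuit.toOp (C l) :=
  ⟨_, PolyBounded.add hW hC, fun l _ => Circuit.cleanU (C l)⟩

/-- A family of maps that can be realized efficiently. -/
def EffR (Φ : ∀ l, P l → Op (W l) → Op (V l)) : Prop :=
  ∃ s, PolyBounded s ∧ ∀ l p, Realizes (s l) (Φ l p)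

lemma EffU.realizes {U : ∀ l, P l → Op (W l)} (h : EffU U) (e : ∀ l, ι l ↪ W l)
    (f : ∀ l, κ l ↪ W l) :
    EffR fun l p ρ => traceOut (f l) (U l p * ap (e l) ρ * (U l p)ᴴ) := by
  obtain ⟨s, hs, h⟩ := h
  exact ⟨s, hs, fun l p => (h l p).realizes _ _⟩

lemma EffR.comp {Φ : ∀ l, P l → Op (ι l) → Op (κ l)} {Ψ : ∀ l, P l → Op (κ l) → Op (W l)}
    (hΨ : EffR Ψ) (hΦ : EffR Φ) : EffR fun l p ρ => Ψ l p (Φ l p ρ) := by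
  obtain ⟨s, hs, h⟩ := hΦ
  obtain ⟨t, ht, h'⟩ := hΨ
  exact ⟨_, hs.add ht, fun l p => (h' l p).comp (h l p)⟩

lemma EffR.par {Φ : ∀ l, P l → Op (ι l) → Op (κ l)} (hΦ : EffR Φ) (hν : PolyCard ν) :
    EffR fun l p => par (ν l) (Φ l p) := by
  obtain ⟨s, hs, h⟩ := hΦ
  exact ⟨_, hs.add hν, fun l p => (h l p).par (ν l)⟩

lemma QPT.effR {A : ∀ l, QProc (ι l) (κ l)} (hA : QPT A) (hι : PolyCard ι) :
    EffR fun l (_ : P l) => (A l).apply :=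
  ⟨_, PolyBounded.add hι hA, fun l _ => (A l).realizes⟩

/-- The size bound is uniform in the parameters, so an arbitrary choice of one parameter for each
`l` still gives a polynomial-size family; circuit families are non-uniform. -/
lemma EffR.exists_qPT {Φ : ∀ l, P l → Op (ι l) → Op (κ l)} (hΦ : EffR Φ) (p : ∀ l, P l) :
    ∃ A : ∀ l, QProc (ι l) (κ l), QPT A ∧ ∀ l, (A l).apply = Φ l (p l) := by
  obtain ⟨s, hs, h⟩ := hΦ
  choose A hA hA' using fun l => (h l (p l)).exists_qProc
  exact ⟨A, hs.mono hA, hA'⟩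

end Families

/-! ## Efficiency of the Hadamard round -/

lemma PolyCard.wire {n x y k e : ℕ → ℕ} (hn : PolyBounded n) (hx : PolyBounded x)
    (hy : PolyBounded y) (hk : PolyBounded k) (he : PolyBounded e) :
    PolyCard fun l => Wire (n l) (x l) (y l) (k l) (e l) := by
  have hp := fun {a} (ha : PolyBounded a) => PolyCard.prod hn.polyCard (PolyBounded.polyCard ha)
  have h := (hn.polyCard.sum ((hp hx).sum (he.polyCard.sum ((hp hy).sum (hp hk)))))
  refine PolyBounded.mono h fun l => Fintype.card_le_of_injective
    (fun q : Wire (n l) (x l) (y l) (k l) (e l) => match q with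
      | .com i => Sum.inl i
      | .pre i j => Sum.inr (Sum.inl (i, j))
      | .aux j => Sum.inr (Sum.inr (Sum.inl j))
      | .str i j => Sum.inr (Sum.inr (Sum.inr (Sum.inl (i, j))))
      | .key i j => Sum.inr (Sum.inr (Sum.inr (Sum.inr (i, j))))) ?_
  rintro (_ | _ | _ | _ | _) (_ | _ | _ | _ | _) h <;> simp_all

section EffExperiment
variable {P : ℕ → Type} {n x y k e w : ℕ → ℕ} {κ R : ℕ → Type}
  [∀ l, Fintype (κ l)] [∀ l, DecidableEq (κ l)] [∀ l, Fintype (R l)] [∀ l, DecidableEq (R l)]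

lemma EfficientFun.effU_mapBits {a b : ℕ → ℕ} {J : ∀ l, Bits (a l) → Bits (b l)}
    (hJ : EfficientFun (ι := fun l => Fin (a l)) (κ := fun l => Fin (b l)) J) (hn : PolyBounded n)
    (ha : PolyBounded a) (hb : PolyBounded b) :
    EffU fun l (_ : P l) => xorVec (mapBits (n := n l) (J l)) := by
  have hA := hn.polyCard.prod ha.polyCard
  have h1 : EffV fun l (p : P l × Fin (n l)) (v : Fin (n l) × Fin (a l) → Bool) (j : Fin (a l)) =>
    v (p.2, j) := EffV.vars hA _
  have h2 := h1.comp hJ hA ha.polyCard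
  have h3 : EffV fun l (_ : P l) => mapBits (n := n l) (J l) :=
    Eff.param (P' := fun l => P l × (Fin (n l) × Fin (b l))) h2 fun l p => ((p.1, p.2.1), p.2.2)
  exact h3.xorVec hA (hn.polyCard.prod hb.polyCard)

lemma effR_experiment (hn : PolyBounded n) (hx : PolyBounded x) (hy : PolyBounded y)
    (hk : PolyBounded k) (he : PolyBounded e) (hw : PolyBounded w) (hκ : PolyCard κ)
    (hR : PolyCard R) {C : ∀ l, Circuit (Wire (n l) (x l) (y l) (k l) (e l))}
    (hC : PolyBounded fun l => (C l).length)
    {K : ∀ l, P l → (κ l ⊕ R l → Bool) → Fin (n l) × Fin (k l) → Bool} (hK : EffV K)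
    {J : ∀ l, Bits (x l) → Bits (w l)}
    (hJ : EfficientFun (ι := fun l => Fin (x l)) (κ := fun l => Fin (w l)) J)
    {Jinv : ∀ l, Bits (w l) → Bits (x l)}
    (hJinv : EfficientFun (ι := fun l => Fin (w l)) (κ := fun l => Fin (x l)) Jinv)
    {S : ∀ l, QProc (HWire (n l) (x l) (y l) (k l) (e l) (w l))
      (HWire (n l) (x l) (y l) (k l) (e l) (w l))} (hS : QPT S)
    {g : ∀ l, P l → (HWire (n l) (x l) (y l) (k l) (e l) (w l) ⊕ Side (n l) (y l) (κ l) (R l) → Bool)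
      → Bool} (hg : Eff g) :
    EffR fun l p => experiment (Circuit.toOp (C l)) (K l p) (J l) (Jinv l) (S l) (g l p) := by
  have hWire := PolyCard.wire hn hx hy hk he
  have hHW : PolyCard fun l => HWire (n l) (x l) (y l) (k l) (e l) (w l) :=
    hWire.sum (hn.polyCard.prod hw.polyCard)
  have hNY := hn.polyCard.prod hy.polyCard
  have hSide : PolyCard fun l => Side (n l) (y l) (κ l) (R l) := (hκ.sum hR).sum hNY
  have hT := hHW.sum hSide
  have hstr : EffU fun l (_ : P l) => xorVec (id : (Fin (n l) × Fin (y l) → Bool) → _) :=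
    (EffV.vars hNY fun l (_ : P l) k => k).xorVec hNY hNY
  have hprep : EffU fun l p => (prepOp (Circuit.toOp (C l)) (K l p) :
      Op (HWire (n l) (x l) (y l) (k l) (e l) (w l) ⊕ Side (n l) (y l) (κ l) (R l))) :=
    (hstr.lift hT fun l => strEmb).mul
      ((((EffU.circuit hWire hC).lift hHW fun l => Function.Embedding.inl).lift hT
        fun l => Function.Embedding.inl).mul
        (((hK.xorVec (hκ.sum hR) (hn.polyCard.prod hk.polyCard)).lift hT fun l => keyEmb).mul
          ((EffU.hadOn hR fun l _ _ => true).lift hT fun l => coinEmb)))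
  have huJ : EffU fun l (_ : P l) =>
      (uJ (J l) (Jinv l) : Op (HWire (n l) (x l) (y l) (k l) (e l) (w l))) := by
    simp only [uJ_eq]
    exact ((hJinv.effU_mapBits hn hw hx).lift hHW fun l => preEmb').mul
      ((hJ.effU_mapBits hn hx hw).lift hHW fun l => preEmb)
  -- `experiment` is a composition of three channels: preparation with `U_J`, the prover's `S`
  -- beside the side registers, and the Hadamard transform with the decoding phase followed by
  -- discarding.
  have h1 := ((huJ.lift hT fun l => Function.Embedding.inl).mul hprep).realizes
    (fun l => inputEmb) fun l => Function.Embedding.refl _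
  have h2 := (hS.effR (P := P) hHW).par hSide
  have h3 := ((hg.phaseOp hT).mul ((EffU.hadOn hHW fun l (_ : P l) => selPre).lift hT
    fun l => Function.Embedding.inl)).realizes
    (fun l => Function.Embedding.refl _) fun l => comEmb.trans Function.Embedding.inl
  have h := h3.comp (h2.comp h1)
  simp only [ap_refl, traceOut_refl] at h
  exact h

end EffExperiment


/-! ## The verifier's computations -/

section Verifier
variable {𝓓 : Domains} {n : ℕ → ℕ}

/-- The decoding bit of a qubit, if `b` is used where the verifier chooses a random bit. -/
def decodeBit (l : ℕ) (F : NTCF 𝓓) (kt : Bits (𝓓.kLen l) × Bits (F.tLen l)) (y : Bits (𝓓.yLen l))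
    (d : Bits (F.w l)) (b : Bool) : Bool :=
  match F.inv l kt.2 false y, F.inv l kt.2 true y with
  | some x₀, some x₁ =>
    if F.goodChk l kt.1 false x₀ kt.2 d = true ∧ F.goodChk l kt.1 true x₁ kt.2 d = true
    then dot d (xorBits (F.J l x₀) (F.J l x₁)) else b
  | _, _ => b

/-- One explicit coin supplies the randomness of the decoding bit, so that decoding becomes a
deterministic function and can be evaluated reversibly. -/
lemma decodeProb_eq (l : ℕ) (F : NTCF 𝓓) (kt : Bits (𝓓.kLen l) × Bits (F.tLen l))
    (y : Bits (𝓓.yLen l)) (d : Bits (F.w l)) (c : Bool) :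
    decodeProb l F kt y d c = 1 / 2 * ∑ b, if decodeBit l F kt y d b = c then 1 else 0 := by
  unfold decodeProb decodeBit
  rcases F.inv l kt.2 false y with _ | x₀ <;> rcases F.inv l kt.2 true y with _ | x₁
  · cases c <;> simp
  · cases c <;> simp
  · cases c <;> simp
  · simp only
    by_cases hg : F.goodChk l kt.1 false x₀ kt.2 d = true ∧ F.goodChk l kt.1 true x₁ kt.2 d = true
    · simp only [if_pos hg]
      rcases h : dot d (xorBits (F.J l x₀) (F.J l x₁)) <;> cases c <;> simp
    · simp only [if_neg hg]
      cases c <;> simp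

lemma decodeProb_sum (l : ℕ) (F : NTCF 𝓓) (kt : Bits (𝓓.kLen l) × Bits (F.tLen l))
    (y : Bits (𝓓.yLen l)) (d : Bits (F.w l)) : ∑ c, decodeProb l F kt y d c = 1 := by
  simp only [decodeProb_eq, ← Finset.mul_sum]
  rw [Finset.sum_comm]
  simp

/-- The input of `decodeBit`: the coins of the key generation, the commitment string, the measured
string and the random bit. -/
abbrev DecodeWire (F : NTCF 𝓓) (l : ℕ) : Type :=
  Fin (F.coins l) ⊕ (Fin (𝓓.yLen l) ⊕ (Fin (F.w l) ⊕ Unit))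

lemma DecodeWire.polyCard (F : NTCF 𝓓) : PolyCard fun l => DecodeWire F l :=
  F.coins_poly.polyCard.sum (𝓓.yLen_poly.polyCard.sum (F.w_poly.polyCard.sum PolyCard.unit))

/-- `decodeBit`, as a function of all inputs. -/
def decodeOn (F : NTCF 𝓓) (l : ℕ) (v : DecodeWire F l → Bool) : Bool :=
  decodeBit l F (F.gen l (v ∘ Sum.inl)) (v ∘ Sum.inr ∘ Sum.inl) (v ∘ Sum.inr ∘ Sum.inr ∘ Sum.inl)
    (v (Sum.inr (Sum.inr (Sum.inr ()))))

/-- Key and trapdoor are recomputed from the coins; then come the two inverses, the two membership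
checks and the inner product, with a final branch on whether all of these succeeded. -/
lemma eff_decodeOn {P : ℕ → Type} (F : NTCF 𝓓) : Eff fun l (_ : P l) => decodeOn F l := by
  have hW := DecodeWire.polyCard F
  have hx := 𝓓.xLen_poly.polyCard
  have hy := 𝓓.yLen_poly.polyCard
  have hk := 𝓓.kLen_poly.polyCard
  have ht := F.tLen_poly.polyCard
  have hw := F.w_poly.polyCard
  have h0 : EffV fun l (_ : P l) (v : DecodeWire F l → Bool) => v ∘ Sum.inl :=
    EffV.vars hW fun _ _ => Sum.inl
  have hgen := EffV.comp h0 F.gen_eff hW F.coins_poly.polyCard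
  have kV : EffV fun l (_ : P l) (v : DecodeWire F l → Bool) => (F.gen l (v ∘ Sum.inl)).1 := by
    have h := EffV.reindex hgen fun l _ => (Sum.inl : Fin (𝓓.kLen l) → _)
    exact h
  have tV : EffV fun l (_ : P l) (v : DecodeWire F l → Bool) => (F.gen l (v ∘ Sum.inl)).2 := by
    have h := EffV.reindex hgen fun l _ => (Sum.inr : Fin (F.tLen l) → _)
    exact h
  have yV : EffV fun l (_ : P l) (v : DecodeWire F l → Bool) => v ∘ Sum.inr ∘ Sum.inl :=
    EffV.vars hW fun _ _ j => Sum.inr (Sum.inl j)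
  have dV : EffV fun l (_ : P l) (v : DecodeWire F l → Bool) =>
    v ∘ Sum.inr ∘ Sum.inr ∘ Sum.inl := EffV.vars hW fun _ _ j => Sum.inr (Sum.inr (Sum.inl j))
  have cV : ∀ b : Bool, EffV fun l (_ : P l) (v : DecodeWire F l → Bool) (_ : Unit) => b :=
    fun b => Eff.const hW fun _ _ => b
  have invV : ∀ b : Bool, EffV fun l (_ : P l) (v : DecodeWire F l → Bool) =>
      encOpt (F.inv l (F.gen l (v ∘ Sum.inl)).2 b (v ∘ Sum.inr ∘ Sum.inl)) := by
    intro b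
    have h := EffV.elim tV (EffV.elim (cV b) yV)
    have h' := EffV.comp h F.inv_eff hW (ht.sum (PolyCard.unit.sum hy))
    exact h'
  have flag : ∀ b : Bool, Eff fun l (_ : P l) (v : DecodeWire F l → Bool) =>
      encOpt (F.inv l (F.gen l (v ∘ Sum.inl)).2 b (v ∘ Sum.inr ∘ Sum.inl)) (Sum.inl ()) := by
    intro b
    have h := EffV.bit (invV b) fun l _ => Sum.inl ()
    exact h
  -- If an inverse is missing this is the zero string. The values computed from it are meaningless
  -- but harmless, since the flag bit makes the final branch choose the random bit.
  have xV : ∀ b : Bool, EffV fun l (_ : P l) (v : DecodeWire F l → Bool) (j : Fin (𝓓.xLen l)) =>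
      encOpt (F.inv l (F.gen l (v ∘ Sum.inl)).2 b (v ∘ Sum.inr ∘ Sum.inl)) (Sum.inr j) := by
    intro b
    have h := EffV.reindex (invV b) fun l _ => (Sum.inr : Fin (𝓓.xLen l) → _)
    exact h
  have good : ∀ b : Bool, Eff fun l (_ : P l) (v : DecodeWire F l → Bool) =>
      F.goodChk l (F.gen l (v ∘ Sum.inl)).1 b
        (fun j => encOpt (F.inv l (F.gen l (v ∘ Sum.inl)).2 b (v ∘ Sum.inr ∘ Sum.inl)) (Sum.inr j))
        (F.gen l (v ∘ Sum.inl)).2 (v ∘ Sum.inr ∘ Sum.inr ∘ Sum.inl) := by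
    intro b
    have h := EffV.elim kV (EffV.elim (cV b) (EffV.elim (xV b) (EffV.elim tV dV)))
    have h' := EffV.comp h F.goodChk_eff hW
      (hk.sum (PolyCard.unit.sum (hx.sum (ht.sum hw))))
    have h'' := EffV.bit h' fun l _ => ()
    exact h''
  have JV : ∀ b : Bool, EffV fun l (_ : P l) (v : DecodeWire F l → Bool) => F.J l fun j =>
      encOpt (F.inv l (F.gen l (v ∘ Sum.inl)).2 b (v ∘ Sum.inr ∘ Sum.inl)) (Sum.inr j) := by
    intro b
    have h := EffV.comp (xV b) F.J_eff hW hx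
    exact h
  have hdot := Eff.parity hW hw (Eff.op hW dV (Eff.xor (JV false) (JV true)) and)
  beta_reduce at hdot
  have hb : Eff fun l (_ : P l) (v : DecodeWire F l → Bool) =>
    v (Sum.inr (Sum.inr (Sum.inr ()))) := Eff.bit hW fun _ _ => Sum.inr (Sum.inr (Sum.inr ()))
  have h := Eff.ite hW (Eff.op hW (Eff.op hW (flag false) (flag true) and)
    (Eff.op hW (good false) (good true) and) and) hdot hb
  convert h using 4 with l p v
  unfold decodeOn decodeBit
  rcases F.inv l (F.gen l (v ∘ Sum.inl)).2 false (v ∘ Sum.inr ∘ Sum.inl) with _ | x₀ <;>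
    rcases F.inv l (F.gen l (v ∘ Sum.inl)).2 true (v ∘ Sum.inr ∘ Sum.inl) with _ | x₁
  · simp [encOpt]
  · simp [encOpt]
  · simp [encOpt]
  · simp [encOpt, dot_eq_parity, xorBits]

/-- The ways to obtain the key for a qubit. -/
inductive KeySource
  | fromF
  | fromG
  | given
  deriving DecidableEq

variable (F : NTCF 𝓓) (G : TrapdoorInjective 𝓓)

/-- Coins for the key generation of both families and for the decoding, for each of the qubits. -/
abbrev Coins (n : ℕ → ℕ) (l : ℕ) : Type := Fin (n l) × (Fin (F.coins l) ⊕ (Fin (G.coins l) ⊕ Unit))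

/-- The key of a qubit. -/
def sourceKey (l : ℕ) (k : Bits (𝓓.kLen l)) (r : Bits (F.coins l)) (s : Bits (G.coins l)) :
    KeySource → Bits (𝓓.kLen l)
  | .fromF => (F.gen l r).1
  | .fromG => (G.gen l s).1
  | .given => k

/-- The sources of the keys, and the qubits that are decoded. -/
abbrev Mode (n : ℕ → ℕ) (l : ℕ) : Type := (Fin (n l) → KeySource) × Bits (n l)

/-- For a `given` key the register `Fin (𝓓.kLen l)` is the input and no matching trapdoor is among
the coins; the reduction uses this source for a qubit that is not decoded. -/
def keyBits (l : ℕ) (p : Mode n l) (v : Fin (𝓓.kLen l) ⊕ Coins F G n l → Bool)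
    (q : Fin (n l) × Fin (𝓓.kLen l)) : Bool :=
  sourceKey F G l (v ∘ Sum.inl) (fun j => v (Sum.inr (q.1, Sum.inl j)))
    (fun j => v (Sum.inr (q.1, Sum.inr (Sum.inl j)))) (p.1 q.1) q.2

lemma Coins.polyCard (hn : PolyBounded n) : PolyCard fun l => Coins F G n l :=
  hn.polyCard.prod (F.coins_poly.polyCard.sum (G.coins_poly.polyCard.sum PolyCard.unit))

lemma effV_keyBits (hn : PolyBounded n) :
    EffV fun l (p : Mode n l) v => keyBits F G l p v := by
  have hW : PolyCard fun l => Fin (𝓓.kLen l) ⊕ Coins F G n l :=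
    𝓓.kLen_poly.polyCard.sum (Coins.polyCard F G hn)
  have h1 : EffV fun l (i : Fin (n l)) (v : Fin (𝓓.kLen l) ⊕ Coins F G n l → Bool)
    (j : Fin (F.coins l)) => v (Sum.inr (i, Sum.inl j)) :=
    EffV.vars hW fun _ i j => Sum.inr (i, Sum.inl j)
  have h2 : EffV fun l (i : Fin (n l)) (v : Fin (𝓓.kLen l) ⊕ Coins F G n l → Bool)
    (j : Fin (G.coins l)) => v (Sum.inr (i, Sum.inr (Sum.inl j))) :=
    EffV.vars hW fun _ i j => Sum.inr (i, Sum.inr (Sum.inl j))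
  have h3 : EffV fun l (i : Fin (n l)) (v : Fin (𝓓.kLen l) ⊕ Coins F G n l → Bool) =>
    v ∘ Sum.inl := EffV.vars hW fun _ _ => Sum.inl
  have hF := EffV.reindex (EffV.comp h1 F.gen_eff hW F.coins_poly.polyCard)
    fun l _ => (Sum.inl : Fin (𝓓.kLen l) → _)
  have hG := EffV.reindex (EffV.comp h2 G.gen_eff hW G.coins_poly.polyCard)
    fun l _ => (Sum.inl : Fin (𝓓.kLen l) → _)
  have hF' := Eff.param hF fun l (p : Mode n l × (Fin (n l) × Fin (𝓓.kLen l))) => p.2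
  have hG' := Eff.param hG fun l (p : Mode n l × (Fin (n l) × Fin (𝓓.kLen l))) => p.2
  have h3' := Eff.param h3 fun l (p : Mode n l × (Fin (n l) × Fin (𝓓.kLen l))) => p.2
  have h := Eff.cases hF' (Eff.cases hG' h3' fun l p => p.1.1 p.2.1 = .fromG)
    fun l p => p.1.1 p.2.1 = .fromF
  unfold EffV
  convert h using 4 with l p v
  obtain ⟨⟨p, _⟩, i, j⟩ := p
  simp only [keyBits]
  rcases p i <;> simp [sourceKey]

/-- The registers from which a qubit is decoded. -/
def decodeWire {e' : ℕ} (l : ℕ) (i : Fin (n l)) :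
    DecodeWire F l → HWire (n l) (𝓓.xLen l) (𝓓.yLen l) (𝓓.kLen l) e' (F.w l) ⊕
      Side (n l) (𝓓.yLen l) (Fin (𝓓.kLen l)) (Coins F G n l) :=
  Sum.elim (fun j => Sum.inr (Sum.inl (Sum.inr (i, Sum.inl j))))
    (Sum.elim (fun j => Sum.inr (Sum.inr (i, j))) (Sum.elim (fun j => Sum.inl (Sum.inr (i, j)))
      fun _ => Sum.inr (Sum.inl (Sum.inr (i, Sum.inr (Sum.inr ()))))))

/-- The phase that corrects the committed qubits. -/
def decodePhase {e' : ℕ} (l : ℕ) (p : Mode n l)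
    (u : HWire (n l) (𝓓.xLen l) (𝓓.yLen l) (𝓓.kLen l) e' (F.w l) ⊕
      Side (n l) (𝓓.yLen l) (Fin (𝓓.kLen l)) (Coins F G n l) → Bool) : Bool :=
  parity Finset.univ fun i => u (Sum.inl (comEmb i)) && (p.2 i && decodeOn F l fun q => u (decodeWire F G l i q))

lemma eff_decodePhase_aux {W : ℕ → Type} [∀ l, Fintype (W l)] [∀ l, DecidableEq (W l)]
    (hn : PolyBounded n) (hW : PolyCard W) (c : ∀ l, Fin (n l) → W l)
    (t : ∀ l, Fin (n l) → DecodeWire F l → W l) :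
    Eff fun l (p : Mode n l) (u : W l → Bool) => parity Finset.univ fun i =>
      u (c l i) && (p.2 i && decodeOn F l fun q => u (t l i q)) := by
  have hv := Eff.bit (P := fun l => (Mode n l × Fin (n l)) × DecodeWire F l) hW
    fun l p => t l p.1.2 p.2
  have hd := Eff.subst (P := fun l => Mode n l × Fin (n l))
    (f := fun l p (u : W l → Bool) (q : DecodeWire F l) => u (t l p.2 q))
    hW (DecodeWire.polyCard F) (eff_decodeOn F) hv
  have hc := Eff.bit (P := fun l => Mode n l × Fin (n l)) hW fun l p => c l p.2
  have hf := Eff.const (P := fun l => Mode n l × Fin (n l)) hW fun l p => p.1.2 p.2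
  have h := Eff.parity hW hn.polyCard (Eff.op hW hc (Eff.op hW hf hd and) and)
  exact h

lemma eff_decodePhase {e : ℕ → ℕ} (hn : PolyBounded n) (he : PolyBounded e) :
    Eff fun l (p : Mode n l) u => decodePhase F G (e' := e l) l p u := by
  have hW : PolyCard fun l => HWire (n l) (𝓓.xLen l) (𝓓.yLen l) (𝓓.kLen l) (e l) (F.w l) ⊕
      Side (n l) (𝓓.yLen l) (Fin (𝓓.kLen l)) (Coins F G n l) :=
    ((PolyCard.wire hn 𝓓.xLen_poly 𝓓.yLen_poly 𝓓.kLen_poly he).sum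
      (hn.polyCard.prod F.w_poly.polyCard)).sum
      ((𝓓.kLen_poly.polyCard.sum (Coins.polyCard F G hn)).sum
        (hn.polyCard.prod 𝓓.yLen_poly.polyCard))
  have h := eff_decodePhase_aux F hn hW (fun l i => Sum.inl (comEmb i)) fun l i =>
    decodeWire F G l i
  exact h

/-- The Hadamard round with keys from given sources, as a map from a key to the decoded state. -/
def Prover.channel {F : NTCF 𝓓} (G : TrapdoorInjective 𝓓) (P : Prover F n) (l : ℕ) (p : Mode n l) :
    Op (Fin (𝓓.kLen l)) → Op (Fin (n l)) :=
  experiment (Circuit.toOp (P.U₀ l)) (keyBits F G l p) (F.J l) (F.Jinv l) (P.S l)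
    (decodePhase F G l p)

lemma Prover.effR_channel {F : NTCF 𝓓} (P : Prover F n) (hn : PolyBounded n) :
    EffR fun l (p : Mode n l) => P.channel G l p := by
  have he : PolyBounded P.aux := P.U₀_eff.mono fun l => Nat.le_add_right _ _
  exact effR_experiment hn 𝓓.xLen_poly 𝓓.yLen_poly 𝓓.kLen_poly he F.w_poly 𝓓.kLen_poly.polyCard
    (Coins.polyCard F G hn) (P.U₀_eff.mono fun l => Nat.le_add_left _ _) (effV_keyBits F G hn)
    F.J_eff F.Jinv_eff P.S_eff (eff_decodePhase F G hn he)

end Verifier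


/-! ## Positivity and trace -/

section Positivity
variable {ι κ W : Type} [Fintype ι] [DecidableEq ι] [Fintype κ] [DecidableEq κ] [Fintype W]
  [DecidableEq W]

lemma posSemidef_traceOut (e : κ ↪ W) {σ : Op W} (hσ : σ.PosSemidef) :
    (traceOut e σ).PosSemidef := by
  obtain ⟨γ, _, _, w, hw⟩ := exists_frame e
  have h : traceOut e σ = ∑ g, σ.submatrix (fun a => join w a g) fun a => join w a g := by
    ext z z'
    rw [traceOut_join hw, Matrix.sum_apply]
    rfl
  rw [h]
  exact Matrix.posSemidef_sum _ fun g _ => hσ.submatrix _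

lemma trace_traceOut (e : κ ↪ W) (σ : Op W) : (traceOut e σ).trace = σ.trace := by
  obtain ⟨γ, _, _, w, hw⟩ := exists_frame e
  simp only [Matrix.trace, Matrix.diag_apply, traceOut_join hw]
  rw [sum_join w]

lemma QProc.posSemidef_apply (A : QProc ι κ) {ρ : Op ι} (hρ : ρ.PosSemidef) :
    (A.apply ρ).PosSemidef := by
  rw [A.apply_eq]
  exact posSemidef_traceOut _ ((hρ.mul_mul_conjTranspose_same _).mul_mul_conjTranspose_same _)

lemma QProc.trace_apply (A : QProc ι κ) (ρ : Op ι) : (A.apply ρ).trace = ρ.trace := by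
  rw [A.apply_eq, trace_traceOut, Matrix.trace_mul_comm, ← Matrix.mul_assoc,
    Circuit.conjTranspose_mul_toOp, Matrix.one_mul, ap, Matrix.trace_mul_comm, ← Matrix.mul_assoc,
    iso_conjTranspose_mul, Matrix.one_mul]

lemma isDensityMatrix_ketbra (x : ι → Bool) : IsDensityMatrix (ketbra x) := by
  have h : ketbra x = Matrix.diagonal (Pi.single x 1) := by
    rw [ketbra, Matrix.diagonal_single]
  constructor
  · rw [h, Matrix.posSemidef_diagonal_iff]
    intro i
    by_cases hi : i = x
    · subst hi; simp
    · simp [hi]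
  · simp [h, Matrix.trace]

lemma QProc.isDensityMatrix_apply (A : QProc ι κ) {ρ : Op ι} (hρ : IsDensityMatrix ρ) :
    IsDensityMatrix (A.apply ρ) :=
  ⟨A.posSemidef_apply hρ.1, by rw [A.trace_apply, hρ.2]⟩

/-- For positive semidefinite `M`, vanishing of the quadratic form at a vector forces `M` to
annihilate that vector. -/
lemma posSemidef_eq_zero_of_diag {A : Type} [Fintype A] [DecidableEq A] {M : Matrix A A ℂ}
    (hM : M.PosSemidef) {u : A} (hu : M u u = 0) (v : A) : M u v = 0 ∧ M v u = 0 := by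
  have h1 : M *ᵥ Pi.single u 1 = 0 := by
    rw [← hM.dotProduct_mulVec_zero_iff]
    simp [hu, Pi.star_single]
  have h2 : M v u = 0 := by
    have := congrFun h1 v
    simpa [Matrix.mulVec_single_one] using this
  refine ⟨?_, h2⟩
  have := hM.1.apply u v
  rw [← this, h2, star_zero]

/-- The standard basis measurement. -/
def dephase (ρ : Op ι) : Op ι := Matrix.diagonal fun x => ρ x x

/-- A measurement is implemented by copying the qubits with CNOTs onto fresh ones and discarding the
copies; off-diagonal entries would need two different copies to agree. -/
lemma dephase_eq (ρ : Op ι) :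
    dephase ρ = traceOut Function.Embedding.inl ((xorVec (id : (ι → Bool) → ι → Bool)) *
      ap Function.Embedding.inl ρ * (xorVec (id : (ι → Bool) → ι → Bool))ᴴ) := by
  have hx : ∀ (M : Op (ι ⊕ ι)) (u v : ι ⊕ ι → Bool), (xorVec (id : (ι → Bool) → ι → Bool) * M *
      (xorVec (id : (ι → Bool) → ι → Bool))ᴴ : Op (ι ⊕ ι)) u v
      = M (xorVecBits id u) (xorVecBits id v) := by
    intro M u v
    have h := fm_mul_apply_of_involutive (B := ι ⊕ ι → Bool)
      (xorVecBits_involutive (id : (ι → Bool) → ι → Bool))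
    rw [xorVec, Matrix.mul_assoc, h]
    have h2 : (M * (fm (xorVecBits (id : (ι → Bool) → ι → Bool)))ᴴ) (xorVecBits id u) v
        = star ((fm (xorVecBits (id : (ι → Bool) → ι → Bool)) * Mᴴ) v (xorVecBits id u)) := by
      rw [← Matrix.conjTranspose_apply, Matrix.conjTranspose_mul, Matrix.conjTranspose_conjTranspose]
    rw [h2, h, Matrix.conjTranspose_apply, star_star]
  ext a a'
  rw [traceOut_inl, Matrix.sum_apply]
  have h : ∀ g : ι → Bool, blk (xorVec id * ap Function.Embedding.inl ρ * (xorVec id)ᴴ) g g a a'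
      = if g = a ∧ g = a' then ρ a a' else 0 := by
    intro g
    rw [blk, hx]
    have e : ∀ b : ι → Bool, xorVecBits id (Sum.elim b g)
        = join (Equiv.refl (ι ⊕ ι)) b fun i => xor (g i) (b i) := by
      intro b
      funext q
      rcases q with q | q <;> rfl
    have e' : ∀ b : ι → Bool, ((fun i => xor (g i) (b i)) = fun _ => false) ↔ g = b := by
      intro b
      simp [funext_iff]
    rw [e, e, ap_join isFrame_inl]
    simp only [e']
  simp only [h, dephase, Matrix.diagonal_apply]
  by_cases haa : a = a'
  · subst haa; simp
  · rw [if_neg haa, Finset.sum_eq_zero]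
    intro g _
    rw [if_neg]
    rintro ⟨rfl, h'⟩
    exact haa h'

lemma dephase_eq_sum (ρ : Op ι) : dephase ρ = ∑ x, ρ x x • ketbra x := by
  ext a b
  simp only [dephase, Matrix.sum_apply, Matrix.smul_apply, ketbra, Matrix.single_apply,
    Matrix.diagonal_apply, smul_eq_mul]
  by_cases h : a = b
  · subst h; simp
  · rw [if_neg h, Finset.sum_eq_zero]
    intro x _
    rw [if_neg, mul_zero]
    rintro ⟨rfl, h'⟩
    exact h h'

end Positivity

/-! ## Decoding -/

section Weigh
variable {n x y k e w : ℕ}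

/-- The committed qubits, after `Z` has been applied to qubit `i` with weight `wt i d true` if `d` is
the content of the `i`-th appended register. -/
def weigh (wt : Fin n → Bits w → Bool → ℂ) (τ : Op (HWire n x y k e w)) : Op (Fin n) := fun a a' =>
  ∑ d : Fin n → Bits w, traceOut comEmb (fun u v => if jReg u = d ∧ jReg v = d then τ u v else 0) a a'
    * ∏ i, ∑ c : Bool, wt i (d i) c * if c = true ∧ a i ≠ a' i then -1 else 1

lemma jReg_join {γ : Type} {f : Fin n ⊕ γ ≃ Wire n x y k e ⊕ (Fin n × Fin w)}
    (hf : IsFrame comEmb f) (a a' : Fin n → Bool) (g : γ → Bool) :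
    jReg (join f a g) = jReg (join f a' g) := by
  funext i j
  refine (hf.agree (a := a) (a' := a') (g' := g)).2 rfl _ ?_
  rintro ⟨b, hb⟩
  simp [comEmb] at hb

/-- The appended registers lie in the discarded part `g`, so for given `g` exactly one `d`
contributes. -/
lemma weigh_join {γ : Type} [Fintype γ] [DecidableEq γ]
    {f : Fin n ⊕ γ ≃ Wire n x y k e ⊕ (Fin n × Fin w)}
    (hf : IsFrame comEmb f) (wt : Fin n → Bits w → Bool → ℂ) (τ : Op (HWire n x y k e w))
    (a a' : Fin n → Bool) : weigh wt τ a a' = ∑ g, τ (join f a g) (join f a' g) *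
      ∏ i, ∑ c : Bool, wt i (jReg (join f a g) i) c * if c = true ∧ a i ≠ a' i then -1 else 1 := by
  have h : ∀ d : Fin n → Bits w, traceOut comEmb
      (fun u v => if jReg u = d ∧ jReg v = d then τ u v else 0) a a'
      = ∑ g, if jReg (join f a g) = d ∧ jReg (join f a' g) = d then τ (join f a g) (join f a' g)
          else 0 := fun d => traceOut_join hf _ a a'
  simp only [weigh, h, Finset.sum_mul]
  rw [Finset.sum_comm]
  refine Finset.sum_congr rfl fun g _ => ?_
  rw [Finset.sum_eq_single (jReg (join f a g))]
  · rw [if_pos ⟨rfl, jReg_join hf _ _ _⟩]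
  · intro d _ hd
    rw [if_neg fun h => hd h.1.symm, zero_mul]
  · simp

lemma sign_parity {J : Type} [DecidableEq J] (S : Finset J) (φ : J → Bool) :
    (if parity S φ = true then (-1 : ℂ) else 1) = ∏ j ∈ S, if φ j = true then -1 else 1 := by
  induction S using Finset.induction_on with
  | empty => simp [parity]
  | insert a S ha ih =>
    rw [parity_insert ha, Finset.prod_insert ha, ← ih]
    cases φ a <;> cases parity S φ <;> simp

/-- The phases of row `a` and column `a'` multiply to a sign for each qubit, which is `-1` precisely
when the decoding bit is set and `a i` differs from `a' i`. This is conjugation by `Z`. -/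
lemma traceOut_phaseOp (D : Fin n → Bits w → Bool) (τ : Op (HWire n x y k e w)) :
    traceOut comEmb (phaseOp (fun u => parity Finset.univ fun i => u (comEmb i) && D i (jReg u i)) *
      τ * phaseOp fun u => parity Finset.univ fun i => u (comEmb i) && D i (jReg u i))
      = weigh (fun i d c => if D i d = c then 1 else 0) τ := by
  obtain ⟨γ, _, _, f, hf⟩ := exists_frame (comEmb : Fin n ↪ HWire n x y k e w)
  ext a a'
  rw [traceOut_join hf, weigh_join hf]
  refine Finset.sum_congr rfl fun g _ => ?_
  have hc : ∀ (b : Fin n → Bool) i, join f b g (comEmb i) = b i := fun b i => congrFun (hf.comp b g) i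
  rw [phaseOp, Matrix.mul_diagonal, Matrix.diagonal_mul, sign_parity, sign_parity,
    jReg_join hf a' a, mul_comm, ← mul_assoc, ← Finset.prod_mul_distrib, mul_comm]
  congr 1
  refine Finset.prod_congr rfl fun i _ => ?_
  rw [hc, hc]
  cases D i (jReg (join f a g) i) <;> cases a i <;> cases a' i <;> simp

/-- The qubits that are measured in the Hadamard basis to obtain `d` and the measurement results of
the decoded committed qubits. -/
def selBasis (h : Bits n) : HWire n x y k e w → Bool
  | .inl (.com i) => h i
  | .inl _ => false
  | .inr _ => true

lemma hadOn_selBasis (h : Bits n) : hadOn (selBasis h)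
    = lift comEmb (hadOn h) * hadOn (selPre : HWire n x y k e w → Bool) := by
  have h1 : lift (comEmb : Fin n ↪ HWire n x y k e w) (hadOn h)
      = hadOn fun q => match q with | .inl (.com i) => h i | _ => false := by
    refine lift_hadOn _ (fun i => rfl) ?_
    intro q hq
    rcases q with (i | _ | _ | _ | _) | _
    · exact absurd ⟨i, rfl⟩ hq
    all_goals rfl
  rw [h1, hadOn_mul]
  · congr 1
    funext q
    rcases q with (i | _ | _ | _ | _) | _ <;> simp [selBasis, selPre]
  · intro q
    rcases q with (i | _ | _ | _ | _) | _ <;> simp [selPre]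

/-- The heart of decoding, for one qubit. In the Hadamard basis `H Z = X H`, so applying `Z` with
weight `v true` is the same as XORing the outcome with a bit of weight `v`. In the standard basis
`Z` is diagonal and only the total weight 1 is seen. -/
lemma had1_weigh (v : Bool → ℂ) (hv : ∑ c, v c = 1) (h m a a' : Bool) :
    had1 h m a * had1 h a' m * ∑ c, (v c * if c = true ∧ a ≠ a' then -1 else 1)
      = ∑ b, (if h = true then v (xor m b) else if m = b then 1 else 0) *
          (had1 h b a * had1 h a' b) := by
  rw [Fintype.sum_bool] at hv
  cases h
  · cases m <;> cases a <;> cases a' <;> simp [had1, hv]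
  · simp only [had1_mul_had1, Fintype.sum_bool]
    cases m <;> cases a <;> cases a' <;> simp <;> ring

lemma sum_rearrange {A B C D : Type} [Fintype A] [Fintype B] [Fintype C] [Fintype D]
    (F : A → B → C → D → ℂ) :
    ∑ a, ∑ b, ∑ c, ∑ d, F a b c d = ∑ d, ∑ c, ∑ a, ∑ b, F a b c d := by
  have h1 : ∀ a, ∑ b, ∑ c, ∑ d, F a b c d = ∑ d, ∑ c, ∑ b, F a b c d := by
    intro a
    rw [Finset.sum_comm, Finset.sum_congr rfl fun c _ => Finset.sum_comm, Finset.sum_comm]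
  simp only [h1]
  rw [Finset.sum_comm]
  exact Finset.sum_congr rfl fun d _ => Finset.sum_comm

lemma lift_mul_mul_lift_join {ι γ W : Type} [Fintype ι] [DecidableEq ι] [Fintype γ] [DecidableEq γ]
    [Fintype W] [DecidableEq W] {e : ι ↪ W} {f : ι ⊕ γ ≃ W} (hf : IsFrame e f) (M N : Op ι)
    (τ : Op W) (a b : ι → Bool) (g g' : γ → Bool) :
    (lift e M * τ * lift e N : Op W) (join f a g) (join f b g')
      = ∑ a', ∑ b', M a b' * τ (join f b' g) (join f a' g') * N a' b := by
  rw [mul_lift_join hf]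
  refine Finset.sum_congr rfl fun a' _ => ?_
  rw [lift_mul_join hf, Finset.sum_mul]

lemma hadOn_weigh_join {γ : Type} [Fintype γ] [DecidableEq γ]
    {f : Fin n ⊕ γ ≃ Wire n x y k e ⊕ (Fin n × Fin w)} (hf : IsFrame comEmb f)
    (wt : Fin n → Bits w → Bool → ℂ) (hwt : ∀ i d, ∑ c, wt i d c = 1)
    (τ : Op (HWire n x y k e w)) (h m a a' : Bits n) :
    hadOn h m a * weigh wt τ a a' * hadOn h a' m
      = ∑ g, ∑ b : Fin n → Bool, (∏ i, if h i = true then wt i (jReg (join f b g) i) (xor (m i) (b i))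
          else if m i = b i then 1 else 0) *
          (hadOn h b a * τ (join f a g) (join f a' g) * hadOn h a' b) := by
  rw [weigh_join hf, Finset.mul_sum, Finset.sum_mul]
  refine Finset.sum_congr rfl fun g _ => ?_
  have hp := prod_sum_bits fun i b => (if h i = true then wt i (jReg (join f a g) i) (xor (m i) b)
    else if m i = b then 1 else 0) * (had1 (h i) b (a i) * had1 (h i) (a' i) b)
  have hq : ∀ i, _ := fun i => had1_weigh (wt i (jReg (join f a g) i)) (hwt _ _) (h i) (m i) (a i) (a' i)
  rw [← Finset.prod_congr rfl fun i _ => hq i, Finset.prod_mul_distrib, Finset.prod_mul_distrib,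
    ← hadOn_apply, ← hadOn_apply] at hp
  have : ∀ X Y Z T : ℂ, X * (Y * Z) * T = X * T * Z * Y := by intros; ring
  rw [this, hp, Finset.sum_mul]
  refine Finset.sum_congr rfl fun b _ => ?_
  rw [Finset.prod_mul_distrib, Finset.prod_mul_distrib, ← hadOn_apply, ← hadOn_apply,
    jReg_join hf b a]
  ring

/-- The product of the one-qubit identities over all qubits, with the sums exchanged: decoding
before the measurement becomes classical post-processing of its outcomes. -/
lemma hadOn_weigh_diag (wt : Fin n → Bits w → Bool → ℂ) (hwt : ∀ i d, ∑ c, wt i d c = 1)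
    (τ : Op (HWire n x y k e w)) (h m : Bits n) :
    (hadOn h * weigh wt τ * hadOn h) m m
      = ∑ u, (∏ i, if h i = true then wt i (jReg u i) (xor (m i) (u (comEmb i)))
          else if m i = u (comEmb i) then 1 else 0) *
        (lift comEmb (hadOn h) * τ * lift comEmb (hadOn h) : Op (HWire n x y k e w)) u u := by
  obtain ⟨γ, _, _, f, hf⟩ := exists_frame (comEmb : Fin n ↪ HWire n x y k e w)
  have hc : ∀ (b : Fin n → Bool) g i, join f b g (comEmb i) = b i :=
    fun b g i => congrFun (hf.comp b g) i
  have hL : (hadOn h * weigh wt τ * hadOn h) m m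
      = ∑ a', ∑ a, hadOn h m a * weigh wt τ a a' * hadOn h a' m := by
    simp only [Matrix.mul_apply, Finset.sum_mul]
  rw [hL, sum_join f]
  simp only [hc, lift_mul_mul_lift_join hf, hadOn_weigh_join hf wt hwt, Finset.mul_sum]
  exact sum_rearrange _

lemma weigh_hadOn_diag (wt : Fin n → Bits w → Bool → ℂ) (hwt : ∀ i d, ∑ c, wt i d c = 1)
    (A : Op (HWire n x y k e w)) (h m : Bits n) :
    (hadOn h * weigh wt (hadOn selPre * A * (hadOn selPre)ᴴ) * (hadOn h)ᴴ) m m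
      = ∑ u, (∏ i, if h i = true then wt i (jReg u i) (xor (m i) (u (comEmb i)))
          else if m i = u (comEmb i) then 1 else 0) *
        (hadOn (selBasis h) * A * (hadOn (selBasis h))ᴴ : Op (HWire n x y k e w)) u u := by
  rw [hadOn_conjTranspose h, hadOn_weigh_diag wt hwt]
  rw [hadOn_selBasis, Matrix.conjTranspose_mul, lift_conjTranspose, hadOn_conjTranspose h]
  simp only [Matrix.mul_assoc]

end Weigh


/-! ### The coherent circuit as an average over keys and coins -/

section Channel
variable {𝓓 : Domains} {n : ℕ → ℕ} {F : NTCF 𝓓} (G : TrapdoorInjective 𝓓) (P : Prover F n) (l : ℕ)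

/-- The probabilities of the decoding bits; only the qubits selected by `flags` are decoded. -/
def decodeWeight (F : NTCF 𝓓) (l : ℕ) (flags : Bits (n l)) (r : Fin (n l) → Bits (F.coins l))
    (y : Fin (n l) → Bits (𝓓.yLen l)) (i : Fin (n l)) (d : Bits (F.w l)) (c : Bool) : ℂ :=
  if flags i = true then (decodeProb l F (F.gen l (r i)) (y i) d c : ℂ) else if c = false then 1 else 0

lemma decodeWeight_sum (flags : Bits (n l)) (r : Fin (n l) → Bits (F.coins l))
    (y : Fin (n l) → Bits (𝓓.yLen l)) (i : Fin (n l)) (d : Bits (F.w l)) :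
    ∑ c, decodeWeight F l flags r y i d c = 1 := by
  unfold decodeWeight
  by_cases hf : flags i = true
  · simp only [if_pos hf]
    rw [← Complex.ofReal_sum, decodeProb_sum, Complex.ofReal_one]
  · simp [if_neg hf]

/-- The state after the Hadamard measurement of the appended registers. -/
def Prover.measured (k' : Fin (n l) → Bits (𝓓.kLen l)) (y : Fin (n l) → Bits (𝓓.yLen l)) :
    Op (HWire (n l) (𝓓.xLen l) (𝓓.yLen l) (𝓓.kLen l) (P.aux l) (F.w l)) :=
  hadOn selPre * P.attacked l k' y * (hadOn selPre)ᴴ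

/-- The decoded committed qubits for the keys `k'`. -/
def Prover.decoded (flags : Bits (n l)) (r : Fin (n l) → Bits (F.coins l))
    (k' : Fin (n l) → Bits (𝓓.kLen l)) : Op (Fin (n l)) :=
  ∑ y : Fin (n l) → Bits (𝓓.yLen l), weigh (decodeWeight F l flags r y) (P.measured l k' y)

/-- The keys of all qubits. -/
def sourceKeys (F : NTCF 𝓓) (src : Fin (n l) → KeySource) (k : Bits (𝓓.kLen l))
    (r : Fin (n l) → Bits (F.coins l)) (s : Fin (n l) → Bits (G.coins l)) :
    Fin (n l) → Bits (𝓓.kLen l) := fun i => sourceKey F G l k (r i) (s i) (src i)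

/-- The coins, sorted by their purpose. -/
def coinsEquiv (N a b : ℕ) : ((Fin N → Bits a) × (Fin N → Bits b)) × (Fin N → Bool) ≃
    (Fin N × (Fin a ⊕ (Fin b ⊕ Unit)) → Bool) where
  toFun p q := match q.2 with
    | .inl j => p.1.1 q.1 j
    | .inr (.inl j) => p.1.2 q.1 j
    | .inr (.inr _) => p.2 q.1
  invFun v := ((fun i j => v (i, Sum.inl j), fun i j => v (i, Sum.inr (Sum.inl j))),
    fun i => v (i, Sum.inr (Sum.inr ())))
  left_inv _ := rfl
  right_inv v := by
    funext q
    rcases q with ⟨i, j | j | j⟩ <;> rfl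

lemma sum_rows {N a : ℕ} {M : Type} [AddCommMonoid M] (f : (Fin N × Fin a → Bool) → M) :
    ∑ c, f c = ∑ y : Fin N → Bits a, f fun p => y p.1 p.2 := by
  rw [← (Equiv.curry (Fin N) (Fin a) Bool).symm.sum_comp]
  rfl

/-- Averaging over the decoding coins turns deterministic decoding into the probabilities
`decodeWeight`. The sum factors over the qubits, and a coin that is not used contributes a bare
factor 2. -/
lemma sum_weigh_decodeBit (flags : Bits (n l)) (r : Fin (n l) → Bits (F.coins l))
    (y : Fin (n l) → Bits (𝓓.yLen l)) {e' : ℕ}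
    (τ : Op (HWire (n l) (𝓓.xLen l) (𝓓.yLen l) (𝓓.kLen l) e' (F.w l))) :
    ∑ t : Fin (n l) → Bool, weigh (fun i d c =>
      if (flags i && decodeBit l F (F.gen l (r i)) (y i) d (t i)) = c then 1 else 0) τ
      = (2 ^ n l : ℂ) • weigh (decodeWeight F l flags r y) τ := by
  ext a a'
  simp only [Matrix.sum_apply, Matrix.smul_apply, weigh, smul_eq_mul, Finset.mul_sum]
  rw [Finset.sum_comm]
  refine Finset.sum_congr rfl fun d _ => ?_
  rw [← Finset.mul_sum, mul_left_comm]
  congr 1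
  rw [← prod_sum_bits fun i t => ∑ c : Bool,
    (if (flags i && decodeBit l F (F.gen l (r i)) (y i) (d i) t) = c then (1 : ℂ) else 0) *
      if c = true ∧ a i ≠ a' i then -1 else 1]
  have h2 : (2 ^ n l : ℂ) = ∏ _i : Fin (n l), (2 : ℂ) := by simp
  rw [h2, ← Finset.prod_mul_distrib]
  refine Finset.prod_congr rfl fun i _ => ?_
  rw [Finset.sum_comm, Finset.mul_sum]
  refine Finset.sum_congr rfl fun c _ => ?_
  rw [← Finset.sum_mul, ← mul_assoc]
  congr 1
  unfold decodeWeight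
  by_cases hf : flags i = true
  · simp only [hf, Bool.true_and, if_true, decodeProb_eq]
    push_cast
    simp only [apply_ite Complex.ofReal, Complex.ofReal_one, Complex.ofReal_zero]
    ring
  · have hf' : flags i = false := by simpa using hf
    cases c <;> simp [hf']

/-- Correctness of the circuit: on a basis key it yields the exact average over the key generation
coins. The `n l` decoding coins cancel against the factor from `sum_weigh_decodeBit`. -/
lemma Prover.channel_ketbra (p : Mode n l) (k : Bits (𝓓.kLen l)) :
    P.channel G l p (ketbra k) = (1 / (2 ^ (n l * F.coins l) * 2 ^ (n l * G.coins l)) : ℂ) •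
      ∑ r : Fin (n l) → Bits (F.coins l), ∑ s : Fin (n l) → Bits (G.coins l),
        P.decoded l p.2 r (sourceKeys G l F p.1 k r s) := by
  have hcard : Fintype.card (Coins F G n l) = n l * F.coins l + n l * G.coins l + n l := by
    simp only [Fintype.card_prod, Fintype.card_sum, Fintype.card_fin, Fintype.card_unit]
    ring
  rw [Prover.channel, experiment_ketbra, ← (coinsEquiv (n l) (F.coins l) (G.coins l)).sum_comp,
    Fintype.sum_prod_type, Fintype.sum_prod_type, Finset.smul_sum]
  refine Finset.sum_congr rfl fun r _ => ?_
  rw [Finset.smul_sum]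
  refine Finset.sum_congr rfl fun s _ => ?_
  rw [Prover.decoded, Finset.smul_sum]
  simp only [sum_rows]
  rw [Finset.sum_comm]
  refine Finset.sum_congr rfl fun y _ => ?_
  have h : ∀ t : Fin (n l) → Bool, (1 / 2 ^ Fintype.card (Coins F G n l) : ℂ) •
      weigh (fun i d c => if (p.2 i && decodeBit l F (F.gen l (r i)) (y i) d (t i)) = c
        then 1 else 0) (P.measured l (sourceKeys G l F p.1 k r s) y)
      = (1 / 2 ^ Fintype.card (Coins F G n l) : ℂ) • traceOut comEmb
        (phaseOp (fun u => decodePhase F G l p (Sum.elim u (Sum.elim (Sum.elim k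
          (coinsEquiv (n l) (F.coins l) (G.coins l) ((r, s), t))) fun p => y p.1 p.2))) *
          P.measured l (sourceKeys G l F p.1 k r s) y *
          phaseOp (fun u => decodePhase F G l p (Sum.elim u (Sum.elim (Sum.elim k
          (coinsEquiv (n l) (F.coins l) (G.coins l) ((r, s), t))) fun p => y p.1 p.2)))) := by
    intro t
    rw [← traceOut_phaseOp]
    rfl
  refine (Finset.sum_congr rfl fun t _ => (h t).symm).trans ?_
  rw [← Finset.smul_sum, sum_weigh_decodeBit, smul_smul, hcard]
  congr 1
  rw [pow_add, pow_add]
  field_simp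

/-- With every key from `GEN_F` and every qubit decoded, neither the input key nor the coins for `G`
matter, so any `k` serves to prepare the target state. -/
lemma Prover.channel_fromF (k : Bits (𝓓.kLen l)) :
    P.channel G l (fun _ => .fromF, fun _ => true) (ketbra k) = P.decodedState l := by
  rw [P.channel_ketbra]
  ext a a'
  have hk : ∀ (r : Fin (n l) → Bits (F.coins l)) (s : Fin (n l) → Bits (G.coins l)),
      sourceKeys (n := n) G l F (fun _ => .fromF) k r s = fun i => (F.gen l (r i)).1 :=
    fun r s => rfl
  have hD : P.decodedState l a a' = (∑ r : Fin (n l) → Bits (F.coins l),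
      P.decoded l (fun _ => true) r (fun i => (F.gen l (r i)).1) a a') / 2 ^ (n l * F.coins l) := by
    simp only [Prover.decoded, Matrix.sum_apply]
    rfl
  rw [hD, Matrix.smul_apply, Matrix.sum_apply, smul_eq_mul]
  simp only [hk, Finset.sum_const, Finset.card_univ, Fintype.card_fun, Fintype.card_bool,
    Fintype.card_fin, Matrix.smul_apply, nsmul_eq_mul, ← Finset.mul_sum]
  rw [← pow_mul, mul_comm (G.coins l) (n l)]
  push_cast
  field_simp

end Channel


/-! ## Measurements in the Hadamard basis -/

section Marginal
variable {W : Type} [Fintype W] [DecidableEq W]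

lemma eq_of_hadOn_ne_zero {s u v : W → Bool} (h : hadOn s u v ≠ 0) {q : W} (hq : s q = false) :
    u q = v q := by
  by_contra hne
  refine h (Finset.prod_eq_zero (Finset.mem_univ q) ?_)
  simp [hq, hne]

/-- A function that does not depend on the qubits `t` is a diagonal operator commuting with the
Hadamards on `t`; these cancel by cyclicity of the trace. The basis in which ignored qubits are
measured is thus irrelevant. -/
lemma sum_hadOn_diag (s t : W → Bool) (hst : ∀ q, (t q && s q) = false) (A : Op W)
    (Φ : (W → Bool) → ℂ) (hΦ : ∀ u v, (∀ q, t q = false → u q = v q) → Φ u = Φ v) :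
    ∑ u, Φ u * (hadOn (fun q => t q || s q) * A * (hadOn fun q => t q || s q)ᴴ : Op W) u u
      = ∑ u, Φ u * (hadOn s * A * (hadOn s)ᴴ : Op W) u u := by
  have hT : ∀ M : Op W, ∑ u, Φ u * M u u = (Matrix.diagonal Φ * M).trace := by
    intro M
    simp [Matrix.trace, Matrix.diagonal_mul]
  have hc : hadOn t * Matrix.diagonal Φ = Matrix.diagonal Φ * hadOn t := by
    ext u v
    rw [Matrix.mul_diagonal, Matrix.diagonal_mul]
    by_cases h : hadOn t u v = 0
    · simp [h]
    · rw [hΦ u v fun q hq => eq_of_hadOn_ne_zero h hq, mul_comm]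
  rw [hT, hT, ← hadOn_mul t s hst, Matrix.conjTranspose_mul, hadOn_conjTranspose t]
  have : Matrix.diagonal Φ * (hadOn t * hadOn s * A * ((hadOn s)ᴴ * hadOn t))
      = Matrix.diagonal Φ * hadOn t * (hadOn s * A * (hadOn s)ᴴ) * hadOn t := by
    simp only [Matrix.mul_assoc]
  rw [this, Matrix.trace_mul_comm, ← hc]
  simp only [← Matrix.mul_assoc, hadOn_mul_self, Matrix.one_mul]

lemma exists_of_hadOn_ne_zero {s u : W → Bool} {A : Op W}
    (h : (hadOn s * A * (hadOn s)ᴴ : Op W) u u ≠ 0) :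
    ∃ v v', A v v' ≠ 0 ∧ ∀ q, s q = false → u q = v q := by
  rw [Matrix.mul_apply] at h
  obtain ⟨v', _, h⟩ := Finset.exists_ne_zero_of_sum_ne_zero h
  replace h := left_ne_zero_of_mul h
  rw [Matrix.mul_apply] at h
  obtain ⟨v, _, h⟩ := Finset.exists_ne_zero_of_sum_ne_zero h
  exact ⟨v, v', right_ne_zero_of_mul h, fun q hq => eq_of_hadOn_ne_zero (left_ne_zero_of_mul h) hq⟩

end Marginal

/-! ## Perfect and trivial provers -/

section Trivial
variable {𝓓 : Domains} {n : ℕ → ℕ} {F : NTCF 𝓓} {G : TrapdoorInjective 𝓓} {P : Prover F n} {l : ℕ}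

lemma Prover.sum_norm_amp (P : Prover F n) (l : ℕ) (k' : Fin (n l) → Bits (𝓓.kLen l)) :
    ∑ u, ‖P.amp l k' u‖ ^ 2 = 1 := by
  have h := congrFun (congrFun (Circuit.conjTranspose_mul_toOp (P.U₀ l)) (initBits k')) (initBits k')
  rw [Matrix.mul_apply, Matrix.one_apply_eq] at h
  have h2 : ((∑ u, ‖P.amp l k' u‖ ^ 2 : ℝ) : ℂ) = 1 := by
    rw [← h]
    push_cast
    refine Finset.sum_congr rfl fun u _ => ?_
    rw [Matrix.conjTranspose_apply, Prover.amp, ← Complex.conj_mul']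
    rfl
  exact_mod_cast h2

/-- For every choice of coins the squared amplitudes sum to 1, so acceptance probability 1 leaves no
room for a rejected basis string of nonzero amplitude, whatever the coins. -/
lemma Prover.Perfect.accept (hP : P.Perfect G) {h : Bits (n l)} {r : Fin (n l) → Bits (F.coins l)}
    {s : Fin (n l) → Bits (G.coins l)}
    {u : Wire (n l) (𝓓.xLen l) (𝓓.yLen l) (𝓓.kLen l) (P.aux l) → Bool}
    (hu : P.amp l (verifierKeys G l F h r s) u ≠ 0) :
    ∀ i, (fun j => u (.pre i j)) ∈ 𝓓.X l ∧ (fun j => u (.str i j)) ∈ 𝓓.Y l ∧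
      (if h i = true then F.chk else G.chk) l (verifierKeys G l F h r s i) (u (.com i))
        (fun j => u (.pre i j)) (fun j => u (.str i j)) = true := by
  classical
  by_contra hacc
  have h1 := hP l h
  unfold Prover.testAccept at h1
  rw [div_eq_one_iff_eq (by positivity)] at h1
  have h2 : ∑ r : Fin (n l) → Bits (F.coins l), ∑ s : Fin (n l) → Bits (G.coins l),
      ∑ u : Wire (n l) (𝓓.xLen l) (𝓓.yLen l) (𝓓.kLen l) (P.aux l) → Bool,
        ‖P.amp l (verifierKeys G l F h r s) u‖ ^ 2
      = (2 : ℝ) ^ (n l * F.coins l) * 2 ^ (n l * G.coins l) := by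
    simp only [P.sum_norm_amp, Finset.sum_const, Finset.card_univ, Fintype.card_fun,
      Fintype.card_bool, Fintype.card_fin, nsmul_eq_mul, mul_one]
    push_cast
    rw [← pow_mul, ← pow_mul, mul_comm (F.coins l), mul_comm (G.coins l)]
  rw [← h2] at h1
  have hle : ∀ (r : Fin (n l) → Bits (F.coins l)) (s : Fin (n l) → Bits (G.coins l))
      (u : Wire (n l) (𝓓.xLen l) (𝓓.yLen l) (𝓓.kLen l) (P.aux l) → Bool),
      (if ∀ i, (fun j => u (.pre i j)) ∈ 𝓓.X l ∧ (fun j => u (.str i j)) ∈ 𝓓.Y l ∧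
          (if h i = true then F.chk else G.chk) l (verifierKeys G l F h r s i) (u (.com i))
            (fun j => u (.pre i j)) (fun j => u (.str i j)) = true
        then ‖P.amp l (verifierKeys G l F h r s) u‖ ^ 2 else 0)
        ≤ ‖P.amp l (verifierKeys G l F h r s) u‖ ^ 2 := by
    intro r s u
    split_ifs
    · exact le_rfl
    · positivity
  refine absurd h1 (ne_of_lt ?_)
  refine Finset.sum_lt_sum (fun r _ => Finset.sum_le_sum fun s _ => Finset.sum_le_sum fun u _ =>
    hle r s u) ⟨r, Finset.mem_univ r, ?_⟩
  refine Finset.sum_lt_sum (fun s _ => Finset.sum_le_sum fun u _ => hle r s u)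
    ⟨s, Finset.mem_univ s, ?_⟩
  refine Finset.sum_lt_sum (fun u _ => hle r s u) ⟨u, Finset.mem_univ u, ?_⟩
  rw [if_neg hacc]
  have := norm_pos_iff.2 hu
  positivity

/-- Acceptance places the commitment string in the support of the density of the actual bit and
preimage; for an injective key the trapdoor recovers both. -/
lemma Prover.Perfect.inv_eq (hP : P.Perfect G) {h : Bits (n l)}
    {r : Fin (n l) → Bits (F.coins l)} {s : Fin (n l) → Bits (G.coins l)}
    {u : Wire (n l) (𝓓.xLen l) (𝓓.yLen l) (𝓓.kLen l) (P.aux l) → Bool}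
    (hu : P.amp l (verifierKeys G l F h r s) u ≠ 0) {i : Fin (n l)} (hi : h i = false) :
    G.inv l (G.gen l (s i)).2 (fun j => u (.str i j)) = some (u (.com i), fun j => u (.pre i j)) := by
  obtain ⟨h1, h2, h3⟩ := hP.accept hu i
  have hk : verifierKeys G l F h r s i = (G.gen l (s i)).1 := by simp [verifierKeys, hi]
  rw [hk] at h3
  simp only [hi, Bool.false_eq_true, if_false] at h3
  exact G.inv_spec l (s i) _ _ h1 _ ((G.chk_spec l _ (G.gen_mem l (s i)) _ _ h1 _ h2).1 h3)

lemma comProj_mul_uJ {N x y k e w : ℕ} (J : Bits x → Bits w) (Jinv : Bits w → Bits x) (b : Bits N) :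
    comProj b * (uJ J Jinv : Op (HWire N x y k e w)) = uJ J Jinv * comProj b := by
  have h : (uJ J Jinv : Op (HWire N x y k e w)) = fm (uJBits J Jinv) := rfl
  rw [h, comProj, diagonal_mul_fm]
  rfl

lemma Prover.committed_eq (P : Prover F n) (l : ℕ) (k' : Fin (n l) → Bits (𝓓.kLen l))
    (y : Fin (n l) → Bits (𝓓.yLen l)) : P.committed l k' y
      = Matrix.vecMulVec (commitVec (Circuit.toOp (P.U₀ l)) k' y)
        (star (commitVec (Circuit.toOp (P.U₀ l)) k' y)) := rfl

lemma Prover.posSemidef_attacked (P : Prover F n) (l : ℕ) (k' : Fin (n l) → Bits (𝓓.kLen l))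
    (y : Fin (n l) → Bits (𝓓.yLen l)) : (P.attacked l k' y).PosSemidef := by
  rw [Prover.attacked, P.committed_eq]
  exact QProc.posSemidef_apply _
    ((Matrix.posSemidef_vecMulVec_self_star _).mul_mul_conjTranspose_same _)

/-- `U_J` and `S` cannot create new values of the committed bits. If a value is absent from the
committed state, the projection onto it commutes through `U_J` and `S` and annihilates the output;
positivity then kills the whole row, not only the diagonal entry. -/
lemma Prover.Trivial.exists_commitVec_ne_zero (hP : P.Trivial G)
    {k' : Fin (n l) → Bits (𝓓.kLen l)} {y : Fin (n l) → Bits (𝓓.yLen l)}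
    {v v' : HWire (n l) (𝓓.xLen l) (𝓓.yLen l) (𝓓.kLen l) (P.aux l) (F.w l) → Bool}
    (hv : P.attacked l k' y v v' ≠ 0) :
    ∃ u, commitVec (w := F.w l) (Circuit.toOp (P.U₀ l)) k' y u ≠ 0 ∧ u ∘ comEmb = v ∘ comEmb := by
  by_contra! hno
  have hz : comProj (v ∘ comEmb) * P.committed l k' y = 0 := by
    ext u u'
    rw [comProj, Matrix.diagonal_mul, P.committed_eq, Matrix.vecMulVec_apply]
    by_cases hu : u ∘ comEmb = v ∘ comEmb
    · have : commitVec (w := F.w l) (Circuit.toOp (P.U₀ l)) k' y u = 0 := by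
        by_contra h0
        exact hno u h0 hu
      simp [this]
    · simp [hu]
  have h1 := hP.2 l (v ∘ comEmb) (uJ (F.J l) (F.Jinv l) * P.committed l k' y *
    (uJ (F.J l) (F.Jinv l))ᴴ)
  have h2 : comProj (v ∘ comEmb) * (uJ (F.J l) (F.Jinv l) * P.committed l k' y *
      (uJ (F.J l) (F.Jinv l))ᴴ) = 0 := by
    rw [← Matrix.mul_assoc, ← Matrix.mul_assoc, comProj_mul_uJ, Matrix.mul_assoc (uJ _ _), hz,
      Matrix.mul_zero, Matrix.zero_mul]
  rw [h2, Matrix.zero_mul, QProc.apply_zero] at h1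
  have h3 := congrFun (congrFun h1 v) v
  rw [comProj, Matrix.mul_diagonal, Matrix.diagonal_mul, if_pos rfl, one_mul, mul_one] at h3
  exact hv (posSemidef_eq_zero_of_diag (P.posSemidef_attacked l k' y) h3 v').1

/-- Measurement in the bases `h`, as a linear function of the state. -/
def measL {N : ℕ} (h m : Bits N) : Op (Fin N) →ₗ[ℂ] ℂ where
  toFun ρ := (hadOn h * ρ * (hadOn h)ᴴ) m m
  map_add' ρ σ := by rw [Matrix.mul_add, Matrix.add_mul, Matrix.add_apply]
  map_smul' c ρ := by
    rw [Matrix.mul_smul, Matrix.smul_mul, Matrix.smul_apply, RingHom.id_apply]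

lemma measDist_eq {N : ℕ} (ρ : Op (Fin N)) (h m : Bits N) : measDist ρ h m = (measL h m ρ).re := rfl

/-- The right-hand side does not mention `flags`: decoding a qubit that is measured in the standard
basis has no effect on the results. -/
lemma Prover.measL_decoded (P : Prover F n) (h m flags : Bits (n l))
    (hf : ∀ i, h i = true → flags i = true) (r : Fin (n l) → Bits (F.coins l))
    (k' : Fin (n l) → Bits (𝓓.kLen l)) :
    measL h m (P.decoded l flags r k') = ∑ y : Fin (n l) → Bits (𝓓.yLen l), ∑ u,
      (∏ i, if h i = true then
          (decodeProb l F (F.gen l (r i)) (y i) (jReg u i) (xor (m i) (u (comEmb i))) : ℂ)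
        else if m i = u (comEmb i) then 1 else 0) *
      (hadOn (selBasis h) * P.attacked l k' y * (hadOn (selBasis h))ᴴ :
        Op (HWire (n l) (𝓓.xLen l) (𝓓.yLen l) (𝓓.kLen l) (P.aux l) (F.w l))) u u := by
  rw [Prover.decoded, map_sum]
  refine Finset.sum_congr rfl fun y _ => ?_
  refine (weigh_hadOn_diag _ (decodeWeight_sum l flags r y) _ h m).trans ?_
  refine Finset.sum_congr rfl fun u _ => ?_
  congr 1
  refine Finset.prod_congr rfl fun i _ => ?_
  by_cases hi : h i = true
  · simp only [hi, decodeWeight, hf i hi, if_true]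
  · simp only [if_neg hi]

lemma sum_outcome (P : Prover F n) (k' : Fin (n l) → Bits (𝓓.kLen l))
    (y : Fin (n l) → Bits (𝓓.yLen l)) (Φ : Bits (n l) → (Fin (n l) → Bits (F.w l)) → ℝ) :
    ∑ b : Bits (n l), ∑ d : Fin (n l) → Bits (F.w l), P.outcome l k' y b d * Φ b d
      = (∑ u, (Φ (u ∘ comEmb) (jReg u) : ℂ) *
        (hadOn selComPre * P.attacked l k' y * (hadOn selComPre)ᴴ :
          Op (HWire (n l) (𝓓.xLen l) (𝓓.yLen l) (𝓓.kLen l) (P.aux l) (F.w l))) u u).re := by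
  simp only [Prover.outcome, Finset.sum_mul, Complex.re_sum, Complex.re_ofReal_mul]
  rw [Finset.sum_congr rfl fun b _ => Finset.sum_comm, Finset.sum_comm]
  refine Finset.sum_congr rfl fun u _ => ?_
  rw [Finset.sum_eq_single (u ∘ comEmb), Finset.sum_eq_single (jReg u)]
  · rw [if_pos ⟨rfl, rfl⟩, mul_comm]
  · intro d _ hd
    rw [if_neg fun h => hd h.2.symm, zero_mul]
  · simp
  · intro b _ hb
    refine Finset.sum_eq_zero fun d _ => ?_
    rw [if_neg fun h => hb h.1.symm, zero_mul]
  · simp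

/-- The committed qubits that are measured in the standard basis. -/
def selStd {N x y k e w : ℕ} (h : Bits N) : HWire N x y k e w → Bool
  | .inl (.com i) => !(h i)
  | _ => false

lemma selComPre_eq {N x y k e w : ℕ} (h : Bits N) :
    (selComPre : HWire N x y k e w → Bool) = fun q => selStd h q || selBasis h q := by
  funext q
  rcases q with (i | _ | _ | _ | _) | _ <;> simp [selComPre, selStd, selBasis]

/-- For each choice of coins the verifier's rule agrees exactly with measuring the partially decoded
state. Hadamard positions need only the XOR rule; at the others the trapdoor inverse equals the
standard basis result. -/
lemma Prover.Trivial.sum_standard (hP : P.Trivial G) (h m : Bits (n l))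
    (r : Fin (n l) → Bits (F.coins l)) (s : Fin (n l) → Bits (G.coins l)) :
    ∑ y : Fin (n l) → Bits (𝓓.yLen l), ∑ b : Bits (n l), ∑ d : Fin (n l) → Bits (F.w l),
      P.outcome l (verifierKeys G l F h r s) y b d *
        ∏ i, (if h i = true then decodeProb l F (F.gen l (r i)) (y i) (d i) (xor (m i) (b i))
          else standardProb G l (G.gen l (s i)).2 (y i) (m i))
      = (measL h m (P.decoded l h r (verifierKeys G l F h r s))).re := by
  rw [P.measL_decoded h m h (fun _ hi => hi), Complex.re_sum]
  refine Finset.sum_congr rfl fun y _ => ?_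
  rw [sum_outcome P _ y fun b d => ∏ i, if h i = true then
    decodeProb l F (F.gen l (r i)) (y i) (d i) (xor (m i) (b i))
      else standardProb G l (G.gen l (s i)).2 (y i) (m i)]
  congr 1
  -- The weights ignore the reported bits at positions with `h i` false, so the Hadamards on those
  -- qubits can be dropped.
  rw [selComPre_eq h, sum_hadOn_diag]
  · refine Finset.sum_congr rfl fun u _ => ?_
    by_cases hu : (hadOn (selBasis h) * P.attacked l (verifierKeys G l F h r s) y *
      (hadOn (selBasis h))ᴴ :
        Op (HWire (n l) (𝓓.xLen l) (𝓓.yLen l) (𝓓.kLen l) (P.aux l) (F.w l))) u u = 0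
    · rw [hu, mul_zero, mul_zero]
    congr 1
    push_cast
    refine Finset.prod_congr rfl fun i _ => ?_
    by_cases hi : h i = true
    · rw [if_pos hi, if_pos hi]
      rfl
    rw [if_neg hi, if_neg hi]
    have hi' : h i = false := by simpa using hi
    -- An outcome that occurs is traced back to a basis string `z` of nonzero amplitude before `U_J`
    -- and `S`, with the same bit at position `i`; `inv_eq` applies to `z`.
    obtain ⟨v, v', hv, huv⟩ := exists_of_hadOn_ne_zero hu
    obtain ⟨z, hz, hzv⟩ := hP.exists_commitVec_ne_zero hv
    unfold commitVec at hz
    split_ifs at hz with hz'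
    · have hinv := hP.1.inv_eq (r := r) (s := s) hz hi'
      have hy : (fun j => (z ∘ Sum.inl) (.str i j)) = y i := funext fun j => hz'.2 i j
      have hc : (z ∘ Sum.inl) (.com i) = u (comEmb i) := by
        rw [huv (comEmb i) hi']
        exact congrFun hzv i
      rw [hy, hc] at hinv
      rw [standardProb, hinv]
      simp only
      split_ifs <;> simp
    · exact absurd rfl hz
  · intro q
    rcases q with (i | _ | _ | _ | _) | _ <;> simp [selStd, selBasis]
  · intro u v huv
    refine congrArg Complex.ofReal (Finset.prod_congr rfl fun i _ => ?_)
    have hj : jReg u = jReg v := by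
      funext a b
      exact huv _ rfl
    by_cases hi : h i = true
    · have : u (comEmb i) = v (comEmb i) := huv _ (show (!(h i)) = false by simp [hi])
      simp only [hi, if_true, hj, Function.comp_apply, this]
    · simp only [if_neg hi]

lemma Prover.Trivial.dist_eq (hP : P.Trivial G) (h m : Bits (n l)) (k : Bits (𝓓.kLen l)) :
    P.dist G l h m
      = measDist (P.channel G l (fun i => if h i = true then .fromF else .fromG, h) (ketbra k)) h m := by
  have hk : ∀ (r : Fin (n l) → Bits (F.coins l)) (s : Fin (n l) → Bits (G.coins l)),
      sourceKeys (n := n) G l F (fun i => if h i = true then .fromF else .fromG) k r s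
        = verifierKeys G l F h r s := by
    intro r s
    funext i
    rw [sourceKeys, verifierKeys]
    split_ifs <;> rfl
  rw [P.channel_ketbra, measDist_eq, map_smul, map_sum, Prover.dist, div_eq_inv_mul]
  simp only [map_sum, hk, hP.sum_standard]
  have hc : (1 / (2 ^ (n l * F.coins l) * 2 ^ (n l * G.coins l)) : ℂ)
      = (((2 ^ (n l * F.coins l) * 2 ^ (n l * G.coins l) : ℝ)⁻¹ : ℝ) : ℂ) := by
    push_cast
    rw [one_div]
  rw [hc, smul_eq_mul, Complex.re_ofReal_mul, Complex.re_sum]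
  simp only [Complex.re_sum]

end Trivial


/-! ## Replacing the keys one by one -/

section Hybrid
variable {𝓓 : Domains} {n : ℕ → ℕ} {F : NTCF 𝓓} {G : TrapdoorInjective 𝓓} {P : Prover F n} {l : ℕ}

/-- The acceptance probability of a test, applied to the measurement results. -/
def testL {N : ℕ} (A : QProc (Fin N) Unit) (h : Bits N) : Op (Fin N) →ₗ[ℂ] ℂ :=
  ∑ x, (A.prob x (fun _ => false) : ℂ) • measL h x

lemma testL_re {N : ℕ} (A : QProc (Fin N) Unit) (h : Bits N) (ρ : Op (Fin N)) :
    (testL A h ρ).re = ∑ x, measDist ρ h x * A.prob x fun _ => false := by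
  simp only [testL, LinearMap.sum_apply, LinearMap.smul_apply, smul_eq_mul, Complex.re_sum,
    Complex.re_ofReal_mul, measDist_eq]
  exact Finset.sum_congr rfl fun x _ => mul_comm _ _

/-- Expresses the linear test functional as the physical procedure of rotating, measuring and
running `A`. Taking real parts in `prob` loses nothing, since the output is Hermitian. -/
lemma testL_eq {N : ℕ} (A : QProc (Fin N) Unit) (h : Bits N) (ρ : Op (Fin N)) :
    testL A h ρ = A.apply (dephase (hadOn h * ρ * (hadOn h)ᴴ)) (fun _ => false) fun _ => false := by
  rw [dephase_eq_sum, QProc.apply_sum, Matrix.sum_apply, testL, LinearMap.sum_apply]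
  refine Finset.sum_congr rfl fun x _ => ?_
  rw [QProc.apply_smul, Matrix.smul_apply, LinearMap.smul_apply, smul_eq_mul, smul_eq_mul, mul_comm]
  congr 1
  have hA := (A.posSemidef_apply (isDensityMatrix_ketbra x).1).1
  rw [QProc.prob]
  exact hA.coe_re_apply_self _

/-- Resampling one coordinate keeps a tuple uniform: exchanging the fresh value with the old
coordinate is an involution. -/
lemma sum_update {N : ℕ} {α : Type} [Fintype α] (j : Fin N) (f : (Fin N → α) → ℂ) :
    ∑ a, ∑ r, f (Function.update r j a) = Fintype.card α * ∑ r, f r := by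
  let σ : α × (Fin N → α) → α × (Fin N → α) := fun p => (p.2 j, Function.update p.2 j p.1)
  have hσ : Function.Involutive σ := by
    intro p
    simp [σ]
  rw [← Fintype.sum_prod_type' fun a r => f (Function.update r j a)]
  refine (Equiv.sum_comp hσ.toPerm fun p => f p.2).trans ?_
  rw [Fintype.sum_prod_type]
  simp

/-- The sources of the keys in the `j`-th hybrid. -/
def hybridSource {N : ℕ} (h : Bits N) (j : ℕ) (i : Fin N) : KeySource :=
  if h i = true ∨ i.val < j then .fromF else .fromG

/-- The sources of the keys if the `j`-th key is given. -/
def givenSource {N : ℕ} (h : Bits N) (j : ℕ) (i : Fin N) : KeySource :=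
  if i.val = j then .given else hybridSource h j i

/-- The state in the `j`-th hybrid. -/
def Prover.hybrid (G : TrapdoorInjective 𝓓) (P : Prover F n) (l : ℕ) (h : Bits (n l)) (j : ℕ) :
    Op (Fin (n l)) :=
  P.channel G l (hybridSource h j, h) (ketbra fun _ => false)

lemma Prover.decoded_update (P : Prover F n) {flags : Bits (n l)} {j : Fin (n l)}
    (hj : flags j = false) (r : Fin (n l) → Bits (F.coins l)) (a : Bits (F.coins l))
    (k' : Fin (n l) → Bits (𝓓.kLen l)) :
    P.decoded l flags (Function.update r j a) k' = P.decoded l flags r k' := by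
  have h : ∀ y, decodeWeight F l flags (Function.update r j a) y = decodeWeight F l flags r y := by
    intro y
    funext i d c
    unfold decodeWeight
    by_cases hi : i = j
    · subst hi
      simp [hj]
    · rw [Function.update_of_ne hi]
  simp only [Prover.decoded, h]

lemma sourceKeys_givenSource_fromF {h : Bits (n l)} {j : Fin (n l)} (k : Bits (𝓓.kLen l))
    (a : Bits (F.coins l)) (r : Fin (n l) → Bits (F.coins l)) (s : Fin (n l) → Bits (G.coins l)) :
    sourceKeys G l F (givenSource h j) (F.gen l a).1 r s
      = sourceKeys G l F (hybridSource h (j + 1)) k (Function.update r j a) s := by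
  funext i
  unfold sourceKeys givenSource hybridSource
  by_cases hi : i = j
  · subst hi
    simp [sourceKey]
  · have hi' : i.val ≠ j.val := fun h => hi (Fin.ext h)
    have h1 : i.val < j.val + 1 ↔ i.val < j.val := by omega
    rw [Function.update_of_ne hi, if_neg hi']
    simp only [h1]
    split_ifs <;> rfl

lemma sourceKeys_givenSource_fromG {h : Bits (n l)} {j : Fin (n l)} (hj : h j = false)
    (k : Bits (𝓓.kLen l)) (a : Bits (G.coins l)) (r : Fin (n l) → Bits (F.coins l))
    (s : Fin (n l) → Bits (G.coins l)) :
    sourceKeys G l F (givenSource h j) (G.gen l a).1 r s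
      = sourceKeys G l F (hybridSource h j) k r (Function.update s j a) := by
  funext i
  unfold sourceKeys givenSource hybridSource
  by_cases hi : i = j
  · subst hi
    simp [sourceKey, hj]
  · have hi' : i.val ≠ j.val := fun h => hi (Fin.ext h)
    rw [Function.update_of_ne hi, if_neg hi']
    split_ifs <;> rfl

lemma expect_re {𝒢 : KeyGen 𝓓} {φ : Bits (𝓓.kLen l) → ℂ} {z : ℂ}
    (h : ∑ a, φ (𝒢.gen l a).1 = (2 ^ 𝒢.coins l : ℂ) * z) :
    𝒢.expect l (fun k => (φ k).re) = z.re := by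
  rw [KeyGen.expect, ← Complex.re_sum, h]
  have : (2 ^ 𝒢.coins l : ℂ) = ((2 ^ 𝒢.coins l : ℝ) : ℂ) := by push_cast; rfl
  rw [this, Complex.re_ofReal_mul]
  field_simp

lemma card_bits (a : ℕ) : (Fintype.card (Bits a) : ℂ) = 2 ^ a := by
  simp

/-- The coins that generate the given key take the place of the `j`-th coins of `F`. This
replacement would also change the trapdoor used in decoding, which is harmless because qubit `j` is
not decoded. -/
lemma Prover.expect_fromF (G : TrapdoorInjective 𝓓) (P : Prover F n) {h : Bits (n l)}
    {j : Fin (n l)} (hj : h j = false) (T : Op (Fin (n l)) →ₗ[ℂ] ℂ) :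
    F.expect l (fun k => (T (P.channel G l (givenSource h j, h) (ketbra k))).re)
      = (T (P.hybrid G l h (j + 1))).re := by
  refine expect_re ?_
  simp only [Prover.hybrid, P.channel_ketbra, map_smul, map_sum, smul_eq_mul]
  rw [← Finset.mul_sum, mul_left_comm]
  congr 1
  simp only [sourceKeys_givenSource_fromF (h := h) (j := j) (fun _ => false)]
  rw [← card_bits, ← sum_update j]
  simp only [P.decoded_update hj]

lemma Prover.expect_fromG (G : TrapdoorInjective 𝓓) (P : Prover F n) {h : Bits (n l)}
    {j : Fin (n l)} (hj : h j = false) (T : Op (Fin (n l)) →ₗ[ℂ] ℂ) :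
    G.expect l (fun k => (T (P.channel G l (givenSource h j, h) (ketbra k))).re)
      = (T (P.hybrid G l h j)).re := by
  refine expect_re ?_
  simp only [Prover.hybrid, P.channel_ketbra, map_smul, map_sum, smul_eq_mul]
  rw [← Finset.mul_sum, mul_left_comm]
  congr 1
  simp only [sourceKeys_givenSource_fromG hj (fun _ => false)]
  rw [Finset.sum_comm, Finset.mul_sum]
  refine Finset.sum_congr rfl fun r _ => ?_
  rw [← card_bits, ← sum_update j]

/-- The adversary against injective invariance: plant the given key, generate the remaining keys,
run the experiment, measure in the bases `h` and apply `A`. -/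
lemma Prover.exists_reduction (G : TrapdoorInjective 𝓓) (P : Prover F n) (hn : PolyBounded n)
    {A : ∀ l, QProc (Fin (n l)) Unit} (hA : QPT A) (h : ∀ l, Bits (n l)) (p : ∀ l, Mode n l) :
    ∃ B : ∀ l, QProc (Fin (𝓓.kLen l)) Unit, QPT B ∧ ∀ l k,
      (B l).prob k (fun _ => false) = (testL (A l) (h l) (P.channel G l (p l) (ketbra k))).re := by
  obtain ⟨s, hs, hch⟩ := P.effR_channel (G := G) hn
  have h1 : EffR fun l (p : Mode n l × Bits (n l)) => P.channel G l p.1 := ⟨s, hs, fun l p => hch l p.1⟩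
  have h2 := (EffU.hadOn hn.polyCard fun l (p : Mode n l × Bits (n l)) => p.2).realizes
    (fun l => Function.Embedding.refl _) fun l => Function.Embedding.refl _
  have hid : EffV fun l (_ : Mode n l × Bits (n l)) => (id : (Fin (n l) → Bool) → Fin (n l) → Bool) :=
    EffV.vars hn.polyCard fun l _ i => i
  have h3 := (hid.xorVec hn.polyCard hn.polyCard).realizes
    (fun l => Function.Embedding.inl) fun l => Function.Embedding.inl
  have h4 := hA.effR (P := fun l => Mode n l × Bits (n l)) hn.polyCard
  have h5 := EffR.comp h4 (EffR.comp h3 (EffR.comp h2 h1))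
  obtain ⟨B, hB, hB'⟩ := h5.exists_qPT fun l => (p l, h l)
  refine ⟨B, hB, fun l k => ?_⟩
  rw [QProc.prob, hB', testL_eq]
  simp only [ap_refl, traceOut_refl]
  rw [← dephase_eq]

end Hybrid


/-! ### The hybrid argument and the resulting state -/

section Conclusion
variable {𝓓 : Domains} {n : ℕ → ℕ} {F : NTCF 𝓓} {G : TrapdoorInjective 𝓓}

lemma Negligible.polyBounded_mul {μ : ℕ → ℝ} (hμ : Negligible μ) {s : ℕ → ℕ} (hs : PolyBounded s) :
    Negligible fun l => s l * μ l := by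
  obtain ⟨p, hp⟩ := hs
  refine (Asymptotics.SuperpolynomialDecay.polynomial_mul hμ (p.map (Nat.castRingHom ℝ))).trans_abs_le
    fun l => ?_
  have h : ((p.map (Nat.castRingHom ℝ)).eval (l : ℝ)) = ((p.eval l : ℕ) : ℝ) := by
    rw [Polynomial.eval_natCast_map]
    rfl
  rw [h, abs_mul, abs_mul, Nat.abs_cast, Nat.abs_cast]
  exact mul_le_mul_of_nonneg_right (by exact_mod_cast hp l) (abs_nonneg _)

lemma Prover.hybrid_succ_of_true (P : Prover F n) {l : ℕ} {h : Bits (n l)} {j : Fin (n l)}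
    (hj : h j = true) : P.hybrid G l h (j + 1) = P.hybrid G l h j := by
  have : hybridSource h (j + 1) = hybridSource h j := by
    funext i
    unfold hybridSource
    by_cases hi : i = j
    · subst hi; simp [hj]
    · have hi' : i.val ≠ j.val := fun h => hi (Fin.ext h)
      have h1 : i.val < j.val + 1 ↔ i.val < j.val := by omega
      simp only [h1]
  rw [Prover.hybrid, this, Prover.hybrid]

/-- The position `j` may vary with the security parameter. If `h` is true there, the two hybrids
coincide; otherwise their difference is exactly the advantage of the reduction. -/
lemma InjectiveInvariant.hybrid_step (hFG : InjectiveInvariant F G) (hn : PolyBounded n)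
    (P : Prover F n) {A : ∀ l, QProc (Fin (n l)) Unit} (hA : QPT A) (h : ∀ l, Bits (n l))
    (j : ℕ → ℕ) : ∃ μ : ℕ → ℝ, Negligible μ ∧ ∀ l, j l < n l →
      |(testL (A l) (h l) (P.hybrid G l (h l) (j l + 1))).re
        - (testL (A l) (h l) (P.hybrid G l (h l) (j l))).re| ≤ μ l := by
  obtain ⟨B, hB, hB'⟩ := P.exists_reduction G hn hA h fun l => (givenSource (h l) (j l), h l)
  obtain ⟨μ, hμ, hμ'⟩ := hFG.indist B hB
  refine ⟨μ, hμ, fun l hl => ?_⟩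
  have h1 := hμ' l
  rcases hj : h l ⟨j l, hl⟩ with _ | _
  · simp only [hB'] at h1
    rw [P.expect_fromF G (j := ⟨j l, hl⟩) hj, P.expect_fromG G (j := ⟨j l, hl⟩) hj] at h1
    exact h1
  · rw [P.hybrid_succ_of_true (j := ⟨j l, hl⟩) hj, sub_self, abs_zero]
    exact (abs_nonneg _).trans h1

lemma InjectiveInvariant.hybrid_indist (hFG : InjectiveInvariant F G) (hn : PolyBounded n)
    (P : Prover F n) {A : ∀ l, QProc (Fin (n l)) Unit} (hA : QPT A) (h : ∀ l, Bits (n l)) :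
    ∃ μ : ℕ → ℝ, Negligible μ ∧ ∀ l,
      |(testL (A l) (h l) (P.hybrid G l (h l) 0)).re
        - (testL (A l) (h l) (P.hybrid G l (h l) (n l))).re| ≤ μ l := by
  -- Each fixed sequence of positions has its own negligible bound. Choosing the worst position for
  -- every `l` gives one bound for all steps, and the sum is at most `n l` times it. If `n l = 0`
  -- there are no steps and `j` is arbitrary.
  have hmax : ∀ l, ∃ j, ∀ i < n l, j < n l ∧
      |(testL (A l) (h l) (P.hybrid G l (h l) (i + 1))).re
        - (testL (A l) (h l) (P.hybrid G l (h l) i)).re|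
      ≤ |(testL (A l) (h l) (P.hybrid G l (h l) (j + 1))).re
        - (testL (A l) (h l) (P.hybrid G l (h l) j)).re| := by
    intro l
    rcases (Finset.range (n l)).eq_empty_or_nonempty with h0 | h0
    · refine ⟨0, fun i hi => ?_⟩
      rw [Finset.range_eq_empty_iff] at h0
      omega
    · obtain ⟨j, hj, hj'⟩ := Finset.exists_max_image _ (fun i =>
        |(testL (A l) (h l) (P.hybrid G l (h l) (i + 1))).re
          - (testL (A l) (h l) (P.hybrid G l (h l) i)).re|) h0
      exact ⟨j, fun i hi => ⟨Finset.mem_range.1 hj, hj' i (Finset.mem_range.2 hi)⟩⟩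
  choose j hj using hmax
  obtain ⟨μ, hμ, hμ'⟩ := hFG.hybrid_step hn P hA h j
  refine ⟨_, hμ.polyBounded_mul hn, fun l => ?_⟩
  rw [abs_sub_comm, ← Finset.sum_range_sub (fun i => (testL (A l) (h l) (P.hybrid G l (h l) i)).re)]
  refine (Finset.abs_sum_le_sum_abs _ _).trans ?_
  refine (Finset.sum_le_card_nsmul _ _ (μ l) fun i hi => ?_).trans_eq ?_
  · obtain ⟨h1, h2⟩ := hj l i (Finset.mem_range.1 hi)
    exact h2.trans (hμ' l h1)
  · rw [Finset.card_range, nsmul_eq_mul]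

/-- In the last hybrid all keys come from `GEN_F`, but only the qubits with `h i` true are decoded.
By `measL_decoded`, decoding the others too does not alter the results. -/
lemma Prover.measL_hybrid_last (P : Prover F n) (l : ℕ) (h m : Bits (n l)) :
    measL h m (P.hybrid G l h (n l)) = measL h m (P.decodedState l) := by
  have hs : hybridSource h (n l) = fun _ => .fromF := by
    funext i
    simp [hybridSource]
  have hd : ∀ r k', measL h m (P.decoded l h r k') = measL h m (P.decoded l (fun _ => true) r k') :=
    fun r k' => (P.measL_decoded h m h (fun _ hi => hi) r k').trans
      (P.measL_decoded h m (fun _ => true) (fun _ _ => rfl) r k').symm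
  rw [← P.channel_fromF G l fun _ => false, Prover.hybrid, hs, P.channel_ketbra, P.channel_ketbra]
  simp only [map_smul, map_sum, hd]

lemma Prover.measDist_hybrid_last (P : Prover F n) (l : ℕ) (h m : Bits (n l)) :
    measDist (P.hybrid G l h (n l)) h m = measDist (P.decodedState l) h m :=
  congrArg Complex.re (P.measL_hybrid_last l h m)

lemma Prover.Trivial.measDist_hybrid_zero {P : Prover F n} (hP : P.Trivial G) (l : ℕ)
    (h m : Bits (n l)) : measDist (P.hybrid G l h 0) h m = P.dist G l h m := by
  have hs : hybridSource h 0 = fun i => if h i = true then .fromF else .fromG := by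
    funext i
    simp [hybridSource]
  rw [hP.dist_eq h m fun _ => false, Prover.hybrid, hs]

/-- Feed the all-zero key into the channel; the choice is immaterial by `channel_fromF`. -/
lemma Prover.exists_preparation (G : TrapdoorInjective 𝓓) (P : Prover F n) (hn : PolyBounded n) :
    ∃ A : ∀ l, QProc Empty (Fin (n l)), QPT A ∧
      ∀ l, P.decodedState l = (A l).apply (ketbra fun i => i.elim) := by
  have h1 := (EffU.circuit (P := fun l => Mode n l) 𝓓.kLen_poly.polyCard (C := fun _ => [])
    (PolyBounded.const 0)).realizes
      (fun l => (Function.Embedding.ofIsEmpty : Empty ↪ Fin (𝓓.kLen l)))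
      fun l => Function.Embedding.refl _
  obtain ⟨A, hA, hA'⟩ := ((P.effR_channel (G := G) hn).comp h1).exists_qPT
    fun l => (fun _ => .fromF, fun _ => true)
  refine ⟨A, hA, fun l => ?_⟩
  rw [hA']
  simp only [Circuit.toOp, Matrix.one_mul, Matrix.conjTranspose_one, Matrix.mul_one, traceOut_refl,
    ap_ketbra, P.channel_fromF]

end Conclusion

end MeasProtocol

end

theorem mainTheorem6 {𝓓 : MeasProtocol.Domains} (F : MeasProtocol.NTCF 𝓓)
    (G : MeasProtocol.TrapdoorInjective 𝓓) (hFG : MeasProtocol.ExtendedTCF F G)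
    (n : ℕ → ℕ) (hn : MeasProtocol.PolyBounded n)
    (P : MeasProtocol.Prover F n) (hP : P.Trivial G) :
    ∃ ρ : ∀ l, MeasProtocol.Op (Fin (n l)),
      (∀ l, MeasProtocol.IsDensityMatrix (ρ l)) ∧
      MeasProtocol.EfficientlyPreparable ρ ∧
      (∀ l, ρ l = P.decodedState l) ∧
      ∀ h : ∀ l, MeasProtocol.Bits (n l),
        MeasProtocol.CompIndist (fun l => P.dist G l (h l))
          (fun l => MeasProtocol.measDist (ρ l) (h l)) := by
  obtain ⟨A, hA, hA'⟩ := P.exists_preparation G hn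
  refine ⟨fun l => P.decodedState l, fun l => ?_, ⟨A, hA, hA'⟩, fun _ => rfl, fun h B hB => ?_⟩
  · show MeasProtocol.IsDensityMatrix (P.decodedState l)
    rw [hA' l]
    exact (A l).isDensityMatrix_apply (MeasProtocol.isDensityMatrix_ketbra _)
  · obtain ⟨μ, hμ, hμ'⟩ := hFG.injective_invariant.hybrid_indist hn P hB h
    refine ⟨μ, hμ, fun l => ?_⟩
    have h1 := hμ' l
    simp only [MeasProtocol.testL_re, hP.measDist_hybrid_zero, P.measDist_hybrid_last] at h1
    exact h1
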